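/- Let $K$ be a field of characteristic zero and $\mathfrak g$ a split reductive Lie algebra over $K$ (the Lie algebra of a connected split reductive group $G$), with splitting Cartan subalgebra $\mathfrak h$, root system $\Delta$, a system of simple roots, positive roots $\Delta^+$, root vectors $E_\alpha$ and coroots $H_\alpha=[E_\alpha,E_{-\alpha}]\in\mathfrak h$ with $\alpha(H_\alpha)=2$. Put $\mathfrak u=\bigoplus_{\alpha\in\Delta^+}KE_\alpha$ and $U=\exp\mathfrak u$. Let $S(\mathfrak g)$ be the symmetric algebra with its Poisson bracket $\{\cdot,\cdot\}$ extending the Lie bracket, $F=\mathrm{Frac}\,S(\mathfrak g)$, and let $D_x=\{x,\cdot\}$ for $x\in\mathfrak g$; $U$ acts on $S(\mathfrak g)$ and $F$ through the adjoint representation. Let $\xi_1,\dots,\xi_m$ be a Kostant cascade: put $\Delta_1^+=\Delta^+$; $\xi_i$ is a maximal element of $\Delta_i^+$ (for the order in which $\alpha\ge\beta$ if $\alpha-\beta$ is a sum of simple roots), $\Delta_{i+1}^+=\{\alpha\in\Delta_i^+:(\alpha,\xi_i)=0\}$, and $\Delta_{m+1}^+=\varnothing$. Put $\Gamma_i=\{\alpha\in\Delta_i^+:(\alpha,\xi_i)>0\}$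 and $\Gamma_i^0=\Gamma_i\setminus\{\xi_i\}$; for $\alpha\in\Gamma_i^0$ put $\alpha'=\xi_i-\alpha$ (it lies in $\Gamma_i^0$) and write $[E_\alpha,E_{\alpha'}]=N_{\alpha,\alpha'}E_{\xi_i}$. Let $\mathfrak g_i$ be the span of $\{h\in\mathfrak h:\xi_j(h)=0 \text{ for } j<i\}$ and of all $E_\alpha$, $\alpha\in\Delta$, with $(\alpha,\xi_j)=0$ for $j<i$. Define linear maps $t_i:\mathfrak g_i\to F$ by $t_1(x)=x$ and $t_{i+1}(x)=t_i(x)-b$ for $x\in\mathfrak g_{i+1}$, where $b$ is the unique element of the $K$-span of the $t_i(E_\alpha)t_i(E_\beta)\,t_i(E_{\xi_i})^{-1}$ $(\alpha,\beta\in\Gamma_i^0)$ such that $\{b,t_i(E_\gamma)\}=\{t_i(x),t_i(E_\gamma)\}$ for all $\gamma\in\Gamma_i$. Put $\Xi=\{t_i(E_{\xi_i}):1\le i\le m\}$, let $S(\mathfrak g)_*\subset F$ be the localization of $S(\mathfrak g)$ obtained by inverting the elements of $\Xi$, and let $$Q_{\xi_i}=-\tfrac12\,t_i(H_{\xi_i})\,t_i(E_{\xi_i})^{-1},\qquad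 Q_\alpha=\tfrac1{N_{\alpha,\alpha'}}\,t_i(E_{\alpha'})\,t_i(E_{\xi_i})^{-1}\quad(\alpha\in\Gamma_i^0),$$ $$S_\alpha(a)=\sum_{k\ge0}\frac{(-1)^k}{k!}D_{E_\alpha}^k(a)\,Q_\alpha^k\quad(\alpha\in\Gamma_i),\qquad P_i=\Big(\prod_{\alpha\in\Gamma_i^0}S_\alpha\Big)\circ S_{\xi_i},$$ the product being taken in an arbitrary order. Then $D_x$ is locally nilpotent on $S(\mathfrak g)_*$ for every $x\in\mathfrak u$, and: 1) $P=P_m\circ\cdots\circ P_1$ is a homomorphism of the algebra $S(\mathfrak g)$ into $S(\mathfrak g)_*^U$ which is the identity on $S(\mathfrak g)^U$, i.e. $P$ is a $U$-projector of the adjoint representation. 2) Let $\{H_k\}$ be a basis of the orthogonal complement $\{h\in\mathfrak h:\xi_1(h)=\dots=\xi_m(h)=0\}$ of the cascade in $\mathfrak h$. Then the system $$\{P(E_{-\alpha}):\alpha\in\Delta^+\}\cup\{P(H_k)\}\cup\Xi$$ freely generates $S(\mathfrak g)_*^U$, that is, it is algebraically independent over $K$ and together with the inverses of the elements of $\Xi$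 it generates the algebra $S(\mathfrak g)_*^U$; it also freely generates the field $F^U$ of $U$-invariants. -/

import Mathlib

namespace AdjointProjector

noncomputable section

/-! ### The Poisson structure on the fraction field of the symmetric algebra -/

section Poisson

variable {K g : Type*} [Field K] [LieRing g] [LieAlgebra K g]

/-- The field of fractions of the symmetric algebra `S(g)`. -/
abbrev Fld (K g : Type*) [Field K] [LieRing g] [LieAlgebra K g] : Type _ :=
  FractionRing (SymmetricAlgebra K g)

/-- The inclusion `g → S(g) → Frac S(g)`. -/
def emb : g →ₗ[K] Fld K g :=
  (IsScalarTower.toAlgHom K (SymmetricAlgebra K g) (Fld K g)).toLinearMap ∘ₗ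
    SymmetricAlgebra.ι K g

/-- Auxiliary: the homomorphism `S(g) → F[ε]`, `x ↦ x + f(x) ε`, where `F = Frac S(g)`. -/
def dualHom (f : g →ₗ[K] Fld K g) : SymmetricAlgebra K g →ₐ[K] DualNumber (Fld K g) :=
  SymmetricAlgebra.lift
    ((TrivSqZeroExt.inlAlgHom K (Fld K g) (Fld K g)).toLinearMap ∘ₗ emb +
      (TrivSqZeroExt.inrHom (Fld K g) (Fld K g)).restrictScalars K ∘ₗ f)

theorem fst_dualHom (f : g →ₗ[K] Fld K g) (a : SymmetricAlgebra K g) :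
    (dualHom f a).fst = algebraMap (SymmetricAlgebra K g) (Fld K g) a := by
  have : (TrivSqZeroExt.fstHom K (Fld K g) (Fld K g)).comp (dualHom f) =
      IsScalarTower.toAlgHom K (SymmetricAlgebra K g) (Fld K g) := by
    apply SymmetricAlgebra.algHom_ext
    ext x
    simp [dualHom, emb]
  exact DFunLike.congr_fun this a

/-- Auxiliary: the extension of `dualHom f` to `F = Frac S(g)`. -/
def dualHomFld (f : g →ₗ[K] Fld K g) : Fld K g →ₐ[K] DualNumber (Fld K g) :=
  IsLocalization.liftAlgHom (M := nonZeroDivisors (SymmetricAlgebra K g)) (f := dualHom f) (by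
    intro y
    rw [TrivSqZeroExt.isUnit_iff_isUnit_fst, fst_dualHom]
    exact IsLocalization.map_units (Fld K g) y)

theorem dualHomFld_algebraMap (f : g →ₗ[K] Fld K g) (a : SymmetricAlgebra K g) :
    dualHomFld f (algebraMap _ _ a) = dualHom f a := by
  simp [dualHomFld]

theorem fst_dualHomFld (f : g →ₗ[K] Fld K g) (a : Fld K g) : (dualHomFld f a).fst = a := by
  have : ((TrivSqZeroExt.fstHom K (Fld K g) (Fld K g)).comp (dualHomFld f)) =
      AlgHom.id K (Fld K g) := by
    apply IsLocalization.algHom_ext (nonZeroDivisors (SymmetricAlgebra K g))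
    ext x
    exact (congrArg TrivSqZeroExt.fst (dualHomFld_algebraMap f (SymmetricAlgebra.ι K g x))).trans
      (fst_dualHom f _)
  exact DFunLike.congr_fun this a

/-- The unique `K`-linear derivation of `Frac S(g)` with prescribed values `f` on `g`. -/
def derivOf (f : g →ₗ[K] Fld K g) : Derivation K (Fld K g) (Fld K g) :=
  Derivation.mk' ((TrivSqZeroExt.sndHom (Fld K g) (Fld K g)).restrictScalars K ∘ₗ
      (dualHomFld f).toLinearMap) (by
    intro a b
    simp [fst_dualHomFld, mul_comm])

@[simp] theorem derivOf_emb (f : g →ₗ[K] Fld K g) (x : g) : derivOf f (emb x) = f x := by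
  simp [derivOf, emb, dualHomFld_algebraMap, dualHom]

theorem derivation_ext {D₁ D₂ : Derivation K (Fld K g) (Fld K g)}
    (h : ∀ x : g, D₁ (emb x) = D₂ (emb x)) : D₁ = D₂ := by
  have h1 : ∀ a : SymmetricAlgebra K g,
      D₁ (algebraMap _ (Fld K g) a) = D₂ (algebraMap _ (Fld K g) a) := by
    intro a
    induction a using SymmetricAlgebra.induction with
    | algebraMap r =>
      rw [← IsScalarTower.algebraMap_apply K (SymmetricAlgebra K g) (Fld K g)]
      simp
    | ι x => exact h x
    | mul a b ha hb => simp [ha, hb]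
    | add a b ha hb => simp [ha, hb]
  ext q
  obtain ⟨a, b, hb, rfl⟩ := IsFractionRing.div_surjective (A := SymmetricAlgebra K g) q
  simp [Derivation.leibniz_div, h1]

variable (K) in
/-- The adjoint representation extended to `Frac S(g)` by derivations: `D_x y = [x, y]`. -/
def lieDer (x : g) : Derivation K (Fld K g) (Fld K g) :=
  derivOf (emb ∘ₗ (LieAlgebra.ad K g x : g →ₗ[K] g))

@[simp] theorem lieDer_emb (x y : g) : lieDer K x (emb y) = emb ⁅x, y⁆ := by
  simp [lieDer]

theorem lieDer_add (x y : g) : lieDer K (x + y) = lieDer K x + lieDer K y := by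
  apply derivation_ext
  simp

theorem lieDer_smul (c : K) (x : g) : lieDer K (c • x) = c • lieDer K x := by
  apply derivation_ext
  simp

/-- The Poisson bracket `{a, ·}` on `Frac S(g)`: the derivation with `{a, y} = -D_y a` for
`y ∈ g`, which extends the Lie bracket of `g`. -/
def poisson (a : Fld K g) : Derivation K (Fld K g) (Fld K g) :=
  derivOf
    { toFun := fun y => -lieDer K y a
      map_add' := fun y z => by rw [lieDer_add]; simp [add_comm]
      map_smul' := fun c y => by rw [lieDer_smul]; simp }

/-- `D_x a = {x, a}`. -/
theorem poisson_emb (x : g) : poisson (emb x) = lieDer K x := by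
  apply derivation_ext
  intro y
  simp only [poisson, derivOf_emb, lieDer_emb, LinearMap.coe_mk, AddHom.coe_mk]
  rw [← map_neg, lie_skew]

/-- The map `a ↦ ∑ (-1)^k D^k(a) Q^k / k!` attached to a derivation `D` and an element `Q`; used
for `D Q = 1` and for elements `a` on which `D` acts nilpotently, so that the sum is finite. -/
def expProj (D : Derivation K (Fld K g) (Fld K g)) (Q a : Fld K g) : Fld K g :=
  ∑ᶠ k : ℕ, ((-1 : K) ^ k / (k.factorial : K)) • ((⇑D)^[k] a * Q ^ k)

/-! ### The action of unipotent elements -/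

/-- The exponential series of `ad x`, cut off at the nilpotency class of `ad x`. -/
def expAdLin (x : g) : Module.End K g :=
  ∑ k ∈ Finset.range (nilpotencyClass (LieAlgebra.ad K g x)),
    ((k.factorial : K)⁻¹) • (LieAlgebra.ad K g x) ^ k

theorem expAdLin_mul_neg [CharZero K] (x : g) (hx : IsNilpotent (LieAlgebra.ad K g x)) :
    expAdLin (K := K) x * expAdLin (-x) = 1 := by
  let _ : Module ℚ (Module.End K g) := Module.compHom _ (algebraMap ℚ K)
  have key : ∀ (y : g), expAdLin (K := K) y = IsNilpotent.exp (LieAlgebra.ad K g y) := by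
    intro y
    unfold expAdLin IsNilpotent.exp
    refine Finset.sum_congr rfl fun k _ => ?_
    change _ = (algebraMap ℚ K ((k.factorial : ℚ)⁻¹)) • (LieAlgebra.ad K g y) ^ k
    simp
  rw [key, key, map_neg]
  exact IsNilpotent.exp_mul_exp_neg_self hx

/-- `exp (ad x)` as an automorphism of the vector space `g`, for `ad x` nilpotent. -/
def expAd [CharZero K] (x : g) (hx : IsNilpotent (LieAlgebra.ad K g x)) : g ≃ₗ[K] g :=
  LinearEquiv.ofLinearMap (expAdLin x) (expAdLin (-x))
    (expAdLin_mul_neg x hx)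
    (by
      have h := expAdLin_mul_neg (K := K) (-x) (by rw [map_neg]; exact hx.neg)
      rwa [neg_neg] at h)

/-- The automorphism of `Frac S(g)` induced by a linear automorphism of `g`. -/
def act (f : g ≃ₗ[K] g) : Fld K g ≃ₐ[K] Fld K g :=
  IsFractionRing.algEquivOfAlgEquiv (A := SymmetricAlgebra K g) (B := SymmetricAlgebra K g)
    (AlgEquiv.ofAlgHom
      (SymmetricAlgebra.lift (SymmetricAlgebra.ι K g ∘ₗ f.toLinearMap))
      (SymmetricAlgebra.lift (SymmetricAlgebra.ι K g ∘ₗ f.symm.toLinearMap))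
      (by apply SymmetricAlgebra.algHom_ext; ext x; simp)
      (by apply SymmetricAlgebra.algHom_ext; ext x; simp))

theorem act_emb (f : g ≃ₗ[K] g) (x : g) : act f (emb x : Fld K g) = emb (f x) := by
  simp [act, emb]

end Poisson

/-! ### Roots, positive roots and root vectors -/

section Roots

variable {K g : Type*} [Field K] [LieRing g] [LieAlgebra K g]
  (H : LieSubalgebra K g) [LieRing.IsNilpotent H]

/-- The roots of `g` relative to `H`. -/
def roots : Set (Module.Dual K H) :=
  {α | α ≠ 0 ∧ LieAlgebra.rootSpace H (α : H → K) ≠ ⊥}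

/-- `B` is a system of simple roots: a linearly independent set of roots such that each root or
its opposite is a combination of elements of `B` with coefficients in `ℕ`. -/
structure IsBase (B : Set (Module.Dual K H)) : Prop where
  subset : B ⊆ roots H
  linearIndepOn : LinearIndepOn K id B
  pos_or_neg : ∀ α ∈ roots H, α ∈ AddSubmonoid.closure B ∨ -α ∈ AddSubmonoid.closure B

/-- The positive roots with respect to a system `B` of simple roots. -/
def posRoots (B : Set (Module.Dual K H)) : Set (Module.Dual K H) :=
  {α | α ∈ roots H ∧ α ∈ AddSubmonoid.closure B}

/-- A choice of root vectors `E_α` and coroots `H_α`, normalized in the usual way: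
`[E_α, E_{-α}] = H_α`, `[H_α, E_α] = 2 E_α`, `[H_α, E_{-α}] = -2 E_{-α}`. The values at elements
of the dual of `H` which are not roots play no role. -/
structure RootVectors where
  E : Module.Dual K H → g
  coroot : Module.Dual K H → H
  E_mem : ∀ α ∈ roots H, E α ∈ LieAlgebra.rootSpace H (α : H → K)
  sl2 : ∀ α ∈ roots H, IsSl2Triple (coroot α : g) (E α) (E (-α))

end Roots

section Cascade

variable {K g : Type*} [Field K] [LieRing g] [LieAlgebra K g]
  {H : LieSubalgebra K g} [LieRing.IsNilpotent H]
  (R : RootVectors H) (B : Set (Module.Dual K H))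

/-- The nilpotent subalgebra `u`, spanned by the `E_α` with `α` positive. -/
def nilradical : Submodule K g :=
  Submodule.span K (R.E '' posRoots H B)

/-- The group `U = exp u`, acting on `Frac S(g)` through the adjoint representation. -/
def unipotentGroup [CharZero K] : Subgroup (Fld K g ≃ₐ[K] Fld K g) :=
  Subgroup.closure {σ | ∃ x ∈ nilradical R B, ∃ hx : IsNilpotent (LieAlgebra.ad K g x),
    σ = act (expAd x hx)}

/-- The field of `U`-invariants. -/
def invariantField [CharZero K] : IntermediateField K (Fld K g) :=
  IntermediateField.fixedField (unipotentGroup R B)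

/-! ### The Kostant cascade `ξ 0, …, ξ (m - 1)` -/

variable (ξ : ℕ → Module.Dual K H)

/-- The positive roots orthogonal to `ξ j` for all `j < i`, orthogonality of `α` and `ξ j` being
expressed as the vanishing of `α` on the coroot of `ξ j`. -/
def stagePos (i : ℕ) : Set (Module.Dual K H) :=
  {α | α ∈ posRoots H B ∧ ∀ j < i, α (R.coroot (ξ j)) = 0}

/-- `ξ 0, …, ξ (m - 1)` is a Kostant cascade: each `ξ i` is maximal among the positive roots
orthogonal to the previous ones, for the order in which `α ≥ β` means that `α - β` is a sum of
simple roots, and no positive root is orthogonal to all members of the cascade. -/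
structure IsKostantCascade (m : ℕ) : Prop where
  mem : ∀ i < m, ξ i ∈ stagePos R B ξ i
  maximal : ∀ i < m, ∀ α ∈ stagePos R B ξ i, α - ξ i ∈ AddSubmonoid.closure B → α = ξ i
  exhausted : stagePos R B ξ m = ∅

/-- `Γ_i` consists of those `α` in `stagePos i` whose scalar product with `ξ i` is positive. -/
def Gam (i : ℕ) : Set (Module.Dual K H) :=
  {α | α ∈ stagePos R B ξ i ∧ ∃ n : ℕ, 0 < n ∧ α (R.coroot (ξ i)) = (n : K)}

/-- `Γ_i` without `ξ i`. -/
def Gam0 (i : ℕ) : Set (Module.Dual K H) :=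
  Gam R B ξ i \ {ξ i}

/-- The correction element `b_x` at stage `i`. Here `t` is the corrected copy `x ↦ t x` of
`g_i` constructed so far, the `t E_α` with `α ∈ Γ_i` span a Heisenberg algebra `n_i` with centre
`t E_{ξ i}`, and `b_x` is the element of `(n_i⁰)² (t E_{ξ i})⁻¹` (with `n_i⁰` spanned by
the `t E_α`, `α ∈ Γ_i`, `α ≠ ξ i`) such that `{b_x, a} = {t x, a}` for all `a ∈ n_i`. -/
def corr (i : ℕ) (t : g → Fld K g) (x : g) : Fld K g :=
  Classical.epsilon fun b =>
    b ∈ Submodule.span K {q | ∃ α ∈ Gam0 R B ξ i, ∃ β ∈ Gam0 R B ξ i,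
      q = t (R.E α) * t (R.E β) * (t (R.E (ξ i)))⁻¹} ∧
    ∀ α ∈ Gam R B ξ i, poisson b (t (R.E α)) = poisson (t x) (t (R.E α))

/-- The element `x̃` with `i` tildes: `x` itself for `i = 0`, and then one correction
`x̃ = x - b_x` for each stage. It is meaningful for `x` in the reductive subalgebra `g_i` spanned
by `{h ∈ H | ξ j h = 0 for all j < i}` and the `E_α` with `α` orthogonal to `ξ j` for all
`j < i`, and it is used only for such `x`. -/
def tilde : ℕ → g → Fld K g
  | 0 => fun x => emb x
  | i + 1 => fun x => tilde i x - corr R B ξ i (tilde i) x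

/-- The cascade element of `Ξ` with index `i`: the vector `E_{ξ i}` with `i` tildes. -/
def cascadeElt (i : ℕ) : Fld K g :=
  tilde R B ξ i (R.E (ξ i))

/-- The localization `S(g)_*` of `S(g)` at the cascade elements, inside `Frac S(g)`. -/
def locAlg (m : ℕ) : Subalgebra K (Fld K g) :=
  Algebra.adjoin K (Set.range (algebraMap (SymmetricAlgebra K g) (Fld K g)) ∪
    {q | ∃ i < m, q = (cascadeElt R B ξ i)⁻¹})

/-- The algebra `S(g)_*^U` of `U`-invariants in `S(g)_*`. -/
def locInvariants [CharZero K] (m : ℕ) : Subalgebra K (Fld K g) :=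
  locAlg R B ξ m ⊓ (invariantField R B).toSubalgebra

/-! ### The projector -/

/-- The structure constant `N_{α,β}`, defined by `[E_α, E_β] = N_{α,β} E_{α+β}`. -/
def structConst (α β : Module.Dual K H) : K :=
  Classical.epsilon fun c : K => ⁅R.E α, R.E β⁆ = c • R.E (α + β)

/-- `S_{ξ i}`, formed with `Q_{ξ i} = -(1/2) H̃_{ξ i} Ẽ_{ξ i}⁻¹`, for which
`D_{ξ i} Q_{ξ i} = 1`. -/
def projTop (i : ℕ) : Fld K g → Fld K g :=
  expProj (lieDer K (R.E (ξ i)))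
    (-((1 / 2 : K) • (tilde R B ξ i (R.coroot (ξ i)) * (cascadeElt R B ξ i)⁻¹)))

/-- `S_α` for `α ∈ Γ_i`, `α ≠ ξ i`, formed with `Q_α = N_{α,α'}⁻¹ Ẽ_{α'} Ẽ_{ξ i}⁻¹`,
`α' = ξ i - α`, for which `D_α Q_α = 1`. -/
def projRoot (i : ℕ) (α : Module.Dual K H) : Fld K g → Fld K g :=
  expProj (lieDer K (R.E α))
    ((structConst R α (ξ i - α))⁻¹ •
      (tilde R B ξ i (R.E (ξ i - α)) * (cascadeElt R B ξ i)⁻¹))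

/-- `P_i = (∏ S_α) ∘ S_{ξ i}`, the product over a list `l` enumerating `Γ_i` without `ξ i`. -/
def projStage (i : ℕ) (l : List (Module.Dual K H)) (a : Fld K g) : Fld K g :=
  l.foldr (projRoot R B ξ i) (projTop R B ξ i a)

/-- The composite `P_{m-1} ∘ ⋯ ∘ P_0` of the first `m` stages, `ord i` being the order of the
factors in `P_i`. -/
def proj (ord : ℕ → List (Module.Dual K H)) : ℕ → Fld K g → Fld K g
  | 0 => id
  | i + 1 => projStage R B ξ i (ord i) ∘ proj ord i

/-- The orthogonal complement of the cascade in `H`: the elements of `H` on which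
`ξ 0, …, ξ (m - 1)` vanish. -/
def cascadeOrth (m : ℕ) : Submodule K H :=
  ⨅ i : Fin m, LinearMap.ker (ξ i)

/-- The system `{P(E_{-α}) : α > 0} ∪ {P(h_k)} ∪ Ξ`, for a family `h` of elements of `H`. -/
def generators (m : ℕ) (ord : ℕ → List (Module.Dual K H)) {ι : Type*} (h : ι → H) :
    posRoots H B ⊕ ι ⊕ Fin m → Fld K g :=
  Sum.elim (fun α => proj R B ξ ord m (emb (R.E (-(α : Module.Dual K H)))))
    (Sum.elim (fun k => proj R B ξ ord m (emb (h k : g)))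
      (fun i => cascadeElt R B ξ i))

end Cascade

end

end AdjointProjector

set_option linter.unusedSectionVars false

namespace AdjointProjector

noncomputable section

/-! ### Root spaces of a split reductive Lie algebra -/

section Reductive

open LieAlgebra LieModule Module

variable {K g L : Type*} [Field K] [LieRing g] [LieAlgebra K g] [LieRing L] [LieAlgebra K L]

/-! Each factor of P is the projection attached to a locally nilpotent derivation D with a slice Q,
that is D Q = 1. The series in D and -Q is multiplicative, takes values in the constants of D, fixes
them and kills Q; moreover the whole algebra is generated by the constants and Q. These facts
compose along a list of pairs (D, Q) as soon as every D preserves the elements killed by its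
predecessors and every Q is killed by them: this is `IsSliceTower`.

A Kostant cascade provides such a tower on S(g)_*. The sets Γ_i partition the positive roots, and
the E_α with α in Γ_i span a Heisenberg algebra with centre E_{ξ_i}: α and ξ_i - α are paired by a
nonzero structure constant, all other brackets vanish. So E_{ξ_i - α} / E_{ξ_i} and H_{ξ_i} /
E_{ξ_i} are slices up to scalars. At later stages they must also be killed by the D_γ of the earlier
stages, and the tildes achieve this: subtracting b_x makes the copy of x commute with the Heisenberg
algebra without spoiling the brackets (`IsPoissonMap.succ`, `tildeLin_spec`). Existence of b_x comes
from an explicit symmetric formula, uniqueness from Euler's identity for quadratic elements.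

Since P kills all slices, it kills the copies of E_α (α in Γ_i, α ≠ ξ_i) and of H_{ξ_i}, hence all
corrections; on g itself it therefore leaves only the listed generators (`proj_emb_mem`). As P fixes
every invariant, these generators and the inverses of Ξ generate S(g)_*^U, and an invariant fraction
can be written with invariant numerator and denominator (`IsSliceTower.exists_mul_eq`).

Independence is a count. The system together with one slice for each positive root generates F and
has at most dim g elements, which does not exceed the transcendence degree of F. -/

theorem hasTrivialRadical_of_surjective_of_ker_eq_center
    [FiniteDimensional K g] [HasCentralRadical K g] (π : g →ₗ⁅K⁆ L)
    (hπ : Function.Surjective π) (hker : π.ker = center K g) : HasTrivialRadical K L := by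
  rw [hasTrivialRadical_iff_no_abelian_ideals]
  intro J hJ
  -- The preimage of an abelian ideal has its brackets in the kernel, which is central. It is
  -- therefore solvable, so it lies in the radical, which is the centre, which `π` kills.
  have hle : ⁅J.comap π, J.comap π⁆ ≤ center K g := by
    rw [LieSubmodule.lieIdeal_oper_eq_span, LieSubmodule.lieSpan_le]
    rintro _ ⟨x, y, rfl⟩
    rw [← hker]
    have hx : π x ∈ J := x.2
    have hy : π y ∈ J := y.2
    have : (⁅(⟨π x, hx⟩ : J), (⟨π y, hy⟩ : J)⁆ : J) = 0 := hJ.trivial _ _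
    have := congrArg Subtype.val this
    simpa using this
  have hsol : IsSolvable (J.comap π) := by
    refine IsSolvable.mk (R := K) (k := 2) ((LieIdeal.derivedSeries_eq_bot_iff _ 2).2 ?_)
    rw [show (2 : ℕ) = 1 + 1 from rfl, derivedSeriesOfIdeal_succ, derivedSeriesOfIdeal_succ,
      derivedSeriesOfIdeal_zero, eq_bot_iff, LieSubmodule.lieIdeal_oper_eq_span,
      LieSubmodule.lieSpan_le]
    rintro _ ⟨x, y, rfl⟩
    have hx := hle x.2
    have := (LieModule.mem_maxTrivSubmodule (R := K) (L := g) (M := g) (x : g)).1 (hle x.2) y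
    simp only [SetLike.mem_coe, LieSubmodule.mem_bot]
    rw [← lie_skew, this, neg_zero]
  have hz : J.comap π ≤ center K g := by
    rw [← radical_eq_center]
    exact (LieIdeal.solvable_iff_le_radical (R := K) g _).1 hsol
  rw [eq_bot_iff]
  intro y hy
  obtain ⟨x, rfl⟩ := hπ y
  have : x ∈ π.ker := by
    rw [hker]; exact hz hy
  simpa using this

/-- As `H` contains the kernel, it is the full preimage of its image, and elements normalizing the
image lift to elements normalizing `H`. -/
theorem isCartanSubalgebra_map (π : g →ₗ⁅K⁆ L) (hπ : Function.Surjective π)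
    (H : LieSubalgebra K g) [H.IsCartanSubalgebra] (hker : ∀ x, π x = 0 → x ∈ H) :
    (H.map π).IsCartanSubalgebra where
  nilpotent := by
    let f : H →ₗ⁅K⁆ H.map π :=
      { toFun := fun x => ⟨π x, ⟨x, x.2, rfl⟩⟩
        map_add' := fun x y => by ext; simp
        map_smul' := fun c x => by ext; simp
        map_lie' := fun {x y} => by ext; simp }
    have hf : Function.Surjective f := by
      rintro ⟨_, x, hx, rfl⟩
      exact ⟨⟨x, hx⟩, rfl⟩
    exact hf.lieAlgebra_isNilpotent
  self_normalizing := by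
    refine le_antisymm ?_ (H.map π).le_normalizer
    intro y hy
    obtain ⟨x, rfl⟩ := hπ y
    refine ⟨x, ?_, rfl⟩
    have : x ∈ H.normalizer := by
      rw [LieSubalgebra.mem_normalizer_iff]
      intro h hh
      obtain ⟨z, hz, hzx⟩ := (LieSubalgebra.mem_normalizer_iff _ _).1 hy (π h) ⟨h, hh, rfl⟩
      have h0 : π (⁅x, h⁆ - z) = 0 := by
        have : π z = ⁅π x, π h⁆ := hzx
        simp [this]
      have := H.add_mem (hker _ h0) hz
      simpa using this
    rwa [LieSubalgebra.IsCartanSubalgebra.self_normalizing] at this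

theorem isTriangularizable_map [FiniteDimensional K g] (π : g →ₗ⁅K⁆ L) (hπ : Function.Surjective π)
    (H : LieSubalgebra K g) [LieRing.IsNilpotent H] [LieRing.IsNilpotent (H.map π)]
    [IsTriangularizable K H g] : IsTriangularizable K (H.map π) L := by
  constructor
  rintro ⟨_, x, hx, rfl⟩
  rw [eq_top_iff]
  rintro y -
  obtain ⟨z, rfl⟩ := hπ y
  have hz : z ∈ ⨆ φ, (toEnd K H g ⟨x, hx⟩).maxGenEigenspace φ := by
    rw [IsTriangularizable.maxGenEigenspace_eq_top]; trivial
  induction hz using Submodule.iSup_induction' with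
  | zero => simp
  | add u v _ _ hu hv => rw [map_add]; exact add_mem hu hv
  | mem φ u hu =>
    refine Submodule.mem_iSup_of_mem φ ?_
    rw [Module.End.mem_maxGenEigenspace] at hu ⊢
    obtain ⟨k, hk⟩ := hu
    refine ⟨k, ?_⟩
    have key : ∀ k : ℕ, ∀ u : g, π (((toEnd K H g ⟨x, hx⟩ - φ • (1 : Module.End K g)) ^ k) u) =
        ((toEnd K (H.map π) L ⟨π x, ⟨x, hx, rfl⟩⟩ - φ • (1 : Module.End K L)) ^ k) (π u) := by
      intro k
      induction k with
      | zero => intro u; simp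
      | succ k ih => intro u; rw [pow_succ, Module.End.mul_apply, ih, pow_succ,
          Module.End.mul_apply]; congr 1; simp
    exact (key k u).symm.trans (by rw [hk, map_zero])


theorem lieHom_pow_toEnd_sub_smul (π : g →ₗ⁅K⁆ L) (x u : g) (c : K) (k : ℕ) :
    π (((toEnd K g g x - c • (1 : Module.End K g)) ^ k) u) =
      ((toEnd K L L (π x) - c • (1 : Module.End K L)) ^ k) (π u) := by
  induction k generalizing u with
  | zero => simp
  | succ k ih => rw [pow_succ, Module.End.mul_apply, ih, pow_succ, Module.End.mul_apply]; simp

/-- The quotient by the centre is semisimple, and there root spaces are lines. A root vanishes on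
the centre and so descends; its root space embeds in the quotient because the kernel lies in `H`,
the weight space of 0. -/
theorem finrank_rootSpace_le_one_of_lieHom [CharZero K] [FiniteDimensional K g]
    [HasCentralRadical K g] (π : g →ₗ⁅K⁆ L)
    (hπ : Function.Surjective π) (hker : π.ker = center K g)
    (H : LieSubalgebra K g) [H.IsCartanSubalgebra] [IsTriangularizable K H g]
    (α : Module.Dual K H) (hα : α ≠ 0) : finrank K (rootSpace H (α : H → K)) ≤ 1 := by
  have hkerH : ∀ x, π x = 0 → x ∈ H := by
    intro x hx
    have hx' : x ∈ center K g := by rw [← hker]; exact hx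
    have : x ∈ H.normalizer := by
      rw [LieSubalgebra.mem_normalizer_iff]
      intro y _
      rw [← lie_skew, (LieModule.mem_maxTrivSubmodule (R := K) (L := g) (M := g) x).1 hx' y]
      simp
    rwa [LieSubalgebra.IsCartanSubalgebra.self_normalizing] at this
  by_cases hbot : rootSpace H (α : H → K) = ⊥
  · rw [hbot]
    exact (finrank_bot K g).le.trans zero_le_one
  have := isCartanSubalgebra_map π hπ H hkerH
  have := isTriangularizable_map π hπ H
  have : FiniteDimensional K L := Module.Finite.of_surjective (π : g →ₗ[K] L) hπ
  have := hasTrivialRadical_of_surjective_of_ker_eq_center π hπ hker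
  have hz : ∀ h : H, π h = 0 → α h = 0 := by
    intro h hh
    have hh' : (h : g) ∈ center K g := by rw [← hker]; exact hh
    refine Weight.apply_eq_zero_of_isNilpotent (M := g) h ?_ (⟨α, hbot⟩ : Weight K H g)
    refine ⟨1, ?_⟩
    ext y
    have := (LieModule.mem_maxTrivSubmodule (R := K) (L := g) (M := g) (h : g)).1 hh' y
    simp only [pow_one, toEnd_apply_apply, LinearMap.zero_apply]
    rw [LieSubalgebra.coe_bracket_of_module, ← lie_skew, this, neg_zero]
  -- The descended root is evaluated at an arbitrary preimage; by `hz` the choice is immaterial.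
  let α' : H.map π → K := fun y => α ⟨y.2.choose, y.2.choose_spec.1⟩
  have hα' : ∀ (h : H) (y : H.map π), (y : L) = π h → α' y = α h := by
    intro h y hy
    have := hz (⟨y.2.choose, y.2.choose_spec.1⟩ - h) (by
      have h2 := y.2.choose_spec.2
      simp only [AddSubgroupClass.coe_sub, map_sub]
      rw [← hy, sub_eq_zero]
      exact h2)
    rw [map_sub, sub_eq_zero] at this
    exact this
  have hmap : ∀ x ∈ rootSpace H (α : H → K), π x ∈ rootSpace (H.map π) α' := by
    intro x hx
    rw [mem_genWeightSpace] at hx ⊢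
    rintro ⟨_, h, hh, rfl⟩
    obtain ⟨k, hk⟩ := hx ⟨h, hh⟩
    refine ⟨k, ?_⟩
    rw [hα' ⟨h, hh⟩ _ rfl]
    exact (lieHom_pow_toEnd_sub_smul π h x (α ⟨h, hh⟩) k).symm.trans
      ((congrArg π hk).trans (map_zero π))
  let f : rootSpace H (α : H → K) →ₗ[K] rootSpace (H.map π) α' :=
    { toFun := fun x => ⟨π x, hmap x x.2⟩
      map_add' := fun x y => by ext; simp
      map_smul' := fun c x => by ext; simp }
  have hdisj : ∀ x ∈ rootSpace H (α : H → K), π x = 0 → x = 0 := by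
    intro x hx hx0
    have h1 : x ∈ rootSpace H (0 : H → K) := by
      rw [rootSpace_zero_eq K g H]; exact hkerH x hx0
    have h2 := disjoint_genWeightSpace K H g (χ₁ := (α : H → K)) (χ₂ := 0) (by
      intro h; apply hα; ext y; exact congrFun h y)
    have h3 : x ∈ genWeightSpace g (α : H → K) ⊓ genWeightSpace g (0 : H → K) := ⟨hx, h1⟩
    rw [h2.eq_bot] at h3
    simpa using h3
  have hf : Function.Injective f := by
    rw [← LinearMap.ker_eq_bot, LinearMap.ker_eq_bot']
    intro x hx
    ext
    exact hdisj x x.2 (congrArg Subtype.val hx)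
  have hne : rootSpace (H.map π) α' ≠ ⊥ := by
    obtain ⟨x, hx, hx0⟩ := (Submodule.ne_bot_iff _).1 (fun h => hbot ((LieSubmodule.toSubmodule_eq_bot _).1 h))
    intro h
    have := hmap x hx
    rw [h, LieSubmodule.mem_bot] at this
    exact hx0 (hdisj x hx this)
  have hnz : Weight.IsNonZero (⟨α', hne⟩ : Weight K (H.map π) L) := by
    intro h0
    apply hα
    ext h
    rw [← hα' h ⟨π h, h, h.2, rfl⟩ rfl]
    exact congrFun h0 _
  exact (LinearMap.finrank_le_finrank_of_injective hf).trans
    (IsKilling.finrank_rootSpace_eq_one _ hnz).le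

/-- In a split reductive Lie algebra the root spaces are at most one-dimensional. -/
theorem finrank_rootSpace_le_one [CharZero K] [FiniteDimensional K g] [HasCentralRadical K g]
    (H : LieSubalgebra K g) [H.IsCartanSubalgebra] [IsTriangularizable K H g]
    (α : Module.Dual K H) (hα : α ≠ 0) : finrank K (rootSpace H (α : H → K)) ≤ 1 := by
  let _ : LieRing (Module.End K g) := LieRing.ofAssociativeRing
  -- The image of the adjoint representation serves as the quotient by the centre.
  refine finrank_rootSpace_le_one_of_lieHom (LieHom.rangeRestrict (ad K g))
    (LieHom.surjective_rangeRestrict _) ?_ H α hα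
  rw [← self_module_ker_eq_center]
  ext x
  rw [LieHom.mem_ker, LieHom.rangeRestrict_apply]
  exact Subtype.ext_iff

end Reductive

/-! ### Root vectors -/

namespace RootVectors

open LieAlgebra LieModule Module

variable {K g : Type*} [Field K] [CharZero K] [LieRing g] [LieAlgebra K g]
  [FiniteDimensional K g] [HasCentralRadical K g]
  {H : LieSubalgebra K g} [H.IsCartanSubalgebra] [IsTriangularizable K H g]
  (R : RootVectors H) {α β : Module.Dual K H}

theorem E_ne_zero (hα : α ∈ roots H) : R.E α ≠ 0 := (R.sl2 α hα).e_ne_zero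

theorem mem_cartan_iff (x : g) : x ∈ H ↔ x ∈ rootSpace H (0 : H → K) := by
  rw [rootSpace_zero_eq K g H]; rfl

theorem mem_roots_of_mem_rootSpace (hα : α ≠ 0) {x : g} (hx : x ∈ rootSpace H (α : H → K))
    (hx0 : x ≠ 0) : α ∈ roots H :=
  ⟨hα, fun h => hx0 (by rw [h] at hx; simpa using hx)⟩

/-- If `-α` had zero root space, `ad (E α)` would carry no weight space into weight 0, so its image
would lie in the sum of the nonzero weight spaces; but it contains the coroot, a nonzero element of
`H`. Nothing about the weight of `R.E (-α)` is used, as `E_mem` applies to roots only. -/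
theorem neg_mem_roots (R : RootVectors H) (hα : α ∈ roots H) : -α ∈ roots H := by
  refine ⟨neg_ne_zero.2 hα.1, fun hbot => ?_⟩
  have hE := R.E_mem α hα
  have hle : ∀ y : g, ⁅R.E α, y⁆ ∈ ⨆ χ ∈ {χ : H → K | χ ≠ 0}, genWeightSpace g χ := by
    intro y
    have hy : y ∈ ⨆ χ : Weight K H g, genWeightSpace g (χ : H → K) := by
      rw [iSup_genWeightSpace_eq_top']; trivial
    induction hy using LieSubmodule.iSup_induction' with
    | zero => simp
    | add u v _ _ hu hv => rw [lie_add]; exact add_mem hu hv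
    | mem χ u hu =>
      have := lie_mem_genWeightSpace_of_mem_genWeightSpace hE hu
      refine LieSubmodule.mem_iSup_of_mem ((α : H → K) + χ)
        (LieSubmodule.mem_iSup_of_mem ?_ this)
      intro h0
      apply χ.genWeightSpace_ne_bot
      rw [show (χ : H → K) = ((-α : Module.Dual K H) : H → K) by
        rw [eq_neg_of_add_eq_zero_right h0]; rfl]
      exact hbot
  have h1 := hle (R.E (-α))
  rw [(R.sl2 α hα).lie_e_f] at h1
  have h2 : (R.coroot α : g) ∈ genWeightSpace g (0 : H → K) :=
    (mem_cartan_iff _).1 (R.coroot α).2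
  have h3 := (iSupIndep_genWeightSpace K H g).disjoint_biSup (x := (0 : H → K))
    (y := {χ : H → K | χ ≠ 0}) (by simp)
  have h4 : (R.coroot α : g) ∈ genWeightSpace g (0 : H → K) ⊓
    ⨆ χ ∈ {χ : H → K | χ ≠ 0}, genWeightSpace g χ := ⟨h2, h1⟩
  rw [h3.eq_bot] at h4
  exact (R.sl2 α hα).h_ne_zero (by simpa using h4)

theorem exists_eq_smul (hα : α ∈ roots H) {x : g} (hx : x ∈ rootSpace H (α : H → K)) :
    ∃ c : K, x = c • R.E α := by
  have h1 : finrank K (rootSpace H (α : H → K)) = 1 := by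
    refine le_antisymm (finrank_rootSpace_le_one H α hα.1) ?_
    have : Nontrivial (rootSpace H (α : H → K)) :=
      ⟨⟨⟨R.E α, R.E_mem α hα⟩, 0, fun h => R.E_ne_zero hα (congrArg Subtype.val h)⟩⟩
    exact finrank_pos
  obtain ⟨c, hc⟩ := (finrank_eq_one_iff_of_nonzero'
    (⟨R.E α, R.E_mem α hα⟩ : rootSpace H (α : H → K))
    (fun h => R.E_ne_zero hα (congrArg Subtype.val h))).1 h1 ⟨x, hx⟩
  exact ⟨c, (congrArg Subtype.val hc).symm⟩

/-- On a generalized weight space `H` acts by the weight up to a nilpotent part, which is zero on a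
line. -/
theorem lie_cartan_E (hα : α ∈ roots H) (h : H) : ⁅(h : g), R.E α⁆ = α h • R.E α := by
  have hmem : ⁅h, R.E α⁆ ∈ rootSpace H (α : H → K) := LieSubmodule.lie_mem _ (R.E_mem α hα)
  obtain ⟨c, hc⟩ := R.exists_eq_smul hα hmem
  have hk := R.E_mem α hα
  rw [mem_genWeightSpace] at hk
  obtain ⟨k, hk⟩ := hk h
  have hpow : ∀ k : ℕ, ((toEnd K H g h - α h • (1 : Module.End K g)) ^ k) (R.E α) =
      (c - α h) ^ k • R.E α := by
    intro k
    induction k with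
    | zero => simp
    | succ k ih =>
      rw [pow_succ', Module.End.mul_apply, ih, map_smul]
      simp only [LinearMap.sub_apply, toEnd_apply_apply, hc, LinearMap.smul_apply,
        Module.End.one_apply]
      rw [← sub_smul, smul_smul, pow_succ]
  rw [hpow, smul_eq_zero] at hk
  have := hk.resolve_right (R.E_ne_zero hα)
  rw [← LieSubalgebra.coe_bracket_of_module, hc, sub_eq_zero.1 (eq_zero_of_pow_eq_zero this)]

theorem apply_coroot_self (hα : α ∈ roots H) : α (R.coroot α) = 2 := by
  have h1 := R.lie_cartan_E hα (R.coroot α)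
  rw [(R.sl2 α hα).lie_h_e_smul K] at h1
  exact (smul_left_injective K (R.E_ne_zero hα) h1).symm

theorem lie_E_E_mem (hα : α ∈ roots H) (hβ : β ∈ roots H) :
    ⁅R.E α, R.E β⁆ ∈ rootSpace H ((α + β : Module.Dual K H) : H → K) :=
  lie_mem_genWeightSpace_of_mem_genWeightSpace (R.E_mem α hα) (R.E_mem β hβ)

theorem lie_E_E_eq_zero (hα : α ∈ roots H) (hβ : β ∈ roots H) (h0 : α + β ≠ 0)
    (h : α + β ∉ roots H) : ⁅R.E α, R.E β⁆ = 0 := by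
  by_contra hne
  exact h (mem_roots_of_mem_rootSpace h0 (R.lie_E_E_mem hα hβ) hne)

theorem exists_lie_E_E_eq (hα : α ∈ roots H) (hβ : β ∈ roots H) (h : α + β ∈ roots H) :
    ∃ c : K, ⁅R.E α, R.E β⁆ = c • R.E (α + β) :=
  R.exists_eq_smul h (R.lie_E_E_mem hα hβ)

/-- A primitive vector of a finite-dimensional sl2-module has a weight in ℕ. This and its mirror
image for `E (-α)` replace root strings and the invariant form in all the combinatorics of the
cascade. -/
theorem exists_nat_of_lie_eq_zero (hα : α ∈ roots H) (hβ : β ∈ roots H)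
    (h : ⁅R.E α, R.E β⁆ = 0) : ∃ n : ℕ, β (R.coroot α) = n := by
  have P : (R.sl2 α hα).HasPrimitiveVectorWith (R.E β) (β (R.coroot α)) :=
    ⟨R.E_ne_zero hβ, R.lie_cartan_E hβ _, h⟩
  exact P.exists_nat

theorem exists_nat_of_lie_neg_eq_zero (hα : α ∈ roots H) (hβ : β ∈ roots H)
    (h : ⁅R.E (-α), R.E β⁆ = 0) : ∃ n : ℕ, β (R.coroot α) = -(n : K) := by
  have P : (R.sl2 α hα).symm.HasPrimitiveVectorWith (R.E β) (-β (R.coroot α)) :=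
    ⟨R.E_ne_zero hβ, by rw [neg_lie, R.lie_cartan_E hβ, neg_smul], h⟩
  obtain ⟨n, hn⟩ := P.exists_nat
  exact ⟨n, by rw [← hn, neg_neg]⟩

theorem finite_roots : (roots H).Finite := by
  have h := finite_genWeightSpace_ne_bot K H g
  refine Set.Finite.of_finite_image (f := fun α : Module.Dual K H => (α : H → K)) ?_
    DFunLike.coe_injective.injOn
  refine h.subset ?_
  rintro _ ⟨α, hα, rfl⟩
  exact hα.2

theorem cartan_sup_span_E : H.toSubmodule ⊔ Submodule.span K (R.E '' roots H) = ⊤ := by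
  rw [eq_top_iff]
  rintro y -
  have hy : y ∈ ⨆ χ : Weight K H g, genWeightSpace g (χ : H → K) := by
    rw [iSup_genWeightSpace_eq_top']; trivial
  induction hy using LieSubmodule.iSup_induction' with
  | zero => simp
  | add u v _ _ hu hv => exact add_mem hu hv
  | mem χ u hu =>
    by_cases h0 : (χ : H → K) = 0
    · rw [h0] at hu
      exact Submodule.mem_sup_left ((mem_cartan_iff u).2 hu)
    · have hχ : χ.toLinear ∈ roots H :=
        ⟨fun h => h0 (by funext x; exact LinearMap.congr_fun h x), χ.genWeightSpace_ne_bot⟩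
      obtain ⟨c, rfl⟩ := R.exists_eq_smul hχ hu
      exact Submodule.mem_sup_right
        (Submodule.smul_mem _ _ (Submodule.subset_span ⟨_, hχ, rfl⟩))

theorem linearIndependent_E : LinearIndependent K fun α : roots H => R.E α := by
  have h := (iSupIndep_genWeightSpace K H g)
  have h' : iSupIndep fun α : roots H => (genWeightSpace g ((α : Module.Dual K H) : H → K)) :=
    h.comp (f := fun α : roots H => ((α : Module.Dual K H) : H → K))
      (fun a b hab => Subtype.ext (DFunLike.coe_injective hab))
  rw [← LieSubmodule.iSupIndep_toSubmodule] at h'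
  exact h'.linearIndependent _ (fun α => R.E_mem α α.2) (fun α => R.E_ne_zero α.2)

theorem disjoint_cartan_span_E :
    Disjoint H.toSubmodule (Submodule.span K (R.E '' roots H)) := by
  have h3 := (iSupIndep_genWeightSpace K H g).disjoint_biSup (x := (0 : H → K))
    (y := {χ : H → K | χ ≠ 0}) (by simp)
  rw [Submodule.disjoint_def]
  intro x hx hx'
  have h2 : x ∈ genWeightSpace g (0 : H → K) := (mem_cartan_iff _).1 hx
  have h1 : x ∈ ⨆ χ ∈ {χ : H → K | χ ≠ 0}, genWeightSpace g χ := by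
    rw [← LieSubmodule.mem_toSubmodule]
    refine (Submodule.span_le.2 ?_) hx'
    rintro _ ⟨α, hα, rfl⟩
    refine LieSubmodule.mem_iSup_of_mem (α : H → K)
        (LieSubmodule.mem_iSup_of_mem ?_ (R.E_mem α hα))
    intro h0
    exact hα.1 (by ext y; exact congrFun h0 y)
  have h4 : x ∈ genWeightSpace g (0 : H → K) ⊓
    ⨆ χ ∈ {χ : H → K | χ ≠ 0}, genWeightSpace g χ := ⟨h2, h1⟩
  rw [h3.eq_bot] at h4
  simpa using h4

end RootVectors

open LieAlgebra LieModule Module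

/-! ### Positive roots and heights -/

section Height

variable {K g : Type*} [Field K] [CharZero K] [LieRing g] [LieAlgebra K g]
  {H : LieSubalgebra K g} [LieRing.IsNilpotent H] {B : Set (Module.Dual K H)}

/-- By linear independence a linear form can be given the value 1 on `B`. It is the height, and
spares any expansion of roots in simple roots. -/
theorem IsBase.exists_height (hB : IsBase H B) :
    ∃ φ : Module.Dual K (Module.Dual K H), ∀ b ∈ B, φ b = 1 := by
  have hli : LinearIndepOn K id B := hB.linearIndepOn
  refine ⟨(Basis.extend hli).constr K (fun _ => (1 : K)), fun b hb => ?_⟩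
  have := (Basis.extend hli).constr_basis K (fun _ => (1 : K)) ⟨b, hli.subset_extend _ hb⟩
  rwa [Basis.extend_apply_self] at this

theorem exists_nat_of_mem_closure {φ : Module.Dual K (Module.Dual K H)} (hφ : ∀ b ∈ B, φ b = 1)
    {α : Module.Dual K H} (hα : α ∈ AddSubmonoid.closure B) :
    ∃ n : ℕ, φ α = n ∧ (n = 0 → α = 0) := by
  induction hα using AddSubmonoid.closure_induction with
  | mem b hb => exact ⟨1, by simp [hφ b hb], by simp⟩
  | zero => exact ⟨0, by simp, by simp⟩
  | add x y _ _ hx hy =>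
    obtain ⟨n, hn, hn0⟩ := hx
    obtain ⟨k, hk, hk0⟩ := hy
    refine ⟨n + k, by simp [hn, hk], fun h => ?_⟩
    rw [hn0 (by omega), hk0 (by omega), add_zero]

theorem IsBase.eq_zero_of_mem_of_neg_mem (hB : IsBase H B) {α : Module.Dual K H}
    (h : α ∈ AddSubmonoid.closure B) (h' : -α ∈ AddSubmonoid.closure B) : α = 0 := by
  obtain ⟨φ, hφ⟩ := hB.exists_height
  obtain ⟨n, hn, hn0⟩ := exists_nat_of_mem_closure hφ h
  obtain ⟨k, hk, -⟩ := exists_nat_of_mem_closure hφ h'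
  refine hn0 ?_
  rw [map_neg, hn] at hk
  have : ((n + k : ℕ) : K) = 0 := by rw [Nat.cast_add, ← hk]; ring
  rw [Nat.cast_eq_zero] at this
  omega

theorem IsBase.neg_notMem_posRoots (hB : IsBase H B) {α : Module.Dual K H}
    (h : α ∈ posRoots H B) : -α ∉ posRoots H B :=
  fun h' => h.1.1 (hB.eq_zero_of_mem_of_neg_mem h.2 h'.2)

end Height

/-! ### Combinatorics of a Kostant cascade -/

namespace IsKostantCascade

variable {K g : Type*} [Field K] [CharZero K] [LieRing g] [LieAlgebra K g]
  [FiniteDimensional K g] [HasCentralRadical K g]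
  {H : LieSubalgebra K g} [H.IsCartanSubalgebra] [IsTriangularizable K H g]
  {R : RootVectors H} {B : Set (Module.Dual K H)} {ξ : ℕ → Module.Dual K H} {m : ℕ}
  {i : ℕ} {α β γ : Module.Dual K H}

theorem add_mem_stagePos (hα : α ∈ stagePos R B ξ i) (hβ : β ∈ stagePos R B ξ i)
    (h : α + β ∈ roots H) : α + β ∈ stagePos R B ξ i :=
  ⟨⟨h, add_mem hα.1.2 hβ.1.2⟩, fun j hj => by
    rw [LinearMap.add_apply, hα.2 j hj, hβ.2 j hj, add_zero]⟩

theorem mem_roots (hξ : IsKostantCascade R B ξ m) (hi : i < m) : ξ i ∈ roots H :=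
  (hξ.mem i hi).1.1

theorem add_ne_zero (hB : IsBase H B) (hα : α ∈ stagePos R B ξ i) (hβ : β ∈ stagePos R B ξ i) :
    α + β ≠ 0 := by
  intro h
  refine hB.neg_notMem_posRoots hα.1 ?_
  rw [neg_eq_of_add_eq_zero_right h]
  exact hβ.1

/-- Maximality of `ξ i`: the sum would be a strictly larger root of the same stage. -/
theorem add_notMem_roots (hξ : IsKostantCascade R B ξ m) (hi : i < m)
    (hα : α ∈ stagePos R B ξ i) : ξ i + α ∉ roots H := by
  intro h
  have h1 := hξ.maximal i hi (ξ i + α) (add_mem_stagePos (hξ.mem i hi) hα h)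
    (by rw [add_sub_cancel_left]; exact hα.1.2)
  exact hα.1.1.1 (by simpa using h1)

theorem lie_E_xi (hξ : IsKostantCascade R B ξ m) (hB : IsBase H B) (hi : i < m)
    (hα : α ∈ stagePos R B ξ i) : ⁅R.E (ξ i), R.E α⁆ = 0 :=
  R.lie_E_E_eq_zero (hξ.mem_roots hi) hα.1.1 (add_ne_zero hB (hξ.mem i hi) hα)
    (hξ.add_notMem_roots hi hα)

theorem exists_nat (hξ : IsKostantCascade R B ξ m) (hB : IsBase H B) (hi : i < m)
    (hα : α ∈ stagePos R B ξ i) : ∃ n : ℕ, α (R.coroot (ξ i)) = n :=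
  R.exists_nat_of_lie_eq_zero (hξ.mem_roots hi) hα.1.1 (hξ.lie_E_xi hB hi hα)

theorem mem_Gam_or (hξ : IsKostantCascade R B ξ m) (hB : IsBase H B) (hi : i < m)
    (hα : α ∈ stagePos R B ξ i) : α ∈ Gam R B ξ i ∨ α ∈ stagePos R B ξ (i + 1) := by
  obtain ⟨n, hn⟩ := hξ.exists_nat hB hi hα
  rcases Nat.eq_zero_or_pos n with rfl | h
  · right
    refine ⟨hα.1, fun j hj => ?_⟩
    rcases Nat.lt_succ_iff_lt_or_eq.1 hj with hj | rfl
    · exact hα.2 j hj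
    · simpa using hn
  · exact Or.inl ⟨hα, n, h, hn⟩

theorem stagePos_anti {j : ℕ} (hij : i ≤ j) : stagePos R B ξ j ⊆ stagePos R B ξ i :=
  fun _ h => ⟨h.1, fun k hk => h.2 k (hk.trans_le hij)⟩

/-- Strong orthogonality. If `ξ i - β` were a root, `E (β - ξ i)` would have weight -2 for the
sl2-triple of `ξ i`, be killed by `E (-ξ i)`, and be sent by `E (ξ i)` to a multiple of `E β`,
itself killed by `E (-ξ i)`. Then the coroot, being the commutator of the two, would kill it as
well, contradicting its weight. -/
theorem sub_notMem_roots (hξ : IsKostantCascade R B ξ m) (hB : IsBase H B) (hi : i < m)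
    (hβ : β ∈ stagePos R B ξ (i + 1)) : ξ i - β ∉ roots H := by
  intro h
  have hβi : β ∈ stagePos R B ξ i := stagePos_anti (Nat.le_succ i) hβ
  have hβ0 : β (R.coroot (ξ i)) = 0 := hβ.2 i (Nat.lt_succ_self i)
  have hγ : (ξ i - β) (R.coroot (ξ i)) = 2 := by
    rw [LinearMap.sub_apply, R.apply_coroot_self (hξ.mem_roots hi), hβ0, sub_zero]
  have hnr : -(ξ i - β) ∈ roots H := R.neg_mem_roots h
  -- `E β` has weight 0 and is killed by `E (ξ i)`; a nonzero bracket with `E (-ξ i)` would be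
  -- primitive of weight -2.
  have hlow : ⁅R.E (-ξ i), R.E β⁆ = 0 := by
    by_contra hne
    have h' : -ξ i + β ≠ 0 := by
      intro h0
      apply h.1
      rw [sub_eq_zero, ← sub_eq_zero, ← neg_eq_zero, ← h0]; abel
    have P : (R.sl2 _ (hξ.mem_roots hi)).HasPrimitiveVectorWith ⁅R.E (-ξ i), R.E β⁆ (-2 : K) := by
      refine ⟨hne, ?_, ?_⟩
      · rw [leibniz_lie, (R.sl2 _ (hξ.mem_roots hi)).lie_lie_smul_f K, R.lie_cartan_E hβ.1.1,
          hβ0, zero_smul, lie_zero, add_zero, neg_lie, smul_lie, neg_smul]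
      · rw [leibniz_lie, (R.sl2 _ (hξ.mem_roots hi)).lie_e_f, R.lie_cartan_E hβ.1.1, hβ0,
          hξ.lie_E_xi hB hi hβi]
        simp
    obtain ⟨n, hn⟩ := P.exists_nat
    have : ((n + 2 : ℕ) : K) = 0 := by rw [Nat.cast_add, ← hn]; norm_num
    rw [Nat.cast_eq_zero] at this
    omega
  obtain ⟨c, hc⟩ := R.exists_lie_E_E_eq (hξ.mem_roots hi) hnr
    (by rw [neg_sub, add_sub_cancel]; exact hβ.1.1)
  rw [neg_sub, add_sub_cancel] at hc
  -- Maximality is used twice: if `ξ i - β` is positive it cannot be added to `ξ i`, and if it is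
  -- negative then `β` lies above `ξ i`.
  have hf : ⁅R.E (-ξ i), R.E (β - ξ i)⁆ = 0 := by
    rcases hB.pos_or_neg _ h with hpos | hneg
    · have hmem : ξ i - β ∈ stagePos R B ξ i := ⟨⟨h, hpos⟩, fun j hj => by
        rw [LinearMap.sub_apply, (hξ.mem i hi).2 j hj, hβi.2 j hj, sub_zero]⟩
      refine R.lie_E_E_eq_zero (R.neg_mem_roots (hξ.mem_roots hi)) (by rwa [← neg_sub]) ?_ ?_
      · intro h0
        refine add_ne_zero hB (hξ.mem i hi) hmem ?_
        rw [← neg_eq_zero, ← h0]; abel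
      · intro hr
        refine hξ.add_notMem_roots hi hmem ?_
        have := R.neg_mem_roots hr
        rwa [show -(-ξ i + (β - ξ i)) = ξ i + (ξ i - β) by abel] at this
    · exfalso
      have := hξ.maximal i hi β hβi (by rwa [← neg_sub])
      exact h.1 (by rw [this, sub_self])
  have h1 : ⁅R.E (-ξ i), ⁅R.E (ξ i), R.E (β - ξ i)⁆⁆ = 0 := by
    rw [hc, lie_smul, hlow, smul_zero]
  have h2 : ⁅R.E (ξ i), ⁅R.E (-ξ i), R.E (β - ξ i)⁆⁆ = 0 := by rw [hf, lie_zero]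
  rw [leibniz_lie, (R.sl2 _ (hξ.mem_roots hi)).lie_e_f, h1, add_zero] at h2
  rw [neg_sub] at hnr
  rw [R.lie_cartan_E hnr, smul_eq_zero] at h2
  rcases h2 with h2 | h2
  · rw [← neg_sub, LinearMap.neg_apply, hγ] at h2
    norm_num at h2
  · exact R.E_ne_zero hnr h2

theorem xi_mem_Gam (hξ : IsKostantCascade R B ξ m) (hi : i < m) : ξ i ∈ Gam R B ξ i :=
  ⟨hξ.mem i hi, 2, by norm_num, by rw [R.apply_coroot_self (hξ.mem_roots hi)]; norm_num⟩

/-- A vector of positive weight is not killed by `E (-ξ i)`, so `ξ i - γ` is a root, positive by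
maximality. The values of `γ` and `ξ i - γ` on the coroot add up to 2; the second is not 0, for
otherwise `ξ i - γ` would be orthogonal to `ξ i` and `sub_notMem_roots` would forbid the root `γ`.
Hence both are 1. -/
theorem Gam0_spec (hξ : IsKostantCascade R B ξ m) (hB : IsBase H B) (hi : i < m)
    (hγ : γ ∈ Gam0 R B ξ i) : ξ i - γ ∈ stagePos R B ξ i ∧ γ (R.coroot (ξ i)) = 1 := by
  obtain ⟨⟨hγs, n, hn, hγn⟩, hne⟩ := hγ
  have hne' : γ ≠ ξ i := hne
  have hf : ⁅R.E (-ξ i), R.E γ⁆ ≠ 0 := by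
    intro h0
    obtain ⟨k, hk⟩ := R.exists_nat_of_lie_neg_eq_zero (hξ.mem_roots hi) hγs.1.1 h0
    rw [hγn] at hk
    have : ((n + k : ℕ) : K) = 0 := by rw [Nat.cast_add, hk]; ring
    rw [Nat.cast_eq_zero] at this
    omega
  have hr : ξ i - γ ∈ roots H := by
    have h1 : -ξ i + γ ∈ roots H := by
      by_contra hr
      refine hf (R.lie_E_E_eq_zero (R.neg_mem_roots (hξ.mem_roots hi)) hγs.1.1 ?_ hr)
      intro h0
      exact hne' (by rw [neg_add_eq_zero] at h0; exact h0.symm)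
    have := R.neg_mem_roots h1
    rwa [show -(-ξ i + γ) = ξ i - γ by abel] at this
  have hpos : ξ i - γ ∈ stagePos R B ξ i := by
    rcases hB.pos_or_neg _ hr with hpos | hneg
    · exact ⟨⟨hr, hpos⟩, fun j hj => by
        rw [LinearMap.sub_apply, (hξ.mem i hi).2 j hj, hγs.2 j hj, sub_zero]⟩
    · exact absurd (hξ.maximal i hi γ hγs (by rwa [← neg_sub])) hne'
  refine ⟨hpos, ?_⟩
  obtain ⟨k, hk⟩ := hξ.exists_nat hB hi hpos
  rw [LinearMap.sub_apply, R.apply_coroot_self (hξ.mem_roots hi), hγn] at hk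
  have hkn : k + n = 2 := by
    have : ((k + n : ℕ) : K) = ((2 : ℕ) : K) := by rw [Nat.cast_add, ← hk]; norm_num
    exact_mod_cast this
  have hk0 : k ≠ 0 := by
    rintro rfl
    refine hξ.sub_notMem_roots hB hi (β := ξ i - γ) ⟨hpos.1, fun j hj => ?_⟩ ?_
    · rcases Nat.lt_succ_iff_lt_or_eq.1 hj with hj | rfl
      · exact hpos.2 j hj
      · rw [LinearMap.sub_apply, R.apply_coroot_self (hξ.mem_roots hi), hγn, hk, Nat.cast_zero]
    · rw [sub_sub_cancel]; exact hγs.1.1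
  obtain rfl : n = 1 := by omega
  rw [hγn, Nat.cast_one]

theorem sub_mem_Gam0 (hξ : IsKostantCascade R B ξ m) (hB : IsBase H B) (hi : i < m)
    (hγ : γ ∈ Gam0 R B ξ i) : ξ i - γ ∈ Gam0 R B ξ i := by
  obtain ⟨h1, h2⟩ := hξ.Gam0_spec hB hi hγ
  refine ⟨⟨h1, 1, one_pos, ?_⟩, ?_⟩
  · rw [LinearMap.sub_apply, R.apply_coroot_self (hξ.mem_roots hi), h2]; norm_num
  · intro h
    have h : ξ i - γ = ξ i := h
    exact hγ.1.1.1.1.1 (by simpa using h)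

/-- The next stage normalizes the Heisenberg algebra without reaching its centre: a sum equal to `ξ
i` is excluded by `sub_notMem_roots`. -/
theorem add_mem_Gam0 (hξ : IsKostantCascade R B ξ m) (hB : IsBase H B) (hi : i < m)
    (hβ : β ∈ stagePos R B ξ (i + 1)) (hγ : γ ∈ Gam0 R B ξ i) (h : β + γ ∈ roots H) :
    β + γ ∈ Gam0 R B ξ i := by
  have hβi : β ∈ stagePos R B ξ i := stagePos_anti (Nat.le_succ i) hβ
  refine ⟨⟨add_mem_stagePos hβi hγ.1.1 h, 1, one_pos, ?_⟩, ?_⟩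
  · rw [LinearMap.add_apply, hβ.2 i (Nat.lt_succ_self i), (hξ.Gam0_spec hB hi hγ).2]; norm_num
  · intro h
    refine hξ.sub_notMem_roots hB hi hβ ?_
    have h : β + γ = ξ i := h
    rw [← h, add_sub_cancel_left]
    exact hγ.1.1.1.1

/-- The sum takes the value 2 on the coroot of `ξ i`, whereas elements of `Gam0` take the value 1.
-/
theorem add_eq_xi (hξ : IsKostantCascade R B ξ m) (hB : IsBase H B) (hi : i < m)
    (hβ : β ∈ Gam0 R B ξ i) (hγ : γ ∈ Gam0 R B ξ i) (h : β + γ ∈ roots H) : β + γ = ξ i := by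
  by_contra hne
  have h2 : (β + γ) (R.coroot (ξ i)) = 2 := by
    rw [LinearMap.add_apply, (hξ.Gam0_spec hB hi hβ).2, (hξ.Gam0_spec hB hi hγ).2]; norm_num
  have hmem : β + γ ∈ Gam0 R B ξ i :=
    ⟨⟨add_mem_stagePos hβ.1.1 hγ.1.1 h, 2, two_pos, by rw [h2]; norm_num⟩, hne⟩
  rw [(hξ.Gam0_spec hB hi hmem).2] at h2
  norm_num at h2

theorem lie_Gam0_eq_zero (hξ : IsKostantCascade R B ξ m) (hB : IsBase H B) (hi : i < m)
    (hβ : β ∈ Gam0 R B ξ i) (hγ : γ ∈ Gam0 R B ξ i) (h : β + γ ≠ ξ i) :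
    ⁅R.E β, R.E γ⁆ = 0 :=
  R.lie_E_E_eq_zero hβ.1.1.1.1 hγ.1.1.1.1 (add_ne_zero hB hβ.1.1 hγ.1.1)
    (fun hr => h (hξ.add_eq_xi hB hi hβ hγ hr))

theorem lie_Gam0_sub (hξ : IsKostantCascade R B ξ m) (hB : IsBase H B) (hi : i < m)
    (hγ : γ ∈ Gam0 R B ξ i) :
    ⁅R.E γ, R.E (ξ i - γ)⁆ = structConst R γ (ξ i - γ) • R.E (ξ i) := by
  have h := R.exists_lie_E_E_eq hγ.1.1.1.1 (hξ.sub_mem_Gam0 hB hi hγ).1.1.1.1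
    (by rw [add_sub_cancel]; exact hξ.mem_roots hi)
  have : ⁅R.E γ, R.E (ξ i - γ)⁆ = structConst R γ (ξ i - γ) • R.E (γ + (ξ i - γ)) :=
    Classical.epsilon_spec h
  rwa [add_sub_cancel] at this

/-- The vector `[E (-γ), E (ξ i)]` is nonzero, since `E (-γ)` has weight -1 and cannot be primitive
for `ξ i`; it is a multiple of `E (ξ i - γ)`. If the constant vanished, `E γ` would kill this
vector, forcing `ξ i` to vanish on the coroot of `γ`; the vector would then be primitive of weight
-2 for the triple of `γ`. -/
theorem structConst_ne_zero (hξ : IsKostantCascade R B ξ m) (hB : IsBase H B) (hi : i < m)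
    (hγ : γ ∈ Gam0 R B ξ i) : structConst R γ (ξ i - γ) ≠ 0 := by
  intro h0
  have hr := hγ.1.1.1.1
  have hx := hξ.mem_roots hi
  have h1 := hξ.lie_Gam0_sub hB hi hγ
  rw [h0, zero_smul] at h1
  have hv : ⁅R.E (-γ), R.E (ξ i)⁆ ≠ 0 := by
    intro h
    have h2 : ⁅R.E (ξ i), R.E (-γ)⁆ = 0 := by rw [← lie_skew, h, neg_zero]
    obtain ⟨n, hn⟩ := R.exists_nat_of_lie_eq_zero hx (R.neg_mem_roots hr) h2
    rw [LinearMap.neg_apply, (hξ.Gam0_spec hB hi hγ).2] at hn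
    have : ((n + 1 : ℕ) : K) = 0 := by rw [Nat.cast_add, ← hn]; norm_num
    rw [Nat.cast_eq_zero] at this
    omega
  have hr' : -γ + ξ i ∈ roots H := by
    rw [neg_add_eq_sub]; exact (hξ.sub_mem_Gam0 hB hi hγ).1.1.1.1
  obtain ⟨d, hd⟩ := R.exists_lie_E_E_eq (R.neg_mem_roots hr) hx hr'
  rw [neg_add_eq_sub] at hd
  have hz : ⁅R.E γ, ⁅R.E (-γ), R.E (ξ i)⁆⁆ = 0 := by rw [hd, lie_smul, h1, smul_zero]
  have hγξ : ⁅R.E γ, R.E (ξ i)⁆ = 0 := by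
    rw [← lie_skew, hξ.lie_E_xi hB hi hγ.1.1, neg_zero]
  have hc : (ξ i) (R.coroot γ) = 0 := by
    have hz' := hz
    rw [leibniz_lie, (R.sl2 _ hr).lie_e_f, hγξ, lie_zero, add_zero, R.lie_cartan_E hx,
      smul_eq_zero] at hz'
    exact hz'.resolve_right (R.E_ne_zero hx)
  have P : (R.sl2 _ hr).HasPrimitiveVectorWith ⁅R.E (-γ), R.E (ξ i)⁆ (-2 : K) := by
    refine ⟨hv, ?_, hz⟩
    rw [leibniz_lie, (R.sl2 _ hr).lie_lie_smul_f K, R.lie_cartan_E hx,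
      hc, zero_smul, lie_zero, add_zero, neg_lie, smul_lie, neg_smul]
  obtain ⟨n, hn⟩ := P.exists_nat
  have : ((n + 2 : ℕ) : K) = 0 := by rw [Nat.cast_add, ← hn]; norm_num
  rw [Nat.cast_eq_zero] at this
  omega

/-- For `j < i` this is part of the definition. For `i < j`, `E (ξ i)` commutes with both `E (ξ j)`
and `E (-ξ j)`, hence with their bracket. -/
theorem xi_apply_coroot (hξ : IsKostantCascade R B ξ m) (hB : IsBase H B) {j : ℕ} (hi : i < m)
    (hj : j < m) (hij : i ≠ j) : ξ i (R.coroot (ξ j)) = 0 := by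
  rcases lt_or_gt_of_ne hij with h | h
  · have hs : ξ j ∈ stagePos R B ξ (i + 1) := stagePos_anti h (hξ.mem j hj)
    have hx := hξ.mem_roots hi
    have hy := hξ.mem_roots hj
    have h1 := hξ.lie_E_xi hB hi (stagePos_anti (Nat.le_succ i) hs)
    have h2 : ⁅R.E (ξ i), R.E (-ξ j)⁆ = 0 := by
      refine R.lie_E_E_eq_zero hx (R.neg_mem_roots hy) ?_ ?_
      · intro h0
        have h3 : ξ i = ξ j := by rwa [← sub_eq_add_neg, sub_eq_zero] at h0
        have h4 := hs.2 i (Nat.lt_succ_self i)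
        rw [← h3, R.apply_coroot_self hx] at h4
        norm_num at h4
      · rw [← sub_eq_add_neg]; exact hξ.sub_notMem_roots hB hi hs
    have h3 : ⁅R.E (ξ i), ⁅R.E (ξ j), R.E (-ξ j)⁆⁆ = 0 := by
      rw [leibniz_lie, h1, h2, zero_lie, lie_zero, add_zero]
    rw [(R.sl2 _ hy).lie_e_f, ← lie_skew, R.lie_cartan_E hx, neg_eq_zero, smul_eq_zero] at h3
    exact h3.resolve_right (R.E_ne_zero hx)
  · exact (hξ.mem i hi).2 j h

theorem exists_mem_Gam (hξ : IsKostantCascade R B ξ m) (hB : IsBase H B)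
    (hα : α ∈ posRoots H B) : ∃ i < m, α ∈ Gam R B ξ i := by
  by_contra! hne
  have : ∀ i ≤ m, α ∈ stagePos R B ξ i := by
    intro i
    induction i with
    | zero => exact fun _ => ⟨hα, fun j hj => absurd hj (Nat.not_lt_zero j)⟩
    | succ i ih =>
      intro hi
      exact (hξ.mem_Gam_or hB hi (ih (by omega))).resolve_left (hne i hi)
  have h := this m le_rfl
  rw [hξ.exhausted] at h
  exact h

theorem Gam_disjoint {j : ℕ} (hi : α ∈ Gam R B ξ i) (hj : α ∈ Gam R B ξ j) : i = j := by
  by_contra hij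
  wlog h : i < j generalizing i j
  · exact this hj hi (Ne.symm hij) (by omega)
  obtain ⟨-, n, hn, hn'⟩ := hi
  rw [hj.1.2 i h] at hn'
  exact hn.ne (by exact_mod_cast hn')

end IsKostantCascade

/-! ### Locally nilpotent derivations with a slice -/

section Slice

open Polynomial

variable {K F : Type*} [Field K] [CharZero K] [Field F] [Algebra K F]

/-- The constants of a derivation. -/
def constants (D : Derivation K F F) : Subalgebra K F where
  carrier := {a | D a = 0}
  mul_mem' {a b} ha hb := by
    simp only [Set.mem_ofPred_eq] at ha hb ⊢
    rw [D.leibniz, ha, hb]; simp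
  add_mem' {a b} ha hb := by
    simp only [Set.mem_ofPred_eq] at ha hb ⊢
    rw [map_add, ha, hb, add_zero]
  algebraMap_mem' r := by simp

theorem mem_constants {D : Derivation K F F} {a : F} : a ∈ constants D ↔ D a = 0 := Iff.rfl

theorem inv_mem_constants {D : Derivation K F F} {a : F} (h : a ∈ constants D) :
    a⁻¹ ∈ constants D := by
  rw [mem_constants] at h ⊢
  rw [Derivation.leibniz_inv, h, smul_zero]

theorem iterate_derivation_zero (D : Derivation K F F) (n : ℕ) : (⇑D)^[n] 0 = 0 :=
  iterate_map_zero D n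

theorem iterate_eq_zero_of_le {D : Derivation K F F} {a : F} {n k : ℕ} (h : (⇑D)^[n] a = 0)
    (hk : n ≤ k) : (⇑D)^[k] a = 0 := by
  obtain ⟨j, rfl⟩ := Nat.exists_eq_add_of_le hk
  rw [add_comm, Function.iterate_add_apply, h, iterate_derivation_zero]

theorem iterate_leibniz (D : Derivation K F F) (n : ℕ) (a b : F) :
    (⇑D)^[n] (a * b) = ∑ ij ∈ Finset.HasAntidiagonal.antidiagonal n,
      n.choose ij.1 • ((⇑D)^[ij.1] a * (⇑D)^[ij.2] b) := by
  induction n with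
  | zero => simp
  | succ n ih =>
    rw [Finset.sum_antidiagonal_choose_succ_nsmul (M := F)
      (fun i j => (⇑D)^[i] a * (⇑D)^[j] b) n, Function.iterate_succ_apply', ih, map_sum,
      ← Finset.sum_add_distrib]
    refine Finset.sum_congr rfl fun ij hij => ?_
    rw [map_nsmul, D.leibniz, Function.iterate_succ_apply', Function.iterate_succ_apply',
      n.choose_symm_of_eq_add (Finset.HasAntidiagonal.mem_antidiagonal.1 hij).symm, ← nsmul_add]
    simp only [smul_eq_mul]
    congr 1
    ring

/-- The elements on which a derivation acts nilpotently. -/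
def nilElements (D : Derivation K F F) : Subalgebra K F where
  carrier := {a | ∃ n, (⇑D)^[n] a = 0}
  mul_mem' {a b} := by
    rintro ⟨n, hn⟩ ⟨k, hk⟩
    refine ⟨n + k, ?_⟩
    rw [iterate_leibniz]
    refine Finset.sum_eq_zero fun ij hij => ?_
    rw [Finset.HasAntidiagonal.mem_antidiagonal] at hij
    rcases le_or_gt n ij.1 with h | h
    · rw [iterate_eq_zero_of_le hn h, zero_mul, smul_zero]
    · rw [iterate_eq_zero_of_le hk (by omega), mul_zero, smul_zero]
  add_mem' {a b} := by
    rintro ⟨n, hn⟩ ⟨k, hk⟩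
    refine ⟨n + k, ?_⟩
    rw [iterate_map_add, iterate_eq_zero_of_le hn (by omega), iterate_eq_zero_of_le hk (by omega),
      add_zero]
  algebraMap_mem' r := ⟨1, by simp⟩

theorem constants_le_nilElements (D : Derivation K F F) : constants D ≤ nilElements D :=
  fun _ h => ⟨1, h⟩

open Classical in
/-- The polynomial `∑ D^k(a) X^k / k!`, for an element on which `D` acts nilpotently. -/
def expPoly (D : Derivation K F F) (a : F) : F[X] :=
  if h : a ∈ nilElements D then
    ∑ k ∈ Finset.range (Nat.find h), monomial k ((k.factorial : K)⁻¹ • (⇑D)^[k] a)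
  else 0

theorem coeff_expPoly {D : Derivation K F F} {a : F} (h : a ∈ nilElements D) (k : ℕ) :
    (expPoly D a).coeff k = (k.factorial : K)⁻¹ • (⇑D)^[k] a := by
  classical
  have h' : ∃ n, (⇑D)^[n] a = 0 := h
  rw [expPoly, dif_pos h, finsetSum_coeff]
  simp only [coeff_monomial, Finset.sum_ite_eq', Finset.mem_range]
  split_ifs with hk
  · rfl
  · rw [iterate_eq_zero_of_le (Nat.find_spec h') (not_lt.1 hk), smul_zero]

/-- Leibniz's rule for the n-th iterate, divided by n!: `expPoly` is exp(XD). -/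
theorem expPoly_mul {D : Derivation K F F} {a b : F} (ha : a ∈ nilElements D)
    (hb : b ∈ nilElements D) : expPoly D (a * b) = expPoly D a * expPoly D b := by
  ext n
  rw [coeff_expPoly (mul_mem ha hb), coeff_mul, iterate_leibniz, Finset.smul_sum]
  refine Finset.sum_congr rfl fun ij hij => ?_
  rw [coeff_expPoly ha, coeff_expPoly hb, smul_mul_smul_comm, ← Nat.cast_smul_eq_nsmul K,
    smul_smul]
  congr 1
  rw [Finset.HasAntidiagonal.mem_antidiagonal] at hij
  subst hij
  have h1 := Nat.add_choose_mul_factorial_mul_factorial ij.1 ij.2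
  rw [← Nat.choose_symm_add] at h1
  have h2 : ((ij.1 + ij.2).choose ij.1 : K) * (ij.1.factorial : K) * (ij.2.factorial : K) =
      ((ij.1 + ij.2).factorial : K) := by exact_mod_cast h1
  have n1 : (ij.1.factorial : K) ≠ 0 := by exact_mod_cast ij.1.factorial_ne_zero
  have n2 : (ij.2.factorial : K) ≠ 0 := by exact_mod_cast ij.2.factorial_ne_zero
  have n3 : ((ij.1 + ij.2).factorial : K) ≠ 0 := by exact_mod_cast (ij.1 + ij.2).factorial_ne_zero
  field_simp
  rw [← h2]

theorem expPoly_add {D : Derivation K F F} {a b : F} (ha : a ∈ nilElements D)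
    (hb : b ∈ nilElements D) : expPoly D (a + b) = expPoly D a + expPoly D b := by
  ext n
  rw [coeff_expPoly (add_mem ha hb), coeff_add, coeff_expPoly ha, coeff_expPoly hb,
    iterate_map_add, smul_add]

theorem expPoly_of_mem_constants {D : Derivation K F F} {a : F} (h : a ∈ constants D) :
    expPoly D a = C a := by
  ext n
  rw [coeff_expPoly (constants_le_nilElements D h), coeff_C]
  rcases n with _ | n
  · simp
  · rw [Function.iterate_succ_apply, mem_constants.1 h, iterate_derivation_zero]; simp

theorem natDegree_expPoly_lt {D : Derivation K F F} {a : F} {n : ℕ} (h : (⇑D)^[n] a = 0)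
    (hn : 0 < n) : (expPoly D a).natDegree < n := by
  by_contra hle
  have hz : (expPoly D a).coeff (expPoly D a).natDegree = 0 := by
    rw [coeff_expPoly ⟨n, h⟩, iterate_eq_zero_of_le h (not_lt.1 hle), smul_zero]
  have h0 : expPoly D a = 0 := leadingCoeff_eq_zero.1 hz
  rw [h0, natDegree_zero] at hle
  exact hle hn

/-- The map `a ↦ ∑ (-1)^k D^k(a) Q^k / k!`. -/
def sliceProj (D : Derivation K F F) (Q a : F) : F :=
  ∑ᶠ k : ℕ, ((-1 : K) ^ k / (k.factorial : K)) • ((⇑D)^[k] a * Q ^ k)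

theorem sliceProj_eq_sum {D : Derivation K F F} {Q a : F} {n : ℕ} (h : (⇑D)^[n] a = 0) :
    sliceProj D Q a = ∑ k ∈ Finset.range n,
      ((-1 : K) ^ k / (k.factorial : K)) • ((⇑D)^[k] a * Q ^ k) := by
  refine finsum_eq_sum_of_support_subset _ fun k hk => ?_
  rw [Function.mem_support] at hk
  simp only [Finset.coe_range, Set.mem_Iio]
  by_contra hle
  rw [iterate_eq_zero_of_le h (not_lt.1 hle)] at hk
  simp at hk

/-- The projection is exp(XD) evaluated at X = -Q, so it inherits additivity and multiplicativity.
-/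
theorem sliceProj_eq_eval {D : Derivation K F F} {Q a : F} (h : a ∈ nilElements D) :
    sliceProj D Q a = (expPoly D a).eval (-Q) := by
  obtain ⟨n, hn⟩ := id h
  have hn' : (⇑D)^[n + 1] a = 0 := iterate_eq_zero_of_le hn n.le_succ
  rw [sliceProj_eq_sum hn', eval_eq_sum_range' (natDegree_expPoly_lt hn' n.succ_pos)]
  refine Finset.sum_congr rfl fun k _ => ?_
  rw [coeff_expPoly h, neg_pow Q k, Algebra.smul_def, Algebra.smul_def, div_eq_mul_inv, map_mul,
    map_pow, map_neg, map_one]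
  ring

theorem sliceProj_mul {D : Derivation K F F} {Q a b : F} (ha : a ∈ nilElements D)
    (hb : b ∈ nilElements D) : sliceProj D Q (a * b) = sliceProj D Q a * sliceProj D Q b := by
  rw [sliceProj_eq_eval ha, sliceProj_eq_eval hb, sliceProj_eq_eval (mul_mem ha hb),
    expPoly_mul ha hb, eval_mul]

theorem sliceProj_add {D : Derivation K F F} {Q a b : F} (ha : a ∈ nilElements D)
    (hb : b ∈ nilElements D) : sliceProj D Q (a + b) = sliceProj D Q a + sliceProj D Q b := by
  rw [sliceProj_eq_eval ha, sliceProj_eq_eval hb, sliceProj_eq_eval (add_mem ha hb),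
    expPoly_add ha hb, eval_add]

theorem sliceProj_of_mem_constants {D : Derivation K F F} {Q a : F} (ha : a ∈ constants D) :
    sliceProj D Q a = a := by
  rw [sliceProj_eq_eval (constants_le_nilElements D ha), expPoly_of_mem_constants ha, eval_C]

theorem sliceProj_self {D : Derivation K F F} {Q : F} (hQ : D Q = 1) : sliceProj D Q Q = 0 := by
  have h : (⇑D)^[2] Q = 0 := by simp [hQ]
  rw [sliceProj_eq_sum h]
  simp [Finset.sum_range_succ, hQ]

theorem sliceProj_mem_constants {D : Derivation K F F} {Q a : F} (hQ : D Q = 1)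
    (ha : a ∈ nilElements D) : sliceProj D Q a ∈ constants D := by
  obtain ⟨n, hn⟩ := ha
  -- Because `D Q = 1`, the derivative of the partial sum telescopes to its boundary term, which
  -- vanishes for large n.
  have key : ∀ n : ℕ, D (∑ k ∈ Finset.range (n + 1),
      ((-1 : K) ^ k / (k.factorial : K)) • ((⇑D)^[k] a * Q ^ k)) =
      ((-1 : K) ^ n / (n.factorial : K)) • ((⇑D)^[n + 1] a * Q ^ n) := by
    intro n
    induction n with
    | zero => simp
    | succ n ih =>
      rw [Finset.sum_range_succ, map_add, ih, Derivation.map_smul, D.leibniz, D.leibniz_pow, hQ,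
        ← Function.iterate_succ_apply' (⇑D) (n + 1) a]
      have hs : ((-1 : K) ^ (n + 1) / ((n + 1).factorial : K)) * ((n + 1 : ℕ) : K) =
          -((-1 : K) ^ n / (n.factorial : K)) := by
        have h1 : (n.factorial : K) ≠ 0 := by exact_mod_cast n.factorial_ne_zero
        have h2 : ((n + 1 : ℕ) : K) ≠ 0 := by exact_mod_cast n.succ_ne_zero
        rw [Nat.factorial_succ, Nat.cast_mul]
        field_simp
        ring
      have e : (⇑D)^[n + 1] a • (n + 1) • Q ^ (n + 1 - 1) • (1 : F) =
          ((n + 1 : ℕ) : K) • ((⇑D)^[n + 1] a * Q ^ n) := by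
        rw [Nat.cast_smul_eq_nsmul]
        simp
        ring
      rw [e, smul_add, smul_smul, hs, neg_smul, smul_eq_mul, mul_comm (Q ^ (n + 1))]
      abel
  have hn' : (⇑D)^[n + 1] a = 0 := iterate_eq_zero_of_le hn n.le_succ
  rw [mem_constants, sliceProj_eq_sum hn', key n, hn', zero_mul, smul_zero]

theorem iterate_mem {D : Derivation K F F} {W : Subalgebra K F} (hD : ∀ a ∈ W, D a ∈ W) {a : F}
    (ha : a ∈ W) (k : ℕ) : (⇑D)^[k] a ∈ W := by
  induction k with
  | zero => exact ha
  | succ k ih => rw [Function.iterate_succ_apply']; exact hD _ ih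

theorem sliceProj_mem {D : Derivation K F F} {W : Subalgebra K F} (hD : ∀ a ∈ W, D a ∈ W)
    (hnil : W ≤ nilElements D) {Q : F} (hQ : Q ∈ W) {a : F} (ha : a ∈ W) :
    sliceProj D Q a ∈ W := by
  obtain ⟨n, hn⟩ := hnil ha
  rw [sliceProj_eq_sum hn]
  exact sum_mem fun k _ => W.smul_mem (mul_mem (iterate_mem hD ha k) (pow_mem hQ k)) _

/-- The projection of `a` is `a` plus terms in `D^k a`, k > 0, multiplied by powers of `Q`. These
`D^k a` have smaller order of nilpotency, so induction applies. -/
theorem le_adjoin_constants {D : Derivation K F F} {W : Subalgebra K F} (hD : ∀ a ∈ W, D a ∈ W)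
    (hnil : W ≤ nilElements D) {Q : F} (hQ : Q ∈ W) (hQ1 : D Q = 1) :
    W ≤ Algebra.adjoin K (((W ⊓ constants D : Subalgebra K F) : Set F) ∪ {Q}) := by
  have hQmem : Q ∈ Algebra.adjoin K (((W ⊓ constants D : Subalgebra K F) : Set F) ∪ {Q}) :=
    Algebra.subset_adjoin (Or.inr rfl)
  have key : ∀ n : ℕ, ∀ a ∈ W, (⇑D)^[n] a = 0 →
      a ∈ Algebra.adjoin K (((W ⊓ constants D : Subalgebra K F) : Set F) ∪ {Q}) := by
    intro n
    induction n with
    | zero => intro a _ h; simp only [Function.iterate_zero, id] at h; rw [h]; exact zero_mem _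
    | succ n ih =>
      intro a ha h
      have h1 := sliceProj_eq_sum (Q := Q) h
      rw [Finset.sum_range_succ'] at h1
      simp only [pow_zero, Nat.factorial_zero, Nat.cast_one, div_one, one_smul, mul_one,
        Function.iterate_zero, id] at h1
      rw [← sub_eq_iff_eq_add'] at h1
      rw [← h1]
      refine sub_mem (Algebra.subset_adjoin (Or.inl ⟨sliceProj_mem hD hnil hQ ha,
        sliceProj_mem_constants hQ1 (hnil ha)⟩)) (sum_mem fun k _ => ?_)
      refine Subalgebra.smul_mem _ (mul_mem (ih _ (iterate_mem hD ha _) ?_)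
        (pow_mem hQmem _)) _
      rw [← Function.iterate_add_apply]
      exact iterate_eq_zero_of_le h (by omega)
  intro a ha
  obtain ⟨n, hn⟩ := hnil ha
  exact key n a ha hn

/-! ### Towers of slices -/

/-- The elements of `W` killed by all derivations of a list. -/
def towerConstants : Subalgebra K F → List (Derivation K F F × F) → Subalgebra K F
  | W, [] => W
  | W, p :: l => towerConstants (W ⊓ constants p.1) l

/-- Each derivation of the list preserves the elements of `W` killed by the previous ones, acts
locally nilpotently on them, and has the second component as a slice among them. -/
def IsSliceTower : Subalgebra K F → List (Derivation K F F × F) → Prop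
  | _, [] => True
  | W, p :: l => (∀ a ∈ W, p.1 a ∈ W) ∧ W ≤ nilElements p.1 ∧ p.2 ∈ W ∧ p.1 p.2 = 1 ∧
      IsSliceTower (W ⊓ constants p.1) l

/-- The composite of the projections attached to a list of slices. -/
def towerProj (l : List (Derivation K F F × F)) (a : F) : F :=
  l.foldl (fun b p => sliceProj p.1 p.2 b) a

variable {W : Subalgebra K F} {l l' : List (Derivation K F F × F)} {a b : F}

theorem IsSliceTower.append (h : IsSliceTower W l) (h' : IsSliceTower (towerConstants W l) l') :
    IsSliceTower W (l ++ l') := by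
  induction l generalizing W with
  | nil => exact h'
  | cons p l ih => exact ⟨h.1, h.2.1, h.2.2.1, h.2.2.2.1, ih h.2.2.2.2 h'⟩

theorem mem_towerConstants :
    a ∈ towerConstants W l ↔ a ∈ W ∧ ∀ p ∈ l, a ∈ constants p.1 := by
  induction l generalizing W with
  | nil => simp [towerConstants]
  | cons p l ih =>
    rw [towerConstants, ih, Algebra.mem_inf]
    simp only [List.mem_cons, forall_eq_or_imp, and_assoc]

theorem towerProj_cons (p : Derivation K F F × F) :
    towerProj (p :: l) a = towerProj l (sliceProj p.1 p.2 a) := rfl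

theorem towerProj_append : towerProj (l ++ l') a = towerProj l' (towerProj l a) :=
  List.foldl_append

theorem IsSliceTower.towerProj_mem (h : IsSliceTower W l) (ha : a ∈ W) :
    towerProj l a ∈ towerConstants W l := by
  induction l generalizing W a with
  | nil => exact ha
  | cons p l ih =>
    exact ih h.2.2.2.2 ⟨sliceProj_mem h.1 h.2.1 h.2.2.1 ha,
      sliceProj_mem_constants h.2.2.2.1 (h.2.1 ha)⟩

theorem IsSliceTower.towerProj_mul (h : IsSliceTower W l) (ha : a ∈ W) (hb : b ∈ W) :
    towerProj l (a * b) = towerProj l a * towerProj l b := by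
  induction l generalizing W a b with
  | nil => rfl
  | cons p l ih =>
    rw [towerProj_cons, sliceProj_mul (h.2.1 ha) (h.2.1 hb)]
    exact ih h.2.2.2.2 ⟨sliceProj_mem h.1 h.2.1 h.2.2.1 ha,
      sliceProj_mem_constants h.2.2.2.1 (h.2.1 ha)⟩ ⟨sliceProj_mem h.1 h.2.1 h.2.2.1 hb,
      sliceProj_mem_constants h.2.2.2.1 (h.2.1 hb)⟩

theorem IsSliceTower.towerProj_add (h : IsSliceTower W l) (ha : a ∈ W) (hb : b ∈ W) :
    towerProj l (a + b) = towerProj l a + towerProj l b := by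
  induction l generalizing W a b with
  | nil => rfl
  | cons p l ih =>
    rw [towerProj_cons, sliceProj_add (h.2.1 ha) (h.2.1 hb)]
    exact ih h.2.2.2.2 ⟨sliceProj_mem h.1 h.2.1 h.2.2.1 ha,
      sliceProj_mem_constants h.2.2.2.1 (h.2.1 ha)⟩ ⟨sliceProj_mem h.1 h.2.1 h.2.2.1 hb,
      sliceProj_mem_constants h.2.2.2.1 (h.2.1 hb)⟩

theorem towerProj_eq_self (h : ∀ p ∈ l, a ∈ constants p.1) : towerProj l a = a := by
  induction l with
  | nil => rfl
  | cons p l ih =>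
    rw [towerProj_cons, sliceProj_of_mem_constants (h p List.mem_cons_self)]
    exact ih fun q hq => h q (List.mem_cons_of_mem _ hq)

/-- A slice is a constant of all earlier derivations, so it reaches its own projection unchanged and
is killed there. -/
theorem IsSliceTower.towerProj_slice (h : IsSliceTower W l) {p : Derivation K F F × F}
    (hp : p ∈ l) : towerProj l p.2 = 0 := by
  induction l generalizing W with
  | nil => simp at hp
  | cons q l ih =>
    rw [towerProj_cons]
    by_cases hpl : p ∈ l
    · have hmem : ∀ {V : Subalgebra K F} {l : List (Derivation K F F × F)}, IsSliceTower V l →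
          p ∈ l → p.2 ∈ V := by
        intro V l hV hp
        induction l generalizing V with
        | nil => simp at hp
        | cons r l ih =>
          rcases List.mem_cons.1 hp with rfl | hp
          · exact hV.2.2.1
          · exact (ih hV.2.2.2.2 hp).1
      rw [sliceProj_of_mem_constants (hmem h.2.2.2.2 hpl).2]
      exact ih h.2.2.2.2 hpl
    · obtain rfl : p = q := (List.mem_cons.1 hp).resolve_right hpl
      rw [sliceProj_self h.2.2.2.1]
      exact towerProj_eq_self fun r _ => zero_mem _

theorem IsSliceTower.le_adjoin (h : IsSliceTower W l) :
    W ≤ Algebra.adjoin K ((towerConstants W l : Set F) ∪ {q | ∃ p ∈ l, q = p.2}) := by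
  induction l generalizing W with
  | nil => exact fun a ha => Algebra.subset_adjoin (Or.inl ha)
  | cons p l ih =>
    refine (le_adjoin_constants h.1 h.2.1 h.2.2.1 h.2.2.2.1).trans (Algebra.adjoin_le ?_)
    rintro a (ha | rfl)
    · refine Algebra.adjoin_mono ?_ (ih h.2.2.2.2 ha)
      refine Set.union_subset_union_right _ ?_
      rintro q ⟨r, hr, rfl⟩
      exact ⟨r, List.mem_cons_of_mem _ hr, rfl⟩
    · exact Algebra.subset_adjoin (Or.inr ⟨p, List.mem_cons_self, rfl⟩)

/-- A quotient of elements of `W` which is killed by the derivations of a slice tower is a quotient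
of elements of `W` killed by these derivations. -/
theorem IsSliceTower.exists_mul_eq (h : IsSliceTower W l) {f : F}
    (hf : ∀ p ∈ l, f ∈ constants p.1) (hW : ∃ b ∈ W, b ≠ 0 ∧ f * b ∈ W) :
    ∃ b ∈ towerConstants W l, b ≠ 0 ∧ f * b ∈ towerConstants W l := by
  induction l generalizing W with
  | nil => exact hW
  | cons p l ih =>
    refine ih h.2.2.2.2 (fun q hq => hf q (List.mem_cons_of_mem _ hq)) ?_
    obtain ⟨b, hb, hb0, hfb⟩ := hW
    have hfp := mem_constants.1 (hf p List.mem_cons_self)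
    -- The new denominator is the last nonzero iterate of the derivation on `b`; iterates commute
    -- with multiplication by the constant `f`.
    obtain ⟨n, hn, hn'⟩ := Nat.exists_not_and_succ_of_not_zero_of_exists
      (p := fun n => (⇑p.1)^[n] b = 0) hb0 (h.2.1 hb)
    have hk : ∀ k, (⇑p.1)^[k] (f * b) = f * (⇑p.1)^[k] b := by
      intro k
      induction k with
      | zero => rfl
      | succ k ihk =>
        rw [Function.iterate_succ_apply', Function.iterate_succ_apply', ihk, p.1.leibniz, hfp]
        simp
    refine ⟨(⇑p.1)^[n] b, ⟨iterate_mem h.1 hb n, ?_⟩, hn, ?_, ?_⟩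
    · rw [Function.iterate_succ_apply'] at hn'; exact hn'
    · rw [← hk]; exact iterate_mem h.1 hfb n
    · refine mul_mem (hf p List.mem_cons_self) ?_
      rw [Function.iterate_succ_apply'] at hn'; exact hn'

end Slice

/-! ### The Poisson bracket -/

section PoissonBracket

variable {K g : Type*} [Field K] [LieRing g] [LieAlgebra K g]

theorem lieDer_lie (x y : g) (a : Fld K g) :
    lieDer K ⁅x, y⁆ a = lieDer K x (lieDer K y a) - lieDer K y (lieDer K x a) := by
  have h : lieDer K ⁅x, y⁆ = ⁅lieDer K x, lieDer K y⁆ := by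
    apply derivation_ext
    intro z
    rw [Derivation.commutator_apply]
    simp only [lieDer_emb]
    rw [← map_sub, lie_lie]
  rw [h, Derivation.commutator_apply]

theorem poisson_apply_emb (a : Fld K g) (y : g) : poisson a (emb y) = -lieDer K y a := by
  simp [poisson]

theorem poisson_add_left (a b c : Fld K g) : poisson (a + b) c = poisson a c + poisson b c := by
  have h : poisson (a + b) = poisson a + poisson b := by
    apply derivation_ext
    intro z
    rw [Derivation.add_apply, poisson_apply_emb, poisson_apply_emb, poisson_apply_emb, map_add]
    ring
  rw [h, Derivation.add_apply]

theorem poisson_mul_left (a b c : Fld K g) :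
    poisson (a * b) c = a * poisson b c + b * poisson a c := by
  have h : poisson (a * b) = a • poisson b + b • poisson a := by
    apply derivation_ext
    intro z
    rw [Derivation.add_apply, Derivation.smul_apply, Derivation.smul_apply, poisson_apply_emb,
      poisson_apply_emb, poisson_apply_emb, Derivation.leibniz]
    simp only [smul_eq_mul]
    ring
  rw [h]
  simp

theorem poisson_smul_left (r : K) (a c : Fld K g) : poisson (r • a) c = r • poisson a c := by
  have h : poisson (r • a) = r • poisson a := by
    apply derivation_ext
    intro z
    rw [Derivation.smul_apply, poisson_apply_emb, poisson_apply_emb, Derivation.map_smul, smul_neg]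
  rw [h, Derivation.smul_apply]

/-- The definition is asymmetric. The bracket is however a derivation in its first argument too, so
the two derivations need only be compared on `g`. -/
theorem poisson_swap (a b : Fld K g) : poisson a b = -poisson b a := by
  let D : Derivation K (Fld K g) (Fld K g) := Derivation.mk'
    { toFun := fun a => poisson a b
      map_add' := fun a a' => poisson_add_left a a' b
      map_smul' := fun r a => poisson_smul_left r a b }
    (fun a a' => poisson_mul_left a a' b)
  have h : D = -poisson b := by
    apply derivation_ext
    intro z
    rw [Derivation.neg_apply, poisson_apply_emb, neg_neg]
    change poisson (emb z) b = _
    rw [poisson_emb]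
  have := congrArg (fun E => E a) h
  exact this

theorem poisson_sub_left (a b c : Fld K g) : poisson (a - b) c = poisson a c - poisson b c := by
  rw [poisson_swap, map_sub, poisson_swap a, poisson_swap b]; ring

theorem lieDer_poisson (z : g) (a b : Fld K g) :
    lieDer K z (poisson a b) = poisson (lieDer K z a) b + poisson a (lieDer K z b) := by
  have h : ⁅lieDer K z, poisson a⁆ = poisson (lieDer K z a) := by
    apply derivation_ext
    intro y
    rw [Derivation.commutator_apply, lieDer_emb, poisson_apply_emb, poisson_apply_emb,
      poisson_apply_emb, lieDer_lie, map_neg]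
    ring
  rw [← h, Derivation.commutator_apply]
  ring

/-- Jacobi's identity. As an identity of derivations it may be tested on `g`, where it says that
`lieDer` respects the bracket. -/
theorem poisson_poisson (a b c : Fld K g) :
    poisson a (poisson b c) = poisson (poisson a b) c + poisson b (poisson a c) := by
  have h : ⁅poisson a, poisson b⁆ = poisson (poisson a b) := by
    apply derivation_ext
    intro z
    rw [Derivation.commutator_apply, poisson_apply_emb, poisson_apply_emb, poisson_apply_emb,
      map_neg, map_neg, lieDer_poisson, poisson_swap b (lieDer K z a)]
    ring
  rw [← h, Derivation.commutator_apply]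
  ring

end PoissonBracket

/-! ### Invariants of the exponentials -/

section Invariants

open Polynomial

variable {K g : Type*} [Field K] [CharZero K] [LieRing g] [LieAlgebra K g]

theorem iterate_lieDer_emb (x y : g) (k : ℕ) :
    (⇑(lieDer K x))^[k] (emb y) = emb (((LieAlgebra.ad K g x) ^ k) y) := by
  induction k with
  | zero => simp
  | succ k ih => rw [Function.iterate_succ_apply', ih, lieDer_emb, pow_succ']; rfl

theorem algebraMap_mem_of_emb_mem {A : Subalgebra K (Fld K g)} (h : ∀ y : g, emb y ∈ A)
    (a : SymmetricAlgebra K g) : algebraMap _ (Fld K g) a ∈ A := by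
  induction a using SymmetricAlgebra.induction with
  | algebraMap r =>
    rw [← IsScalarTower.algebraMap_apply K (SymmetricAlgebra K g) (Fld K g)]
    exact A.algebraMap_mem r
  | ι x => exact h x
  | mul a b ha hb => rw [map_mul]; exact mul_mem ha hb
  | add a b ha hb => rw [map_add]; exact add_mem ha hb

theorem algebraMap_mem_nilElements {x : g} (hx : IsNilpotent (LieAlgebra.ad K g x))
    (a : SymmetricAlgebra K g) : algebraMap _ (Fld K g) a ∈ nilElements (lieDer K x) := by
  refine algebraMap_mem_of_emb_mem (fun y => ?_) a
  obtain ⟨n, hn⟩ := hx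
  exact ⟨n, by rw [iterate_lieDer_emb, hn]; simp⟩

theorem act_expAd_emb {x : g} (hx : IsNilpotent (LieAlgebra.ad K g x)) (y : g) :
    act (expAd x hx) (emb y : Fld K g) = (expPoly (lieDer K x) (emb y)).eval 1 := by
  have hn : (⇑(lieDer K x))^[nilpotencyClass (LieAlgebra.ad K g x)] (emb y) = 0 := by
    rw [iterate_lieDer_emb, pow_nilpotencyClass hx]; simp
  have hn' := iterate_eq_zero_of_le hn (Nat.le_succ _)
  rw [act_emb, eval_eq_sum_range' (natDegree_expPoly_lt hn' (Nat.succ_pos _)),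
    Finset.sum_range_succ, coeff_expPoly ⟨_, hn⟩, hn, smul_zero, zero_mul, add_zero]
  change emb (expAdLin x y) = _
  rw [expAdLin, LinearMap.sum_apply, map_sum]
  refine Finset.sum_congr rfl fun k _ => ?_
  rw [coeff_expPoly ⟨_, hn⟩, iterate_lieDer_emb, one_pow, mul_one, LinearMap.smul_apply, map_smul]

theorem act_expAd_algebraMap {x : g} (hx : IsNilpotent (LieAlgebra.ad K g x))
    (a : SymmetricAlgebra K g) :
    act (expAd x hx) (algebraMap _ (Fld K g) a) =
      (expPoly (lieDer K x) (algebraMap _ (Fld K g) a)).eval 1 := by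
  induction a using SymmetricAlgebra.induction with
  | algebraMap r =>
    rw [← IsScalarTower.algebraMap_apply K (SymmetricAlgebra K g) (Fld K g),
      expPoly_of_mem_constants (Subalgebra.algebraMap_mem _ r), eval_C, AlgEquiv.commutes]
  | ι y => exact act_expAd_emb hx y
  | mul a b ha hb =>
    rw [map_mul, map_mul, expPoly_mul (algebraMap_mem_nilElements hx a)
      (algebraMap_mem_nilElements hx b), eval_mul, ha, hb]
  | add a b ha hb =>
    rw [map_add, map_add, expPoly_add (algebraMap_mem_nilElements hx a)
      (algebraMap_mem_nilElements hx b), eval_add, ha, hb]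

/-- On a quotient the exponential series need not terminate. Writing `a = f b` moves the question to
S(g), where the series is finite and multiplicative and a constant `f` factors out. -/
theorem act_expAd_eq_self {x : g} (hx : IsNilpotent (LieAlgebra.ad K g x)) {f : Fld K g}
    (hf : lieDer K x f = 0) : act (expAd x hx) f = f := by
  obtain ⟨a, b, hb, rfl⟩ := IsFractionRing.div_surjective (A := SymmetricAlgebra K g) f
  have hb0 : algebraMap _ (Fld K g) b ≠ 0 :=
    IsFractionRing.to_map_ne_zero_of_mem_nonZeroDivisors hb
  set f := algebraMap _ (Fld K g) a / algebraMap _ (Fld K g) b with hfdef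
  have hab : algebraMap _ (Fld K g) a = f * algebraMap _ (Fld K g) b := by
    rw [hfdef, div_mul_cancel₀ _ hb0]
  have h1 := act_expAd_algebraMap hx a
  have hfc : f ∈ constants (lieDer K x) := hf
  rw [hab, expPoly_mul (constants_le_nilElements _ hfc) (algebraMap_mem_nilElements hx b), eval_mul,
    expPoly_of_mem_constants hfc, eval_C, ← act_expAd_algebraMap hx b, map_mul] at h1
  exact mul_right_cancel₀ ((_root_.map_ne_zero _).2 hb0) h1

theorem iterate_lieDer_smul (c : K) (x : g) (a : Fld K g) (k : ℕ) :
    (⇑(lieDer K (c • x)))^[k] a = c ^ k • (⇑(lieDer K x))^[k] a := by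
  induction k with
  | zero => simp
  | succ k ih =>
    rw [Function.iterate_succ_apply', ih, Derivation.map_smul, lieDer_smul, Derivation.smul_apply,
      Function.iterate_succ_apply', smul_smul, pow_succ]

theorem eval_one_expPoly_smul {c : K} {x : g} {a : Fld K g} (ha : a ∈ nilElements (lieDer K x)) :
    (expPoly (lieDer K (c • x)) a).eval 1 =
      (expPoly (lieDer K x) a).eval (algebraMap K (Fld K g) c) := by
  obtain ⟨n, hn⟩ := id ha
  have hn1 := iterate_eq_zero_of_le hn (Nat.le_succ n)
  have hn2 : (⇑(lieDer K (c • x)))^[n.succ] a = 0 := by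
    rw [iterate_lieDer_smul, hn1, smul_zero]
  rw [eval_eq_sum_range' (natDegree_expPoly_lt hn1 n.succ_pos),
    eval_eq_sum_range' (natDegree_expPoly_lt hn2 n.succ_pos)]
  refine Finset.sum_congr rfl fun k _ => ?_
  rw [coeff_expPoly ha, coeff_expPoly ⟨_, hn2⟩, iterate_lieDer_smul, one_pow, mul_one,
    smul_comm, Algebra.smul_def, map_pow, mul_comm]

/-- With `f = a / b`, invariance under exp(c x) for all c in K says that the polynomial exp(XD)a - f
exp(XD)b vanishes at every point of the infinite field K. Its coefficient of X gives `D a = f D b`,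
whence `D f = 0`. -/
theorem lieDer_eq_zero_of_act {x : g} (hx : IsNilpotent (LieAlgebra.ad K g x)) {f : Fld K g}
    (hf : ∀ (c : K) (h : IsNilpotent (LieAlgebra.ad K g (c • x))), act (expAd (c • x) h) f = f) :
    lieDer K x f = 0 := by
  obtain ⟨a, b, hb, rfl⟩ := IsFractionRing.div_surjective (A := SymmetricAlgebra K g) f
  have hb0 : algebraMap _ (Fld K g) b ≠ 0 :=
    IsFractionRing.to_map_ne_zero_of_mem_nonZeroDivisors hb
  set f := algebraMap _ (Fld K g) a / algebraMap _ (Fld K g) b with hfdef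
  have hab : algebraMap _ (Fld K g) a = f * algebraMap _ (Fld K g) b := by
    rw [hfdef, div_mul_cancel₀ _ hb0]
  have hna := algebraMap_mem_nilElements hx a
  have hnb := algebraMap_mem_nilElements hx b
  have heval : ∀ c : K, (expPoly (lieDer K x) (algebraMap _ (Fld K g) a) -
      C f * expPoly (lieDer K x) (algebraMap _ (Fld K g) b)).eval (algebraMap K (Fld K g) c) = 0 := by
    intro c
    have hc : IsNilpotent (LieAlgebra.ad K g (c • x)) := by rw [map_smul]; exact hx.smul c
    have h1 := congrArg (act (expAd (c • x) hc)) hab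
    rw [map_mul, hf c hc, act_expAd_algebraMap hc, act_expAd_algebraMap hc,
      eval_one_expPoly_smul hna, eval_one_expPoly_smul hnb] at h1
    rw [eval_sub, eval_mul, eval_C, h1, sub_self]
  have hzero : expPoly (lieDer K x) (algebraMap _ (Fld K g) a) -
      C f * expPoly (lieDer K x) (algebraMap _ (Fld K g) b) = 0 := by
    refine eq_zero_of_infinite_isRoot _ ?_
    refine (Set.infinite_range_of_injective (algebraMap K (Fld K g)).injective).mono ?_
    rintro _ ⟨c, rfl⟩
    exact heval c
  have h1 := congrArg (fun p => p.coeff 1) hzero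
  simp only [coeff_sub, coeff_C_mul, coeff_zero, coeff_expPoly hna, coeff_expPoly hnb,
    Nat.factorial_one, Nat.cast_one, inv_one, one_smul, Function.iterate_one] at h1
  rw [hab, Derivation.leibniz] at h1
  simp only [smul_eq_mul, add_sub_cancel_left, mul_eq_zero] at h1
  exact h1.resolve_left hb0

variable {H : LieSubalgebra K g} [LieRing.IsNilpotent H] {R : RootVectors H}
  {B : Set (Module.Dual K H)}

theorem mem_invariantField_iff
    (hnil : ∀ x ∈ nilradical R B, IsNilpotent (LieAlgebra.ad K g x)) {f : Fld K g} :
    f ∈ invariantField R B ↔ ∀ x ∈ nilradical R B, lieDer K x f = 0 := by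
  rw [invariantField, IntermediateField.mem_fixedField_iff]
  constructor
  · intro h x hx
    refine lieDer_eq_zero_of_act (hnil x hx) fun c hc => ?_
    exact h _ (Subgroup.subset_closure ⟨c • x, Submodule.smul_mem _ _ hx, hc, rfl⟩)
  · intro h σ hσ
    induction hσ using Subgroup.closure_induction with
    | mem σ hσ =>
      obtain ⟨x, hx, hx', rfl⟩ := hσ
      exact act_expAd_eq_self hx' (h x hx)
    | one => rfl
    | mul σ τ _ _ h1 h2 => rw [AlgEquiv.mul_apply, h2, h1]
    | inv σ _ h1 =>
      have h2 := congrArg (⇑σ⁻¹) h1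
      rw [← AlgEquiv.mul_apply, inv_mul_cancel, AlgEquiv.one_apply] at h2
      exact h2.symm

end Invariants

/-! ### Nilpotency of the adjoint action of the nilradical -/

section Nilpotent

variable {K g : Type*} [Field K] [CharZero K] [LieRing g] [LieAlgebra K g]
  [FiniteDimensional K g] [HasCentralRadical K g]
  {H : LieSubalgebra K g} [H.IsCartanSubalgebra] [IsTriangularizable K H g]
  {R : RootVectors H} {B : Set (Module.Dual K H)}

/-- The sum of the root spaces of integral height at least `n`, for a height function `φ`. -/
def heightFiltration (H : LieSubalgebra K g) [LieRing.IsNilpotent H]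
    (φ : Module.Dual K (Module.Dual K H)) (n : ℤ) : Submodule K g :=
  ⨆ (χ : Module.Dual K H) (_ : ∃ k : ℤ, n ≤ k ∧ φ χ = k), (rootSpace H (χ : H → K)).toSubmodule

theorem mem_heightFiltration {φ : Module.Dual K (Module.Dual K H)} {n k : ℤ}
    {χ : Module.Dual K H} (hn : n ≤ k) (hk : φ χ = k) {x : g} (hx : x ∈ rootSpace H (χ : H → K)) :
    x ∈ heightFiltration H φ n :=
  Submodule.mem_iSup_of_mem χ (Submodule.mem_iSup_of_mem ⟨k, hn, hk⟩ hx)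

theorem lie_mem_heightFiltration {φ : Module.Dual K (Module.Dual K H)} (hφ : ∀ b ∈ B, φ b = 1)
    {x : g} (hx : x ∈ nilradical R B) {n : ℤ} {y : g} (hy : y ∈ heightFiltration H φ n) :
    ⁅x, y⁆ ∈ heightFiltration H φ (n + 1) := by
  induction hx using Submodule.span_induction with
  | zero => simp
  | add u v _ _ hu hv => rw [add_lie]; exact add_mem hu hv
  | smul c u _ hu => rw [smul_lie]; exact Submodule.smul_mem _ _ hu
  | mem u hu =>
    obtain ⟨α, hα, rfl⟩ := hu
    obtain ⟨a, ha, ha0⟩ := exists_nat_of_mem_closure hφ hα.2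
    have ha1 : a ≠ 0 := fun h => hα.1.1 (ha0 h)
    have hle : heightFiltration H φ n ≤
        (heightFiltration H φ (n + 1)).comap (LieAlgebra.ad K g (R.E α) : g →ₗ[K] g) := by
      refine iSup₂_le fun χ hχ z hz => ?_
      obtain ⟨k, hnk, hk⟩ := hχ
      refine mem_heightFiltration (k := a + k) (χ := α + χ) (by omega)
        (by rw [map_add, ha, hk]; simp) ?_
      exact lie_mem_genWeightSpace_of_mem_genWeightSpace (R.E_mem α hα.1) hz
    exact hle hy

theorem isNilpotent_ad (hB : IsBase H B) {x : g} (hx : x ∈ nilradical R B) :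
    IsNilpotent (LieAlgebra.ad K g x) := by
  obtain ⟨φ, hφ⟩ := hB.exists_height
  have hint : ∀ α ∈ roots H, ∃ k : ℤ, φ α = k := by
    intro α hα
    rcases hB.pos_or_neg α hα with h | h
    · obtain ⟨n, hn, -⟩ := exists_nat_of_mem_closure hφ h
      exact ⟨n, by simpa using hn⟩
    · obtain ⟨n, hn, -⟩ := exists_nat_of_mem_closure hφ h
      exact ⟨-n, by rw [map_neg] at hn; rw [Int.cast_neg, Int.cast_natCast, ← hn, neg_neg]⟩
  choose! ht hht using hint
  have hfin : (roots H).Finite := RootVectors.finite_roots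
  -- `N` bounds the absolute values of the heights of roots. The filtration is everything at -N and
  -- zero at N + 1, and `ad x` raises it by one, so 2N + 1 applications suffice.
  set N : ℕ := hfin.toFinset.sup (fun α => (ht α).natAbs) with hN
  have hbound : ∀ α ∈ roots H, (ht α).natAbs ≤ N := fun α hα =>
    Finset.le_sup (f := fun α => (ht α).natAbs) (hfin.mem_toFinset.2 hα)
  have htop : heightFiltration H φ (-N) = ⊤ := by
    rw [eq_top_iff, ← R.cartan_sup_span_E, sup_le_iff, Submodule.span_le]
    constructor
    · intro y hy
      exact mem_heightFiltration (k := 0) (χ := 0) (by omega) (by simp)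
        ((RootVectors.mem_cartan_iff y).1 hy)
    · rintro _ ⟨α, hα, rfl⟩
      have := hbound α hα
      exact mem_heightFiltration (k := ht α) (by omega) (hht α hα) (R.E_mem α hα)
  have hbot : heightFiltration H φ (N + 1) = ⊥ := by
    rw [eq_bot_iff]
    refine iSup₂_le fun χ hχ z hz => ?_
    obtain ⟨k, hnk, hk⟩ := hχ
    by_contra hz0
    have hz0' : z ≠ 0 := hz0
    have hχ0 : χ ≠ 0 := by
      rintro rfl
      rw [map_zero] at hk
      have : k = 0 := by exact_mod_cast hk.symm
      omega
    have hχr := RootVectors.mem_roots_of_mem_rootSpace hχ0 hz hz0'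
    have h1 := hbound χ hχr
    have h2 : ht χ = k := by
      have := hht χ hχr
      rw [hk] at this
      exact_mod_cast this.symm
    omega
  refine ⟨2 * N + 1, ?_⟩
  ext y
  have hpow : ∀ k : ℕ, ((LieAlgebra.ad K g x) ^ k) y ∈ heightFiltration H φ (-N + k) := by
    intro k
    induction k with
    | zero => simp [htop]
    | succ k ih =>
      rw [pow_succ']
      have := lie_mem_heightFiltration hφ hx ih
      rw [add_assoc] at this
      simpa using this
  have h := hpow (2 * N + 1)
  rw [show (-(N : ℤ) + (2 * N + 1 : ℕ)) = N + 1 by push_cast; ring, hbot] at h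
  simpa using h

end Nilpotent

/-! ### The Borel subalgebras attached to the stages of the cascade -/

section BorelStage

variable {K g : Type*} [Field K] [CharZero K] [LieRing g] [LieAlgebra K g]
  [FiniteDimensional K g] [HasCentralRadical K g]
  {H : LieSubalgebra K g} [H.IsCartanSubalgebra] [IsTriangularizable K H g]
  (R : RootVectors H) (B : Set (Module.Dual K H)) (ξ : ℕ → Module.Dual K H)

/-- The span of the elements of `H` orthogonal to `ξ j`, `j < i`, and of the root vectors of the
positive roots orthogonal to `ξ j`, `j < i`. -/
def borelStage (i : ℕ) : Submodule K g :=
  (cascadeOrth ξ i).map H.toSubmodule.subtype ⊔ Submodule.span K (R.E '' stagePos R B ξ i)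

variable {R B ξ} {m i : ℕ} {α β γ : Module.Dual K H} {x y : g}

theorem mem_cascadeOrth {h : H} : h ∈ cascadeOrth ξ i ↔ ∀ j < i, ξ j h = 0 := by
  simp [cascadeOrth, Submodule.mem_iInf, Fin.forall_iff]

theorem E_mem_borelStage (hα : α ∈ stagePos R B ξ i) : R.E α ∈ borelStage R B ξ i :=
  Submodule.mem_sup_right (Submodule.subset_span ⟨α, hα, rfl⟩)

theorem cartan_mem_borelStage {h : H} (hh : ∀ j < i, ξ j h = 0) :
    (h : g) ∈ borelStage R B ξ i :=
  Submodule.mem_sup_left ⟨h, mem_cascadeOrth.2 hh, rfl⟩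

@[elab_as_elim]
theorem borelStage_induction {p : (x : g) → x ∈ borelStage R B ξ i → Prop}
    (hx : x ∈ borelStage R B ξ i) (zero : p 0 (zero_mem _))
    (add : ∀ u v hu hv, p u hu → p v hv → p (u + v) (add_mem hu hv))
    (smul : ∀ (c : K) u hu, p u hu → p (c • u) (Submodule.smul_mem _ c hu))
    (cartan : ∀ (h : H) (hh : ∀ j < i, ξ j h = 0), p h (cartan_mem_borelStage hh))
    (root : ∀ α (hα : α ∈ stagePos R B ξ i), p (R.E α) (E_mem_borelStage hα)) : p x hx := by
  obtain ⟨u, hu, v, hv, rfl⟩ := Submodule.mem_sup.1 hx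
  refine add _ _ (Submodule.mem_sup_left hu) (Submodule.mem_sup_right hv) ?_ ?_
  · obtain ⟨h, hh, rfl⟩ := hu
    exact cartan h (mem_cascadeOrth.1 hh)
  · clear hx
    induction hv using Submodule.span_induction with
    | zero => exact zero
    | add u v hu' hv' hu hv =>
      exact add _ _ (Submodule.mem_sup_right hu') (Submodule.mem_sup_right hv') hu hv
    | smul c u hu' hu => exact smul _ _ (Submodule.mem_sup_right hu') hu
    | mem u hu =>
      obtain ⟨α, hα, rfl⟩ := hu
      exact root α hα

theorem borelStage_succ_le : borelStage R B ξ (i + 1) ≤ borelStage R B ξ i := by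
  intro x hx
  induction hx using borelStage_induction with
  | zero => exact zero_mem _
  | add u v _ _ hu hv => exact add_mem hu hv
  | smul c u _ hu => exact Submodule.smul_mem _ _ hu
  | cartan h hh => exact cartan_mem_borelStage fun j hj => hh j (hj.trans (Nat.lt_succ_self i))
  | root α hα => exact E_mem_borelStage (IsKostantCascade.stagePos_anti (Nat.le_succ i) hα)

theorem lie_mem_borelStage (hξ : IsKostantCascade R B ξ m) (hB : IsBase H B) (hi : i ≤ m)
    (hx : x ∈ borelStage R B ξ i) (hy : y ∈ borelStage R B ξ i) :
    ⁅x, y⁆ ∈ borelStage R B ξ i := by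
  have hcr : ∀ h : H, ∀ α ∈ stagePos R B ξ i, ⁅(h : g), R.E α⁆ ∈ borelStage R B ξ i := by
    intro h α hα
    rw [R.lie_cartan_E hα.1.1]
    exact Submodule.smul_mem _ _ (E_mem_borelStage hα)
  induction hx using borelStage_induction with
  | zero => rw [zero_lie]; exact zero_mem _
  | add u v _ _ hu hv => rw [add_lie]; exact add_mem hu hv
  | smul c u _ hu => rw [smul_lie]; exact Submodule.smul_mem _ _ hu
  | cartan h hh =>
    induction hy using borelStage_induction with
    | zero => rw [lie_zero]; exact zero_mem _
    | add u v _ _ hu hv => rw [lie_add]; exact add_mem hu hv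
    | smul c u _ hu => rw [lie_smul]; exact Submodule.smul_mem _ _ hu
    | cartan h' hh' =>
      -- Commutativity of `H` is not invoked: `ξ j` vanishes on `[h, h']` because `h` and `h'` act
      -- on `E (ξ j)` by scalars.
      rw [← LieSubalgebra.coe_bracket]
      refine cartan_mem_borelStage fun j hj => ?_
      have hr := hξ.mem_roots (hj.trans_le hi)
      have h1 := R.lie_cartan_E hr ⁅h, h'⁆
      rw [LieSubalgebra.coe_bracket, lie_lie, R.lie_cartan_E hr, R.lie_cartan_E hr, lie_smul,
        lie_smul, R.lie_cartan_E hr, R.lie_cartan_E hr, hh j hj, hh' j hj] at h1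
      simp only [zero_smul, smul_zero, sub_self] at h1
      exact (smul_eq_zero.1 h1.symm).resolve_right (R.E_ne_zero hr)
    | root α hα => exact hcr h α hα
  | root α hα =>
    induction hy using borelStage_induction with
    | zero => rw [lie_zero]; exact zero_mem _
    | add u v _ _ hu hv => rw [lie_add]; exact add_mem hu hv
    | smul c u _ hu => rw [lie_smul]; exact Submodule.smul_mem _ _ hu
    | cartan h hh => rw [← lie_skew]; exact neg_mem (hcr h α hα)
    | root β hβ =>
      by_cases h : α + β ∈ roots H
      · obtain ⟨c, hc⟩ := R.exists_lie_E_E_eq hα.1.1 hβ.1.1 h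
        rw [hc]
        exact Submodule.smul_mem _ _
          (E_mem_borelStage (IsKostantCascade.add_mem_stagePos hα hβ h))
      · rw [R.lie_E_E_eq_zero hα.1.1 hβ.1.1 (IsKostantCascade.add_ne_zero hB hα hβ) h]
        exact zero_mem _

theorem coroot_mem_borelStage (hξ : IsKostantCascade R B ξ m) (hB : IsBase H B) (hi : i < m) :
    (R.coroot (ξ i) : g) ∈ borelStage R B ξ i :=
  cartan_mem_borelStage fun _ hj => hξ.xi_apply_coroot hB (hj.trans hi) hi hj.ne

theorem lie_E_xi_eq_zero (hξ : IsKostantCascade R B ξ m) (hB : IsBase H B) (hi : i < m)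
    (hx : x ∈ borelStage R B ξ (i + 1)) : ⁅x, R.E (ξ i)⁆ = 0 := by
  induction hx using borelStage_induction with
  | zero => rw [zero_lie]
  | add u v _ _ hu hv => rw [add_lie, hu, hv, add_zero]
  | smul c u _ hu => rw [smul_lie, hu, smul_zero]
  | cartan h hh => rw [R.lie_cartan_E (hξ.mem_roots hi), hh i (Nat.lt_succ_self i), zero_smul]
  | root α hα =>
    rw [← lie_skew, hξ.lie_E_xi hB hi (IsKostantCascade.stagePos_anti (Nat.le_succ i) hα),
      neg_zero]

theorem lie_E_Gam0_mem (hξ : IsKostantCascade R B ξ m) (hB : IsBase H B) (hi : i < m)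
    (hx : x ∈ borelStage R B ξ (i + 1)) (hγ : γ ∈ Gam0 R B ξ i) :
    ⁅x, R.E γ⁆ ∈ Submodule.span K (R.E '' Gam0 R B ξ i) := by
  induction hx using borelStage_induction with
  | zero => rw [zero_lie]; exact zero_mem _
  | add u v _ _ hu hv => rw [add_lie]; exact add_mem hu hv
  | smul c u _ hu => rw [smul_lie]; exact Submodule.smul_mem _ _ hu
  | cartan h hh =>
    rw [R.lie_cartan_E hγ.1.1.1.1]
    exact Submodule.smul_mem _ _ (Submodule.subset_span ⟨γ, hγ, rfl⟩)
  | root α hα =>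
    by_cases h : α + γ ∈ roots H
    · obtain ⟨c, hc⟩ := R.exists_lie_E_E_eq hα.1.1 hγ.1.1.1.1 h
      rw [hc]
      exact Submodule.smul_mem _ _
        (Submodule.subset_span ⟨_, hξ.add_mem_Gam0 hB hi hα hγ h, rfl⟩)
    · rw [R.lie_E_E_eq_zero hα.1.1 hγ.1.1.1.1 (IsKostantCascade.add_ne_zero hB
        (IsKostantCascade.stagePos_anti (Nat.le_succ i) hα) hγ.1.1) h]
      exact zero_mem _

theorem span_Gam0_le : Submodule.span K (R.E '' Gam0 R B ξ i) ≤ borelStage R B ξ i := by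
  rw [Submodule.span_le]
  rintro _ ⟨γ, hγ, rfl⟩
  exact E_mem_borelStage hγ.1.1

theorem eq_or_mem_Gam0 (hγ : γ ∈ Gam R B ξ i) : γ = ξ i ∨ γ ∈ Gam0 R B ξ i := by
  by_cases h : γ = ξ i
  · exact Or.inl h
  · exact Or.inr ⟨hγ, h⟩

end BorelStage

/-! ### The correction elements of a Heisenberg algebra -/

section Heisenberg

variable {K g : Type*} [Field K] [CharZero K] [LieRing g] [LieAlgebra K g]
  [FiniteDimensional K g] [HasCentralRadical K g]
  {H : LieSubalgebra K g} [H.IsCartanSubalgebra] [IsTriangularizable K H g]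
  (R : RootVectors H) (B : Set (Module.Dual K H)) (ξ : ℕ → Module.Dual K H)

/-- The finite set of roots `Gam0 R B ξ i`. -/
def gamFinset (i : ℕ) : Finset (Module.Dual K H) :=
  ((RootVectors.finite_roots (H := H)).subset
    (fun _ h => h.1.1.1.1 : Gam0 R B ξ i ⊆ roots H)).toFinset

theorem mem_gamFinset {i : ℕ} {γ : Module.Dual K H} :
    γ ∈ gamFinset R B ξ i ↔ γ ∈ Gam0 R B ξ i := by
  simp [gamFinset]

/-- The linear map `x ↦ b_x`, given by an explicit formula. -/
def corrLin (i : ℕ) (t : g →ₗ[K] Fld K g) : g →ₗ[K] Fld K g :=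
  ∑ γ ∈ gamFinset R B ξ i, (2 * structConst R γ (ξ i - γ))⁻¹ •
    (LinearMap.mulRight K (t (R.E γ) * (t (R.E (ξ i)))⁻¹) ∘ₗ t ∘ₗ
      (-(LieAlgebra.ad K g (R.E (ξ i - γ)) : g →ₗ[K] g)))

/-- An element x acts on the Heisenberg algebra by a derivation A that kills the centre z, so A is
infinitesimally symplectic. Such an A is the bracket with half the sum of N⁻¹ A(e_{γ'}) e_γ z⁻¹; the
half appears because both factors of the products contribute equally. -/
theorem corrLin_apply (i : ℕ) (t : g →ₗ[K] Fld K g) (x : g) :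
    corrLin R B ξ i t x = ∑ γ ∈ gamFinset R B ξ i, (2 * structConst R γ (ξ i - γ))⁻¹ •
      (t ⁅x, R.E (ξ i - γ)⁆ * (t (R.E γ) * (t (R.E (ξ i)))⁻¹)) := by
  rw [corrLin, LinearMap.sum_apply]
  refine Finset.sum_congr rfl fun γ _ => ?_
  simp only [LinearMap.smul_apply, LinearMap.comp_apply, LinearMap.neg_apply,
    LieAlgebra.ad_apply, LinearMap.mulRight_apply, lie_skew]

/-- The span of the products among which the correction elements are to be found. -/
def corrSpan (i : ℕ) (t : g → Fld K g) : Submodule K (Fld K g) :=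
  Submodule.span K {q | ∃ α ∈ Gam0 R B ξ i, ∃ β ∈ Gam0 R B ξ i,
    q = t (R.E α) * t (R.E β) * (t (R.E (ξ i)))⁻¹}

variable {R B ξ} {m i : ℕ} {t : g →ₗ[K] Fld K g} {α β γ δ : Module.Dual K H} {x y : g}

theorem mul_mul_mem_corrSpan (hx : x ∈ Submodule.span K (R.E '' Gam0 R B ξ i))
    (hy : y ∈ Submodule.span K (R.E '' Gam0 R B ξ i)) :
    t x * t y * (t (R.E (ξ i)))⁻¹ ∈ corrSpan R B ξ i t := by
  induction hx using Submodule.span_induction with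
  | zero => simp
  | add u v _ _ hu hv => rw [map_add, add_mul, add_mul]; exact add_mem hu hv
  | smul c u _ hu =>
    rw [map_smul, smul_mul_assoc, smul_mul_assoc]; exact Submodule.smul_mem _ _ hu
  | mem u hu =>
    obtain ⟨α, hα, rfl⟩ := hu
    induction hy using Submodule.span_induction with
    | zero => simp
    | add u v _ _ hu hv => rw [map_add, mul_add, add_mul]; exact add_mem hu hv
    | smul c u _ hu =>
      rw [map_smul, mul_smul_comm, smul_mul_assoc]; exact Submodule.smul_mem _ _ hu
    | mem u hu =>
      obtain ⟨β, hβ, rfl⟩ := hu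
      exact Submodule.subset_span ⟨α, hα, β, hβ, rfl⟩

theorem corrLin_mem (hξ : IsKostantCascade R B ξ m) (hB : IsBase H B) (hi : i < m)
    (hx : x ∈ borelStage R B ξ (i + 1)) : corrLin R B ξ i t x ∈ corrSpan R B ξ i t := by
  rw [corrLin_apply]
  refine sum_mem fun γ hγ => Submodule.smul_mem _ _ ?_
  rw [mem_gamFinset] at hγ
  rw [← mul_assoc]
  exact mul_mul_mem_corrSpan (lie_E_Gam0_mem hξ hB hi hx (hξ.sub_mem_Gam0 hB hi hγ))
    (Submodule.subset_span ⟨γ, hγ, rfl⟩)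

theorem poisson_inv_eq_zero {a z : Fld K g} (h : poisson a z = 0) : poisson a z⁻¹ = 0 := by
  rw [Derivation.leibniz_inv, h, smul_zero]

/-- `t` respects the brackets on the Borel subalgebra of the stage `i`. -/
def IsPoissonMap (R : RootVectors H) (B : Set (Module.Dual K H)) (ξ : ℕ → Module.Dual K H)
    (i : ℕ) (t : g →ₗ[K] Fld K g) : Prop :=
  ∀ x ∈ borelStage R B ξ i, ∀ y ∈ borelStage R B ξ i, poisson (t x) (t y) = t ⁅x, y⁆

namespace IsPoissonMap

theorem poisson_xi (ht : IsPoissonMap R B ξ i t) (hξ : IsKostantCascade R B ξ m)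
    (hB : IsBase H B) (hi : i < m) (hx : x ∈ borelStage R B ξ (i + 1)) :
    poisson (t x) (t (R.E (ξ i))) = 0 := by
  rw [ht _ (borelStage_succ_le hx) _ (E_mem_borelStage (hξ.mem i hi)),
    lie_E_xi_eq_zero hξ hB hi hx, map_zero]

theorem poisson_E_xi (ht : IsPoissonMap R B ξ i t) (hξ : IsKostantCascade R B ξ m)
    (hB : IsBase H B) (hi : i < m) (hγ : γ ∈ stagePos R B ξ i) :
    poisson (t (R.E γ)) (t (R.E (ξ i))) = 0 := by
  rw [ht _ (E_mem_borelStage hγ) _ (E_mem_borelStage (hξ.mem i hi)), ← lie_skew,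
    hξ.lie_E_xi hB hi hγ, neg_zero, map_zero]

theorem poisson_E_E (ht : IsPoissonMap R B ξ i t) (hξ : IsKostantCascade R B ξ m)
    (hB : IsBase H B) (hi : i < m) (hβ : β ∈ Gam0 R B ξ i) (hγ : γ ∈ Gam0 R B ξ i)
    (hne : β ≠ γ) : poisson (t (R.E β)) (t (R.E (ξ i - γ))) = 0 := by
  have hγ' := hξ.sub_mem_Gam0 hB hi hγ
  rw [ht _ (E_mem_borelStage hβ.1.1) _ (E_mem_borelStage hγ'.1.1),
    hξ.lie_Gam0_eq_zero hB hi hβ hγ', map_zero]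
  intro h
  apply hne
  rw [← sub_eq_zero, ← sub_eq_zero.2 h]
  abel

theorem poisson_E_E_self (ht : IsPoissonMap R B ξ i t) (hξ : IsKostantCascade R B ξ m)
    (hB : IsBase H B) (hi : i < m) (hγ : γ ∈ Gam0 R B ξ i) :
    poisson (t (R.E γ)) (t (R.E (ξ i - γ))) = structConst R γ (ξ i - γ) • t (R.E (ξ i)) := by
  rw [ht _ (E_mem_borelStage hγ.1.1) _ (E_mem_borelStage (hξ.sub_mem_Gam0 hB hi hγ).1.1),
    hξ.lie_Gam0_sub hB hi hγ, map_smul]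

/-- Euler's formula in degree one. -/
theorem euler_linear (ht : IsPoissonMap R B ξ i t) (hξ : IsKostantCascade R B ξ m)
    (hB : IsBase H B) (hi : i < m) (hx : x ∈ Submodule.span K (R.E '' Gam0 R B ξ i)) :
    ∑ γ ∈ gamFinset R B ξ i, (structConst R γ (ξ i - γ))⁻¹ •
      (poisson (t x) (t (R.E (ξ i - γ))) * t (R.E γ)) = t (R.E (ξ i)) * t x := by
  induction hx using Submodule.span_induction with
  | zero => simp [poisson_swap 0]
  | add u v _ _ hu hv =>
    rw [map_add, mul_add, ← hu, ← hv, ← Finset.sum_add_distrib]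
    refine Finset.sum_congr rfl fun γ _ => ?_
    rw [poisson_add_left, add_mul, smul_add]
  | smul c u _ hu =>
    rw [map_smul, mul_smul_comm, ← hu, Finset.smul_sum]
    refine Finset.sum_congr rfl fun γ _ => ?_
    rw [poisson_smul_left, smul_mul_assoc, smul_comm]
  | mem u hu =>
    obtain ⟨β, hβ, rfl⟩ := hu
    rw [Finset.sum_eq_single_of_mem β ((mem_gamFinset R B ξ).2 hβ)]
    · rw [ht.poisson_E_E_self hξ hB hi hβ, smul_mul_assoc, smul_smul,
        inv_mul_cancel₀ (hξ.structConst_ne_zero hB hi hβ), one_smul]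
    · intro γ hγ hne
      rw [ht.poisson_E_E hξ hB hi hβ ((mem_gamFinset R B ξ).1 hγ) hne.symm, zero_mul, smul_zero]

theorem poisson_inv_xi (ht : IsPoissonMap R B ξ i t) (hξ : IsKostantCascade R B ξ m)
    (hB : IsBase H B) (hi : i < m) (hγ : γ ∈ stagePos R B ξ i) :
    poisson (t (R.E (ξ i)))⁻¹ (t (R.E γ)) = 0 := by
  rw [poisson_swap, poisson_inv_eq_zero (ht.poisson_E_xi hξ hB hi hγ), neg_zero]

/-- Euler's formula in degree two. -/
theorem euler_quadratic (ht : IsPoissonMap R B ξ i t) (hξ : IsKostantCascade R B ξ m)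
    (hB : IsBase H B) (hi : i < m) {b : Fld K g} (hb : b ∈ corrSpan R B ξ i t) :
    ∑ γ ∈ gamFinset R B ξ i, (structConst R γ (ξ i - γ))⁻¹ •
      (poisson b (t (R.E (ξ i - γ))) * t (R.E γ)) = 2 * (t (R.E (ξ i)) * b) := by
  induction hb using Submodule.span_induction with
  | zero => simp [poisson_swap 0]
  | add u v _ _ hu hv =>
    rw [mul_add, mul_add, ← hu, ← hv, ← Finset.sum_add_distrib]
    refine Finset.sum_congr rfl fun γ _ => ?_
    rw [poisson_add_left, add_mul, smul_add]
  | smul c u _ hu =>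
    rw [mul_smul_comm, mul_smul_comm, ← hu, Finset.smul_sum]
    refine Finset.sum_congr rfl fun γ _ => ?_
    rw [poisson_smul_left, smul_mul_assoc, smul_comm]
  | mem u hu =>
    obtain ⟨α, hα, β, hβ, rfl⟩ := hu
    have h1 := ht.euler_linear hξ hB hi (Submodule.subset_span ⟨α, hα, rfl⟩)
    have h2 := ht.euler_linear hξ hB hi (Submodule.subset_span ⟨β, hβ, rfl⟩)
    have h3 : ∀ γ ∈ gamFinset R B ξ i, (structConst R γ (ξ i - γ))⁻¹ •
        (poisson (t (R.E α) * t (R.E β) * (t (R.E (ξ i)))⁻¹) (t (R.E (ξ i - γ))) * t (R.E γ)) =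
        (t (R.E β) * (t (R.E (ξ i)))⁻¹) * ((structConst R γ (ξ i - γ))⁻¹ •
          (poisson (t (R.E α)) (t (R.E (ξ i - γ))) * t (R.E γ))) +
        (t (R.E α) * (t (R.E (ξ i)))⁻¹) * ((structConst R γ (ξ i - γ))⁻¹ •
          (poisson (t (R.E β)) (t (R.E (ξ i - γ))) * t (R.E γ))) := by
      intro γ hγ
      have hγ' := hξ.sub_mem_Gam0 hB hi ((mem_gamFinset R B ξ).1 hγ)
      rw [poisson_mul_left, poisson_mul_left, ht.poisson_inv_xi hξ hB hi hγ'.1.1, mul_smul_comm,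
        mul_smul_comm, ← smul_add]
      congr 1
      ring
    rw [Finset.sum_congr rfl h3, Finset.sum_add_distrib, ← Finset.mul_sum, ← Finset.mul_sum, h1, h2]
    ring

/-- Uniqueness of the correction: Euler's formula recovers a quadratic element from its brackets
with the Heisenberg generators. -/
theorem eq_zero_of_poisson_eq_zero (ht : IsPoissonMap R B ξ i t) (hZ : t (R.E (ξ i)) ≠ 0)
    (hξ : IsKostantCascade R B ξ m)
    (hB : IsBase H B) (hi : i < m) {b : Fld K g} (hb : b ∈ corrSpan R B ξ i t)
    (h : ∀ γ ∈ Gam0 R B ξ i, poisson b (t (R.E γ)) = 0) : b = 0 := by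
  have h1 := ht.euler_quadratic hξ hB hi hb
  rw [Finset.sum_eq_zero] at h1
  · have := h1.symm
    have h2 : (2 : Fld K g) ≠ 0 := by
      rw [← map_ofNat (algebraMap K (Fld K g)) 2]
      exact (_root_.map_ne_zero _).2 two_ne_zero
    exact ((mul_eq_zero.1 ((mul_eq_zero.1 this).resolve_left h2)).resolve_left hZ)
  · intro γ hγ
    rw [h _ (hξ.sub_mem_Gam0 hB hi ((mem_gamFinset R B ξ).1 hγ)), zero_mul, smul_zero]

theorem poisson_corrLin_sub (ht : IsPoissonMap R B ξ i t) (hZ : t (R.E (ξ i)) ≠ 0)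
    (hξ : IsKostantCascade R B ξ m) (hB : IsBase H B) (hi : i < m)
    (hx : x ∈ borelStage R B ξ (i + 1)) (hδ : δ ∈ Gam0 R B ξ i) :
    poisson (corrLin R B ξ i t x) (t (R.E (ξ i - δ))) = t ⁅x, R.E (ξ i - δ)⁆ := by
  classical
  have hδ' := hξ.sub_mem_Gam0 hB hi hδ
  have hxi := borelStage_succ_le hx
  have hlie := lie_E_Gam0_mem hξ hB hi hx hδ'
  have hsum : ∀ (s : Finset (Module.Dual K H)) (f : Module.Dual K H → Fld K g) (c : Fld K g),
      poisson (∑ γ ∈ s, f γ) c = ∑ γ ∈ s, poisson (f γ) c := by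
    intro s f c
    rw [poisson_swap, map_sum, ← Finset.sum_neg_distrib]
    exact Finset.sum_congr rfl fun γ _ => (poisson_swap _ _).symm
  -- The bracket with the factor `E γ` survives only for `γ = δ`. The bracket with the other factor
  -- becomes, by `hanti`, a term of Euler's linear formula for `[x, E (ξ i - δ)]`. Each part sums to
  -- half of the result.
  have hterm : ∀ γ ∈ gamFinset R B ξ i,
      poisson ((2 * structConst R γ (ξ i - γ))⁻¹ •
        (t ⁅x, R.E (ξ i - γ)⁆ * (t (R.E γ) * (t (R.E (ξ i)))⁻¹))) (t (R.E (ξ i - δ))) =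
      (2 : K)⁻¹ • (if γ = δ then t ⁅x, R.E (ξ i - δ)⁆ else 0) +
      (2 : K)⁻¹ • ((t (R.E (ξ i)))⁻¹ * ((structConst R γ (ξ i - γ))⁻¹ •
        (poisson (t ⁅x, R.E (ξ i - δ)⁆) (t (R.E (ξ i - γ))) * t (R.E γ)))) := by
    intro γ hγ
    rw [mem_gamFinset] at hγ
    have hγ' := hξ.sub_mem_Gam0 hB hi hγ
    have hlieγ := lie_E_Gam0_mem hξ hB hi hx hγ'
    -- `x` commutes with the bracket of the two root vectors, which is zero or central; this is the
    -- symplectic symmetry in `γ` and `δ`.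
    have hanti : poisson (t ⁅x, R.E (ξ i - γ)⁆) (t (R.E (ξ i - δ))) =
        poisson (t ⁅x, R.E (ξ i - δ)⁆) (t (R.E (ξ i - γ))) := by
      have h1 : ⁅x, ⁅R.E (ξ i - γ), R.E (ξ i - δ)⁆⁆ = 0 := by
        by_cases he : ξ i - γ + (ξ i - δ) = ξ i
        · have he' : ξ i - δ = ξ i - (ξ i - γ) := by
            rw [sub_sub_cancel]
            exact add_left_cancel (he.trans (sub_add_cancel _ _).symm)
          rw [he', hξ.lie_Gam0_sub hB hi hγ', lie_smul, lie_E_xi_eq_zero hξ hB hi hx, smul_zero]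
        · rw [hξ.lie_Gam0_eq_zero hB hi hγ' hδ' he, lie_zero]
      rw [ht _ (span_Gam0_le hlieγ) _ (E_mem_borelStage hδ'.1.1),
        ht _ (span_Gam0_le hlie) _ (E_mem_borelStage hγ'.1.1)]
      rw [leibniz_lie] at h1
      rw [eq_neg_of_add_eq_zero_left h1, lie_skew]
    have hN := hξ.structConst_ne_zero hB hi hγ
    rw [poisson_smul_left, poisson_mul_left, poisson_mul_left, ht.poisson_inv_xi hξ hB hi hδ'.1.1,
      hanti]
    by_cases h : γ = δ
    · subst h
      rw [if_pos rfl, ht.poisson_E_E_self hξ hB hi hγ]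
      simp only [Algebra.smul_def, map_mul, map_inv₀]
      have hN' : algebraMap K (Fld K g) (structConst R γ (ξ i - γ)) ≠ 0 :=
        (_root_.map_ne_zero _).2 hN
      have h2' : algebraMap K (Fld K g) 2 ≠ 0 := (_root_.map_ne_zero _).2 two_ne_zero
      field_simp
      ring
    · rw [if_neg h, ht.poisson_E_E hξ hB hi hγ hδ h]
      simp only [Algebra.smul_def, map_mul, map_inv₀, mul_inv]
      ring
  rw [corrLin_apply, hsum, Finset.sum_congr rfl hterm, Finset.sum_add_distrib, ← Finset.smul_sum,
    ← Finset.smul_sum, ← Finset.mul_sum, ht.euler_linear hξ hB hi hlie, Finset.sum_ite_eq',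
    if_pos ((mem_gamFinset R B ξ).2 hδ), inv_mul_cancel_left₀ hZ, ← smul_add, ← two_smul K,
    smul_smul, inv_mul_cancel₀ two_ne_zero, one_smul]

theorem poisson_corrLin (ht : IsPoissonMap R B ξ i t) (hZ : t (R.E (ξ i)) ≠ 0)
    (hξ : IsKostantCascade R B ξ m) (hB : IsBase H B) (hi : i < m)
    (hx : x ∈ borelStage R B ξ (i + 1)) (hδ : δ ∈ Gam R B ξ i) :
    poisson (corrLin R B ξ i t x) (t (R.E δ)) = t ⁅x, R.E δ⁆ := by
  rcases eq_or_mem_Gam0 hδ with rfl | hδ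
  · rw [lie_E_xi_eq_zero hξ hB hi hx, map_zero]
    have hb := corrLin_mem (t := t) hξ hB hi hx
    generalize corrLin R B ξ i t x = b at hb ⊢
    induction hb using Submodule.span_induction with
    | zero => simp [poisson_swap 0]
    | add u v _ _ hu hv => rw [poisson_add_left, hu, hv, add_zero]
    | smul c u _ hu => rw [poisson_smul_left, hu, smul_zero]
    | mem u hu =>
      obtain ⟨α, hα, β, hβ, rfl⟩ := hu
      rw [poisson_mul_left, poisson_mul_left, ht.poisson_inv_xi hξ hB hi (hξ.mem i hi),
        ht.poisson_E_xi hξ hB hi hα.1.1, ht.poisson_E_xi hξ hB hi hβ.1.1]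
      simp
  · have := ht.poisson_corrLin_sub hZ hξ hB hi hx (hξ.sub_mem_Gam0 hB hi hδ)
    rwa [sub_sub_cancel] at this

/-- The corrected map commutes with the Heisenberg algebra. -/
theorem poisson_sub_corrLin (ht : IsPoissonMap R B ξ i t) (hZ : t (R.E (ξ i)) ≠ 0)
    (hξ : IsKostantCascade R B ξ m) (hB : IsBase H B) (hi : i < m)
    (hx : x ∈ borelStage R B ξ (i + 1)) (hδ : δ ∈ Gam R B ξ i) :
    poisson (t (R.E δ)) (t x - corrLin R B ξ i t x) = 0 := by
  rw [poisson_swap, poisson_sub_left, ht.poisson_corrLin hZ hξ hB hi hx hδ,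
    ht _ (borelStage_succ_le hx) _ (E_mem_borelStage hδ.1), sub_self, neg_zero]

theorem poisson_mem_corrSpan (ht : IsPoissonMap R B ξ i t)
    (hξ : IsKostantCascade R B ξ m) (hB : IsBase H B) (hi : i < m)
    (hy : y ∈ borelStage R B ξ (i + 1)) {b : Fld K g} (hb : b ∈ corrSpan R B ξ i t) :
    poisson (t y) b ∈ corrSpan R B ξ i t := by
  induction hb using Submodule.span_induction with
  | zero => simp
  | add u v _ _ hu hv => rw [map_add]; exact add_mem hu hv
  | smul c u _ hu => rw [Derivation.map_smul]; exact Submodule.smul_mem _ _ hu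
  | mem u hu =>
    obtain ⟨α, hα, β, hβ, rfl⟩ := hu
    have hyi := borelStage_succ_le hy
    have h1 : poisson (t y) (t (R.E α) * t (R.E β) * (t (R.E (ξ i)))⁻¹) =
        t ⁅y, R.E α⁆ * t (R.E β) * (t (R.E (ξ i)))⁻¹ +
          t (R.E α) * t ⁅y, R.E β⁆ * (t (R.E (ξ i)))⁻¹ := by
      rw [Derivation.leibniz, Derivation.leibniz,
        poisson_inv_eq_zero (ht.poisson_xi hξ hB hi hy), ht _ hyi _ (E_mem_borelStage hα.1.1),
        ht _ hyi _ (E_mem_borelStage hβ.1.1)]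
      simp only [smul_eq_mul]
      ring
    rw [h1]
    exact add_mem
      (mul_mul_mem_corrSpan (lie_E_Gam0_mem hξ hB hi hy hα) (Submodule.subset_span ⟨β, hβ, rfl⟩))
      (mul_mul_mem_corrSpan (Submodule.subset_span ⟨α, hα, rfl⟩) (lie_E_Gam0_mem hξ hB hi hy hβ))

/-- Equivariance follows from uniqueness: both sides are quadratic, and by Jacobi's identity they
have the same brackets with the Heisenberg generators. -/
theorem poisson_corrLin_right (ht : IsPoissonMap R B ξ i t) (hZ : t (R.E (ξ i)) ≠ 0)
    (hξ : IsKostantCascade R B ξ m) (hB : IsBase H B) (hi : i < m)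
    (hx : x ∈ borelStage R B ξ (i + 1)) (hy : y ∈ borelStage R B ξ (i + 1)) :
    poisson (t y) (corrLin R B ξ i t x) = corrLin R B ξ i t ⁅y, x⁆ := by
  have hyx := lie_mem_borelStage hξ hB hi hy hx
  have hyi := borelStage_succ_le hy
  have hxi := borelStage_succ_le hx
  rw [← sub_eq_zero]
  refine ht.eq_zero_of_poisson_eq_zero hZ hξ hB hi (sub_mem
    (ht.poisson_mem_corrSpan hξ hB hi hy (corrLin_mem hξ hB hi hx))
    (corrLin_mem hξ hB hi hyx)) fun γ hγ => ?_
  have h1 := poisson_poisson (t y) (corrLin R B ξ i t x) (t (R.E γ))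
  have hyγ := span_Gam0_le (lie_E_Gam0_mem hξ hB hi hy hγ)
  have hxγ := span_Gam0_le (lie_E_Gam0_mem hξ hB hi hx hγ)
  have hspan : poisson (corrLin R B ξ i t x) (t ⁅y, R.E γ⁆) = t ⁅x, ⁅y, R.E γ⁆⁆ := by
    have h := lie_E_Gam0_mem hξ hB hi hy hγ
    generalize ⁅y, R.E γ⁆ = z at h ⊢
    induction h using Submodule.span_induction with
    | zero => simp
    | add u v _ _ hu hv => rw [map_add, map_add, hu, hv, lie_add, map_add]
    | smul c u _ hu => rw [map_smul, Derivation.map_smul, hu, lie_smul, map_smul]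
    | mem u hu =>
      obtain ⟨β, hβ, rfl⟩ := hu
      exact ht.poisson_corrLin hZ hξ hB hi hx hβ.1
  rw [ht.poisson_corrLin hZ hξ hB hi hx hγ.1, ht _ hyi _ (E_mem_borelStage hγ.1.1), hspan,
    ht _ hyi _ hxγ, ← sub_eq_iff_eq_add] at h1
  rw [poisson_sub_left, ← h1, ht.poisson_corrLin hZ hξ hB hi hyx hγ.1, lie_lie, map_sub, sub_self]

/-- Corrections are built from the Heisenberg algebra, so they commute with corrected elements.
Hence {t x - b_x, t y - b_y} = {t x - b_x, t y}, and equivariance turns this into t[x, y] - b_{[x,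
y]}. -/
theorem succ (ht : IsPoissonMap R B ξ i t) (hZ : t (R.E (ξ i)) ≠ 0)
    (hξ : IsKostantCascade R B ξ m) (hB : IsBase H B) (hi : i < m) :
    IsPoissonMap R B ξ (i + 1) (t - corrLin R B ξ i t) := by
  intro x hx y hy
  have hcomm : ∀ b ∈ corrSpan R B ξ i t, poisson b (t x - corrLin R B ξ i t x) = 0 := by
    intro b hb
    induction hb using Submodule.span_induction with
    | zero => simp [poisson_swap 0]
    | add u v _ _ hu hv => rw [poisson_add_left, hu, hv, add_zero]
    | smul c u _ hu => rw [poisson_smul_left, hu, smul_zero]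
    | mem u hu =>
      obtain ⟨α, hα, β, hβ, rfl⟩ := hu
      have h3 := ht.poisson_sub_corrLin hZ hξ hB hi hx (hξ.xi_mem_Gam hi)
      rw [poisson_swap, neg_eq_zero] at h3
      rw [poisson_mul_left, poisson_mul_left, ht.poisson_sub_corrLin hZ hξ hB hi hx hα.1,
        ht.poisson_sub_corrLin hZ hξ hB hi hx hβ.1, poisson_swap (t (R.E (ξ i)))⁻¹,
        poisson_inv_eq_zero h3]
      simp
  rw [LinearMap.sub_apply, LinearMap.sub_apply, map_sub,
    poisson_swap _ (corrLin R B ξ i t y), hcomm _ (corrLin_mem hξ hB hi hy), neg_zero, sub_zero,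
    poisson_sub_left, poisson_swap (corrLin R B ξ i t x), ht.poisson_corrLin_right hZ hξ hB hi hx hy,
    ht _ (borelStage_succ_le hx) _ (borelStage_succ_le hy), LinearMap.sub_apply, ← lie_skew x y,
    map_neg, map_neg]

end IsPoissonMap

end Heisenberg

/-! ### The corrected copies of the Borel subalgebras -/

section Tilde

variable {K g : Type*} [Field K] [CharZero K] [LieRing g] [LieAlgebra K g]
  [FiniteDimensional K g] [HasCentralRadical K g]
  {H : LieSubalgebra K g} [H.IsCartanSubalgebra] [IsTriangularizable K H g]
  (R : RootVectors H) (B : Set (Module.Dual K H)) (ξ : ℕ → Module.Dual K H)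

/-- The linear version of `tilde`. -/
def tildeLin : ℕ → g →ₗ[K] Fld K g
  | 0 => emb
  | i + 1 => tildeLin i - corrLin R B ξ i (tildeLin i)

/-- The field generated by the `E γ` with `γ ∈ Gam j`, `j < i`. -/
def stageField (i : ℕ) : IntermediateField K (Fld K g) :=
  IntermediateField.adjoin K {q | ∃ j < i, ∃ γ ∈ Gam R B ξ j, q = emb (R.E γ)}

variable {R B ξ} {m i j : ℕ} {α β γ : Module.Dual K H} {x y : g}

theorem tildeLin_succ (i : ℕ) (x : g) : tildeLin R B ξ (i + 1) x =
    tildeLin R B ξ i x - corrLin R B ξ i (tildeLin R B ξ i) x := rfl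

theorem stageField_mono (hij : i ≤ j) : stageField R B ξ i ≤ stageField R B ξ j := by
  refine IntermediateField.adjoin.mono _ _ _ ?_
  rintro q ⟨k, hk, γ, hγ, rfl⟩
  exact ⟨k, hk.trans_le hij, γ, hγ, rfl⟩

/-- The constants of a derivation of a field, as a subfield. -/
def constantField {F : Type*} [Field F] [Algebra K F] (D : Derivation K F F) :
    IntermediateField K F where
  __ := constants D
  inv_mem' _ h := inv_mem_constants h

theorem eq_zero_of_mem_stageField {D : Derivation K (Fld K g) (Fld K g)}
    (hD : ∀ j < i, ∀ γ ∈ Gam R B ξ j, D (emb (R.E γ)) = 0) {a : Fld K g}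
    (ha : a ∈ stageField R B ξ i) : D a = 0 := by
  have : stageField R B ξ i ≤ constantField D := by
    refine IntermediateField.adjoin_le_iff.2 ?_
    rintro q ⟨k, hk, γ, hγ, rfl⟩
    exact hD k hk γ hγ
  exact this ha

/-- A linear form that is nonzero at `E (ξ i)` and zero on the other root vectors extends to a
derivation killing the stage field but not `E (ξ i)`. The purpose is to show that the cascade
elements do not vanish. -/
theorem emb_E_xi_notMem_stageField (hξ : IsKostantCascade R B ξ m) (hi : i < m) :
    emb (R.E (ξ i)) ∉ stageField R B ξ i := by
  intro hmem
  have hli := R.linearIndependent_E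
  have hx := hξ.mem_roots hi
  have hnot : R.E (ξ i) ∉ Submodule.span K ((fun α : roots H => R.E α) '' {α | α ≠ ⟨ξ i, hx⟩}) :=
    hli.notMem_span_image (x := ⟨ξ i, hx⟩) (by simp)
  obtain ⟨φ, hφ, hle⟩ := Submodule.exists_le_ker_of_notMem hnot
  have h := eq_zero_of_mem_stageField
    (D := derivOf ((Algebra.linearMap K (Fld K g)) ∘ₗ φ)) (i := i) (R := R) (B := B) (ξ := ξ) ?_ hmem
  · rw [derivOf_emb, LinearMap.comp_apply, Algebra.linearMap_apply, FaithfulSMul.algebraMap_eq_zero_iff] at h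
    exact hφ h
  · intro k hk γ hγ
    have h0 : φ (R.E γ) = 0 := by
      refine hle (Submodule.subset_span ⟨⟨γ, hγ.1.1.1⟩, ?_, rfl⟩)
      intro h
      have h' : γ = ξ i := congrArg Subtype.val h
      have := IsKostantCascade.Gam_disjoint hγ (h' ▸ hξ.xi_mem_Gam hi)
      omega
    rw [derivOf_emb, LinearMap.comp_apply, h0, map_zero]

theorem apply_corrLin_eq_zero {t : g →ₗ[K] Fld K g} {D : Derivation K (Fld K g) (Fld K g)}
    (hD : ∀ x ∈ borelStage R B ξ i, D (t x) = 0) (hξ : IsKostantCascade R B ξ m)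
    (hB : IsBase H B) (hi : i < m) (hx : x ∈ borelStage R B ξ (i + 1)) :
    D (corrLin R B ξ i t x) = 0 := by
  have hb := corrLin_mem (t := t) hξ hB hi hx
  have hle : corrSpan R B ξ i t ≤ (constants D).toSubmodule := by
    refine Submodule.span_le.2 ?_
    rintro _ ⟨α, hα, β, hβ, rfl⟩
    change _ ∈ constants D
    exact mul_mem (mul_mem (hD _ (E_mem_borelStage hα.1.1)) (hD _ (E_mem_borelStage hβ.1.1)))
      (inv_mem_constants (hD _ (E_mem_borelStage (hξ.mem i hi))))
  exact hle hb

/-- The three claims need one another. The accumulated corrections lie in the field generated by the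
earlier `E γ`, and that field commutes with the i-th copy; thus `x` and its copy have the same
bracket with any copy `t y`, and commuting with the copies of the `E γ` amounts to being killed by
the `D_γ`. -/
theorem tildeLin_spec (hξ : IsKostantCascade R B ξ m) (hB : IsBase H B) (hi : i ≤ m) :
    IsPoissonMap R B ξ i (tildeLin R B ξ i) ∧
    (∀ x ∈ borelStage R B ξ i, emb x - tildeLin R B ξ i x ∈ stageField R B ξ i) ∧
    (∀ j < i, ∀ γ ∈ Gam R B ξ j, ∀ y ∈ borelStage R B ξ i,
      lieDer K (R.E γ) (tildeLin R B ξ i y) = 0) := by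
  induction i with
  | zero =>
    refine ⟨fun x _ y _ => ?_, fun x _ => ?_, fun j hj => absurd hj (Nat.not_lt_zero j)⟩
    · rw [tildeLin, poisson_emb, lieDer_emb]
    · rw [tildeLin, sub_self]; exact zero_mem _
  | succ i ih =>
    obtain ⟨hp, hd, hc⟩ := ih (Nat.le_of_succ_le hi)
    have hi' : i < m := hi
    have hZ : tildeLin R B ξ i (R.E (ξ i)) ≠ 0 := by
      intro h0
      have := hd _ (E_mem_borelStage (hξ.mem i hi'))
      rw [h0, sub_zero] at this
      exact emb_E_xi_notMem_stageField hξ hi' this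
    have hfield : ∀ a ∈ stageField R B ξ i, ∀ y ∈ borelStage R B ξ i,
        poisson a (tildeLin R B ξ i y) = 0 := by
      intro a ha y hy
      rw [poisson_swap, neg_eq_zero]
      refine eq_zero_of_mem_stageField (fun j hj γ hγ => ?_) ha
      rw [poisson_apply_emb, hc j hj γ hγ y hy, neg_zero]
    refine ⟨hp.succ hZ hξ hB hi', fun x hx => ?_, fun j hj γ hγ y hy => ?_⟩
    · have hgam : ∀ γ ∈ Gam R B ξ i, tildeLin R B ξ i (R.E γ) ∈ stageField R B ξ (i + 1) := by
        intro γ hγ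
        have h1 := stageField_mono (Nat.le_succ i) (hd _ (E_mem_borelStage hγ.1))
        have h2 : emb (R.E γ) ∈ stageField R B ξ (i + 1) :=
          IntermediateField.subset_adjoin _ _ ⟨i, Nat.lt_succ_self i, γ, hγ, rfl⟩
        have := sub_mem h2 h1
        rwa [sub_sub_cancel] at this
      have hle : corrSpan R B ξ i (tildeLin R B ξ i) ≤
          (stageField R B ξ (i + 1)).toSubalgebra.toSubmodule := by
        refine Submodule.span_le.2 ?_
        rintro _ ⟨α, hα, β, hβ, rfl⟩
        change _ ∈ stageField R B ξ (i + 1)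
        exact mul_mem (mul_mem (hgam _ hα.1) (hgam _ hβ.1)) (inv_mem (hgam _ (hξ.xi_mem_Gam hi')))
      have h1 := hle (corrLin_mem hξ hB hi' hx)
      have h2 := stageField_mono (Nat.le_succ i) (hd _ (borelStage_succ_le hx))
      have := add_mem h2 h1
      rw [tildeLin_succ, ← sub_add]
      exact this
    · rw [tildeLin_succ]
      rcases Nat.lt_succ_iff_lt_or_eq.1 hj with hj | rfl
      · rw [map_sub, hc j hj γ hγ _ (borelStage_succ_le hy),
          apply_corrLin_eq_zero (fun x hx => hc j hj γ hγ x hx) hξ hB hi' hy, sub_zero]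
      -- For the stage just completed, `E γ` differs from its copy by an element of the stage field,
      -- which commutes with the new copy of `y`; the copy of `E γ` commutes with it by
      -- construction.
      · have ha := hd _ (E_mem_borelStage hγ.1)
        have h1 : poisson (emb (R.E γ) - tildeLin R B ξ j (R.E γ))
            (tildeLin R B ξ j y - corrLin R B ξ j (tildeLin R B ξ j) y) = 0 := by
          rw [map_sub, hfield _ ha _ (borelStage_succ_le hy),
            apply_corrLin_eq_zero (fun x hx => hfield _ ha x hx) hξ hB hi' hy, sub_zero]
        rw [poisson_sub_left, hp.poisson_sub_corrLin hZ hξ hB hi' hy hγ, sub_zero,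
          poisson_emb] at h1
        exact h1

theorem tildeLin_xi_ne_zero (hξ : IsKostantCascade R B ξ m) (hB : IsBase H B) (hi : i < m) :
    tildeLin R B ξ i (R.E (ξ i)) ≠ 0 := by
  intro h0
  have := (tildeLin_spec hξ hB hi.le).2.1 _ (E_mem_borelStage (hξ.mem i hi))
  rw [h0, sub_zero] at this
  exact emb_E_xi_notMem_stageField hξ hi this

theorem lieDer_tildeLin_eq_zero (hξ : IsKostantCascade R B ξ m) (hB : IsBase H B) (hi : i ≤ m)
    (hj : j < i) (hγ : γ ∈ Gam R B ξ j) (hy : y ∈ borelStage R B ξ i) :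
    lieDer K (R.E γ) (tildeLin R B ξ i y) = 0 :=
  (tildeLin_spec hξ hB hi).2.2 j hj γ hγ y hy

theorem lieDer_tildeLin (hξ : IsKostantCascade R B ξ m) (hB : IsBase H B) (hi : i ≤ m)
    (hx : x ∈ borelStage R B ξ i) (hy : y ∈ borelStage R B ξ i) :
    lieDer K x (tildeLin R B ξ i y) = tildeLin R B ξ i ⁅x, y⁆ := by
  obtain ⟨hp, hd, hc⟩ := tildeLin_spec hξ hB hi
  have h1 : poisson (emb x - tildeLin R B ξ i x) (tildeLin R B ξ i y) = 0 := by
    rw [poisson_swap, neg_eq_zero]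
    refine eq_zero_of_mem_stageField (fun j hj γ hγ => ?_) (hd x hx)
    rw [poisson_apply_emb, hc j hj γ hγ y hy, neg_zero]
  rw [poisson_sub_left, hp x hx y hy, sub_eq_zero, poisson_emb] at h1
  exact h1

/-- On the Borel subalgebra of the stage, `corrLin` shows that the condition defining `corr` can be
met, and uniqueness identifies the chosen element with the explicit one. -/
theorem tilde_eq_tildeLin (hξ : IsKostantCascade R B ξ m) (hB : IsBase H B) (hi : i ≤ m)
    (hx : x ∈ borelStage R B ξ i) : tilde R B ξ i x = tildeLin R B ξ i x := by
  induction i generalizing x with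
  | zero => rfl
  | succ i ih =>
    have hi' : i < m := hi
    have ih' : ∀ y ∈ borelStage R B ξ i, tilde R B ξ i y = tildeLin R B ξ i y :=
      fun y hy => ih hi'.le hy
    have hp := (tildeLin_spec hξ hB hi'.le).1
    have hZ := tildeLin_xi_ne_zero hξ hB hi'
    have hE : ∀ γ ∈ Gam R B ξ i, tilde R B ξ i (R.E γ) = tildeLin R B ξ i (R.E γ) :=
      fun γ hγ => ih' _ (E_mem_borelStage hγ.1)
    have hset : {q | ∃ α ∈ Gam0 R B ξ i, ∃ β ∈ Gam0 R B ξ i,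
        q = tilde R B ξ i (R.E α) * tilde R B ξ i (R.E β) * (tilde R B ξ i (R.E (ξ i)))⁻¹} =
        {q | ∃ α ∈ Gam0 R B ξ i, ∃ β ∈ Gam0 R B ξ i, q = tildeLin R B ξ i (R.E α) *
          tildeLin R B ξ i (R.E β) * (tildeLin R B ξ i (R.E (ξ i)))⁻¹} := by
      ext q
      refine exists_congr fun α => and_congr_right fun hα => exists_congr fun β =>
        and_congr_right fun hβ => ?_
      rw [hE α hα.1, hE β hβ.1, hE _ (hξ.xi_mem_Gam hi')]
    have hspec := Classical.epsilon_spec (p := fun b =>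
      b ∈ Submodule.span K {q | ∃ α ∈ Gam0 R B ξ i, ∃ β ∈ Gam0 R B ξ i,
        q = tilde R B ξ i (R.E α) * tilde R B ξ i (R.E β) * (tilde R B ξ i (R.E (ξ i)))⁻¹} ∧
      ∀ α ∈ Gam R B ξ i, poisson b (tilde R B ξ i (R.E α)) =
        poisson (tilde R B ξ i x) (tilde R B ξ i (R.E α)))
      ⟨corrLin R B ξ i (tildeLin R B ξ i) x, by
        rw [hset]; exact corrLin_mem hξ hB hi' hx, fun α hα => by
        rw [hE α hα, hp.poisson_corrLin hZ hξ hB hi' hx hα, ih' x (borelStage_succ_le hx),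
          hp _ (borelStage_succ_le hx) _ (E_mem_borelStage hα.1)]⟩
    change corr R B ξ i (tilde R B ξ i) x ∈ _ ∧ ∀ α ∈ Gam R B ξ i,
      poisson (corr R B ξ i (tilde R B ξ i) x) _ = _ at hspec
    have hcorr : corr R B ξ i (tilde R B ξ i) x = corrLin R B ξ i (tildeLin R B ξ i) x := by
      rw [← sub_eq_zero]
      refine hp.eq_zero_of_poisson_eq_zero hZ hξ hB hi'
        (sub_mem (by rw [hset] at hspec; exact hspec.1) (corrLin_mem hξ hB hi' hx))
        fun γ hγ => ?_
      have h1 := hspec.2 γ hγ.1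
      rw [hE γ hγ.1, ih' x (borelStage_succ_le hx),
        hp _ (borelStage_succ_le hx) _ (E_mem_borelStage hγ.1.1)] at h1
      rw [poisson_sub_left, h1, hp.poisson_corrLin hZ hξ hB hi' hx hγ.1, sub_self]
    change tilde R B ξ i x - corr R B ξ i (tilde R B ξ i) x = _
    rw [hcorr, ih' x (borelStage_succ_le hx), tildeLin_succ]

theorem cascadeElt_eq (hξ : IsKostantCascade R B ξ m) (hB : IsBase H B) (hi : i < m) :
    cascadeElt R B ξ i = tildeLin R B ξ i (R.E (ξ i)) :=
  tilde_eq_tildeLin hξ hB hi.le (E_mem_borelStage (hξ.mem i hi))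

/-- If `α` belongs to an earlier `Gam j`, `D_α` kills the whole i-th copy; otherwise `α` lies in
stage i, where `E α` commutes with `E (ξ i)` by maximality. Inverting these invariants is what keeps
the localization stable under u with locally nilpotent action. -/
theorem lieDer_E_cascadeElt (hξ : IsKostantCascade R B ξ m) (hB : IsBase H B) (hi : i < m)
    (hα : α ∈ posRoots H B) : lieDer K (R.E α) (cascadeElt R B ξ i) = 0 := by
  rw [cascadeElt_eq hξ hB hi]
  obtain ⟨j, hj, hαj⟩ := hξ.exists_mem_Gam hB hα
  rcases lt_or_ge j i with h | h
  · exact lieDer_tildeLin_eq_zero hξ hB hi.le h hαj (E_mem_borelStage (hξ.mem i hi))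
  · have hαi := IsKostantCascade.stagePos_anti h hαj.1
    rw [lieDer_tildeLin hξ hB hi.le (E_mem_borelStage hαi) (E_mem_borelStage (hξ.mem i hi)),
      ← lie_skew, hξ.lie_E_xi hB hi hαi, neg_zero, map_zero]

theorem lieDer_eq_zero_of_mem_span {s : Set (Module.Dual K H)} {a : Fld K g}
    (h : ∀ γ ∈ s, lieDer K (R.E γ) a = 0) (hx : x ∈ Submodule.span K (R.E '' s)) :
    lieDer K x a = 0 := by
  induction hx using Submodule.span_induction with
  | zero =>
    have : lieDer K (0 : g) = 0 := by
      rw [← zero_smul K (0 : g), lieDer_smul, zero_smul]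
    rw [this, Derivation.zero_apply]
  | add u v _ _ hu hv => rw [lieDer_add, Derivation.add_apply, hu, hv, add_zero]
  | smul c u _ hu => rw [lieDer_smul, Derivation.smul_apply, hu, smul_zero]
  | mem u hu =>
    obtain ⟨γ, hγ, rfl⟩ := hu
    exact h γ hγ

theorem lieDer_cascadeElt (hξ : IsKostantCascade R B ξ m) (hB : IsBase H B) (hi : i < m)
    (hx : x ∈ nilradical R B) : lieDer K x (cascadeElt R B ξ i) = 0 :=
  lieDer_eq_zero_of_mem_span (fun _ hγ => lieDer_E_cascadeElt hξ hB hi hγ) hx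

/-! ### The localized algebra -/

theorem emb_mem_locAlg (x : g) : emb x ∈ locAlg R B ξ m :=
  Algebra.subset_adjoin (Or.inl ⟨SymmetricAlgebra.ι K g x, rfl⟩)

theorem inv_cascadeElt_mem_locAlg (hi : i < m) : (cascadeElt R B ξ i)⁻¹ ∈ locAlg R B ξ m :=
  Algebra.subset_adjoin (Or.inr ⟨i, hi, rfl⟩)

theorem locAlg_le {A : Subalgebra K (Fld K g)} (h : ∀ x : g, emb x ∈ A)
    (h' : ∀ i < m, (cascadeElt R B ξ i)⁻¹ ∈ A) : locAlg R B ξ m ≤ A := by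
  refine Algebra.adjoin_le ?_
  rintro _ (⟨a, rfl⟩ | ⟨i, hi, rfl⟩)
  · exact algebraMap_mem_of_emb_mem h a
  · exact h' i hi

theorem corrLin_tildeLin_mem_locAlg_of (hξ : IsKostantCascade R B ξ m) (hB : IsBase H B)
    (hi : i < m) (h : ∀ x ∈ borelStage R B ξ i, tildeLin R B ξ i x ∈ locAlg R B ξ m) :
    corrSpan R B ξ i (tildeLin R B ξ i) ≤ (locAlg R B ξ m).toSubmodule := by
  refine Submodule.span_le.2 ?_
  rintro _ ⟨α, hα, β, hβ, rfl⟩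
  rw [← cascadeElt_eq hξ hB hi]
  change _ ∈ locAlg R B ξ m
  exact mul_mem (mul_mem (h _ (E_mem_borelStage hα.1.1)) (h _ (E_mem_borelStage hβ.1.1)))
    (inv_cascadeElt_mem_locAlg hi)

theorem tildeLin_mem_locAlg (hξ : IsKostantCascade R B ξ m) (hB : IsBase H B) (hi : i ≤ m)
    (hx : x ∈ borelStage R B ξ i) : tildeLin R B ξ i x ∈ locAlg R B ξ m := by
  induction i generalizing x with
  | zero => exact emb_mem_locAlg x
  | succ i ih =>
    rw [tildeLin_succ]
    exact sub_mem (ih (Nat.le_of_succ_le hi) (borelStage_succ_le hx))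
      (corrLin_tildeLin_mem_locAlg_of hξ hB hi (fun x hx => ih (Nat.le_of_succ_le hi) hx)
        (corrLin_mem hξ hB hi hx))

theorem cascadeElt_mem_locAlg (hξ : IsKostantCascade R B ξ m) (hB : IsBase H B) (hi : i < m) :
    cascadeElt R B ξ i ∈ locAlg R B ξ m := by
  rw [cascadeElt_eq hξ hB hi]
  exact tildeLin_mem_locAlg hξ hB hi.le (E_mem_borelStage (hξ.mem i hi))

theorem locAlg_le_nilElements (hξ : IsKostantCascade R B ξ m) (hB : IsBase H B)
    (hx : x ∈ nilradical R B) : locAlg R B ξ m ≤ nilElements (lieDer K x) := by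
  refine locAlg_le (fun y => ?_) fun i hi => ?_
  · obtain ⟨n, hn⟩ := isNilpotent_ad hB hx
    exact ⟨n, by rw [iterate_lieDer_emb, hn]; simp⟩
  · exact constants_le_nilElements _ (inv_mem_constants (lieDer_cascadeElt hξ hB hi hx))

theorem lieDer_mem_locAlg (hξ : IsKostantCascade R B ξ m) (hB : IsBase H B)
    (hx : x ∈ nilradical R B) {a : Fld K g} (ha : a ∈ locAlg R B ξ m) :
    lieDer K x a ∈ locAlg R B ξ m := by
  let A : Subalgebra K (Fld K g) :=
    { carrier := {a | a ∈ locAlg R B ξ m ∧ lieDer K x a ∈ locAlg R B ξ m}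
      mul_mem' := fun {a b} ha hb => ⟨mul_mem ha.1 hb.1, by
        rw [Derivation.leibniz]
        exact add_mem (mul_mem ha.1 hb.2) (mul_mem hb.1 ha.2)⟩
      add_mem' := fun {a b} ha hb => ⟨add_mem ha.1 hb.1, by
        rw [map_add]
        exact add_mem ha.2 hb.2⟩
      algebraMap_mem' := fun r => ⟨Subalgebra.algebraMap_mem _ r, by simp⟩ }
  have : locAlg R B ξ m ≤ A := by
    refine locAlg_le (fun y => ⟨emb_mem_locAlg y, ?_⟩)
      fun i hi => ⟨inv_cascadeElt_mem_locAlg hi, ?_⟩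
    · rw [lieDer_emb]; exact emb_mem_locAlg _
    · rw [Derivation.leibniz_inv, lieDer_cascadeElt hξ hB hi hx, smul_zero]; exact zero_mem _
  exact (this ha).2

end Tilde

/-! ### The tower of slices attached to a Kostant cascade -/

section CascadeTower

variable {K g : Type*} [Field K] [CharZero K] [LieRing g] [LieAlgebra K g]
  [FiniteDimensional K g] [HasCentralRadical K g]
  {H : LieSubalgebra K g} [H.IsCartanSubalgebra] [IsTriangularizable K H g]
  (R : RootVectors H) (B : Set (Module.Dual K H)) (ξ : ℕ → Module.Dual K H)

/-- The derivation `D_{ξ i}` with its slice `Q_{ξ i}`. -/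
def topPair (i : ℕ) : Derivation K (Fld K g) (Fld K g) × Fld K g :=
  (lieDer K (R.E (ξ i)),
    -((1 / 2 : K) • (tilde R B ξ i (R.coroot (ξ i)) * (cascadeElt R B ξ i)⁻¹)))

/-- The derivation `D_α` with its slice `Q_α`, for `α ∈ Γ_i⁰`. -/
def rootPair (i : ℕ) (α : Module.Dual K H) : Derivation K (Fld K g) (Fld K g) × Fld K g :=
  (lieDer K (R.E α), (structConst R α (ξ i - α))⁻¹ •
    (tilde R B ξ i (R.E (ξ i - α)) * (cascadeElt R B ξ i)⁻¹))

/-- The slices of the first stages, in the order in which the projections are applied. -/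
def cascadeList (ord : ℕ → List (Module.Dual K H)) :
    ℕ → List (Derivation K (Fld K g) (Fld K g) × Fld K g)
  | 0 => []
  | i + 1 => cascadeList ord i ++ topPair R B ξ i :: (ord i).reverse.map (rootPair R B ξ i)

variable {R B ξ} {m i j : ℕ} {α β γ : Module.Dual K H} {x y : g}
  {ord : ℕ → List (Module.Dual K H)}

theorem proj_eq_towerProj (i : ℕ) (a : Fld K g) :
    proj R B ξ ord i a = towerProj (cascadeList R B ξ ord i) a := by
  induction i with
  | zero => rfl
  | succ i ih =>
    change (ord i).foldr (projRoot R B ξ i) (projTop R B ξ i (proj R B ξ ord i a)) = _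
    rw [ih, cascadeList, towerProj_append, towerProj_cons]
    generalize towerProj (cascadeList R B ξ ord i) a = b
    -- `foldr` applies the last factor of the list first, which accounts for the `reverse` in
    -- `cascadeList`.
    rw [towerProj, List.foldl_map, List.foldl_reverse]
    rfl

theorem mem_cascadeList {p : Derivation K (Fld K g) (Fld K g) × Fld K g} :
    p ∈ cascadeList R B ξ ord i ↔
      ∃ j < i, p = topPair R B ξ j ∨ ∃ α ∈ ord j, p = rootPair R B ξ j α := by
  induction i with
  | zero => simp [cascadeList]
  | succ i ih =>
    rw [cascadeList, List.mem_append, ih, List.mem_cons, List.mem_map]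
    constructor
    · rintro (⟨j, hj, h⟩ | h | ⟨α, hα, rfl⟩)
      · exact ⟨j, hj.trans (Nat.lt_succ_self i), h⟩
      · exact ⟨i, Nat.lt_succ_self i, Or.inl h⟩
      · exact ⟨i, Nat.lt_succ_self i, Or.inr ⟨α, List.mem_reverse.1 hα, rfl⟩⟩
    · rintro ⟨j, hj, h⟩
      rcases Nat.lt_succ_iff_lt_or_eq.1 hj with hj | rfl
      · exact Or.inl ⟨j, hj, h⟩
      · rcases h with h | ⟨α, hα, rfl⟩
        · exact Or.inr (Or.inl h)
        · exact Or.inr (Or.inr ⟨α, List.mem_reverse.2 hα, rfl⟩)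

theorem forall_mem_cascadeList_iff (hξ : IsKostantCascade R B ξ m)
    (hord : ∀ i < m, (ord i).Nodup ∧ ∀ α, α ∈ ord i ↔ α ∈ Gam0 R B ξ i) (hi : i ≤ m)
    {a : Fld K g} : (∀ p ∈ cascadeList R B ξ ord i, a ∈ constants p.1) ↔
      ∀ j < i, ∀ γ ∈ Gam R B ξ j, lieDer K (R.E γ) a = 0 := by
  constructor
  · intro h j hj γ hγ
    rcases eq_or_mem_Gam0 hγ with rfl | hγ
    · exact h _ (mem_cascadeList.2 ⟨j, hj, Or.inl rfl⟩)
    · exact h _ (mem_cascadeList.2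
        ⟨j, hj, Or.inr ⟨γ, ((hord j (hj.trans_le hi)).2 γ).2 hγ, rfl⟩⟩)
  · intro h p hp
    obtain ⟨j, hj, rfl | ⟨α, hα, rfl⟩⟩ := mem_cascadeList.1 hp
    · exact h j hj _ (hξ.xi_mem_Gam (hj.trans_le hi))
    · exact h j hj _ (((hord j (hj.trans_le hi)).2 α).1 hα).1

theorem forall_mem_posRoots_iff (hξ : IsKostantCascade R B ξ m) (hB : IsBase H B) {a : Fld K g} :
    (∀ j < m, ∀ γ ∈ Gam R B ξ j, lieDer K (R.E γ) a = 0) ↔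
      ∀ x ∈ nilradical R B, lieDer K x a = 0 := by
  constructor
  · intro h x hx
    refine lieDer_eq_zero_of_mem_span (fun γ hγ => ?_) hx
    obtain ⟨j, hj, hγj⟩ := hξ.exists_mem_Gam hB hγ
    exact h j hj γ hγj
  · exact fun h j _ γ hγ => h _ (Submodule.subset_span ⟨γ, hγ.1.1, rfl⟩)

theorem E_mem_nilradical (hα : α ∈ posRoots H B) : R.E α ∈ nilradical R B :=
  Submodule.subset_span ⟨α, hα, rfl⟩

theorem lieDer_mul_inv_cascadeElt (hξ : IsKostantCascade R B ξ m) (hB : IsBase H B) (hi : i < m)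
    (hx : x ∈ nilradical R B) (a : Fld K g) :
    lieDer K x (a * (cascadeElt R B ξ i)⁻¹) = lieDer K x a * (cascadeElt R B ξ i)⁻¹ := by
  rw [Derivation.leibniz, Derivation.leibniz_inv, lieDer_cascadeElt hξ hB hi hx]
  simp [mul_comm]

theorem cascadeElt_ne_zero (hξ : IsKostantCascade R B ξ m) (hB : IsBase H B) (hi : i < m) :
    cascadeElt R B ξ i ≠ 0 := by
  rw [cascadeElt_eq hξ hB hi]
  exact tildeLin_xi_ne_zero hξ hB hi

theorem rootPair_snd (hξ : IsKostantCascade R B ξ m) (hB : IsBase H B) (hi : i < m)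
    (hα : α ∈ Gam0 R B ξ i) : (rootPair R B ξ i α).2 = (structConst R α (ξ i - α))⁻¹ •
      (tildeLin R B ξ i (R.E (ξ i - α)) * (cascadeElt R B ξ i)⁻¹) := by
  rw [rootPair, tilde_eq_tildeLin hξ hB hi.le (E_mem_borelStage (hξ.sub_mem_Gam0 hB hi hα).1.1)]

theorem topPair_snd (hξ : IsKostantCascade R B ξ m) (hB : IsBase H B) (hi : i < m) :
    (topPair R B ξ i).2 =
      -((1 / 2 : K) • (tildeLin R B ξ i (R.coroot (ξ i)) * (cascadeElt R B ξ i)⁻¹)) := by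
  rw [topPair, tilde_eq_tildeLin hξ hB hi.le (coroot_mem_borelStage hξ hB hi)]

theorem rootPair_snd_mem_locAlg (hξ : IsKostantCascade R B ξ m) (hB : IsBase H B) (hi : i < m)
    (hα : α ∈ Gam0 R B ξ i) : (rootPair R B ξ i α).2 ∈ locAlg R B ξ m := by
  rw [rootPair_snd hξ hB hi hα]
  exact Subalgebra.smul_mem _ (mul_mem (tildeLin_mem_locAlg hξ hB hi.le
    (E_mem_borelStage (hξ.sub_mem_Gam0 hB hi hα).1.1)) (inv_cascadeElt_mem_locAlg hi)) _

theorem topPair_snd_mem_locAlg (hξ : IsKostantCascade R B ξ m) (hB : IsBase H B) (hi : i < m) :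
    (topPair R B ξ i).2 ∈ locAlg R B ξ m := by
  rw [topPair_snd hξ hB hi]
  exact neg_mem (Subalgebra.smul_mem _ (mul_mem (tildeLin_mem_locAlg hξ hB hi.le
    (coroot_mem_borelStage hξ hB hi)) (inv_cascadeElt_mem_locAlg hi)) _)

theorem lieDer_rootPair_snd (hξ : IsKostantCascade R B ξ m) (hB : IsBase H B) (hi : i < m)
    (hα : α ∈ Gam0 R B ξ i) (hβ : β ∈ stagePos R B ξ i) :
    lieDer K (R.E β) (rootPair R B ξ i α).2 = (structConst R α (ξ i - α))⁻¹ •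
      (tildeLin R B ξ i ⁅R.E β, R.E (ξ i - α)⁆ * (cascadeElt R B ξ i)⁻¹) := by
  rw [rootPair_snd hξ hB hi hα, Derivation.map_smul,
    lieDer_mul_inv_cascadeElt hξ hB hi (E_mem_nilradical hβ.1), lieDer_tildeLin hξ hB hi.le
      (E_mem_borelStage hβ) (E_mem_borelStage (hξ.sub_mem_Gam0 hB hi hα).1.1)]

theorem lieDer_rootPair_snd_self (hξ : IsKostantCascade R B ξ m) (hB : IsBase H B) (hi : i < m)
    (hα : α ∈ Gam0 R B ξ i) : lieDer K (R.E α) (rootPair R B ξ i α).2 = 1 := by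
  rw [lieDer_rootPair_snd hξ hB hi hα hα.1.1, hξ.lie_Gam0_sub hB hi hα, map_smul, smul_mul_assoc,
    ← cascadeElt_eq hξ hB hi, mul_inv_cancel₀ (cascadeElt_ne_zero hξ hB hi),
    inv_smul_smul₀ (hξ.structConst_ne_zero hB hi hα)]

theorem lieDer_rootPair_snd_of_ne (hξ : IsKostantCascade R B ξ m) (hB : IsBase H B) (hi : i < m)
    (hα : α ∈ Gam0 R B ξ i) (hβ : β ∈ Gam R B ξ i) (h : β ≠ α) :
    lieDer K (R.E β) (rootPair R B ξ i α).2 = 0 := by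
  have h0 : ⁅R.E β, R.E (ξ i - α)⁆ = 0 := by
    have hα' := hξ.sub_mem_Gam0 hB hi hα
    rcases eq_or_mem_Gam0 hβ with rfl | hβ
    · exact hξ.lie_E_xi hB hi hα'.1.1
    · refine hξ.lie_Gam0_eq_zero hB hi hβ hα' fun h' => h ?_
      rw [add_sub_left_comm, add_eq_left, sub_eq_zero] at h'
      exact h'
  rw [lieDer_rootPair_snd hξ hB hi hα hβ.1, h0, map_zero, zero_mul, smul_zero]

theorem lieDer_topPair_snd (hξ : IsKostantCascade R B ξ m) (hB : IsBase H B) (hi : i < m) :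
    lieDer K (R.E (ξ i)) (topPair R B ξ i).2 = 1 := by
  have h1 : ⁅R.E (ξ i), (R.coroot (ξ i) : g)⁆ = (-2 : K) • R.E (ξ i) := by
    rw [← lie_skew, R.lie_cartan_E (hξ.mem_roots hi), R.apply_coroot_self (hξ.mem_roots hi),
      neg_smul]
  have hxi := hξ.mem i hi
  rw [topPair_snd hξ hB hi, map_neg, Derivation.map_smul,
    lieDer_mul_inv_cascadeElt hξ hB hi (E_mem_nilradical hxi.1), lieDer_tildeLin hξ hB hi.le
      (E_mem_borelStage hxi) (coroot_mem_borelStage hξ hB hi), h1, map_smul, smul_mul_assoc,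
    ← cascadeElt_eq hξ hB hi, mul_inv_cancel₀ (cascadeElt_ne_zero hξ hB hi), smul_smul,
    ← neg_smul]
  norm_num

/-- `E β` normalizes the span of each earlier Heisenberg algebra, so `D_β` preserves their common
constants. -/
theorem lieDer_of_mem_Gam_of_stagePos (hξ : IsKostantCascade R B ξ m) (hB : IsBase H B)
    (hi : i ≤ m) (hβ : β ∈ stagePos R B ξ i) {a : Fld K g}
    (ha : ∀ j < i, ∀ γ ∈ Gam R B ξ j, lieDer K (R.E γ) a = 0) :
    ∀ j < i, ∀ γ ∈ Gam R B ξ j, lieDer K (R.E γ) (lieDer K (R.E β) a) = 0 := by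
  intro j hj γ hγ
  have hβj : R.E β ∈ borelStage R B ξ (j + 1) :=
    E_mem_borelStage (IsKostantCascade.stagePos_anti hj hβ)
  have hz : lieDer K ⁅R.E β, R.E γ⁆ a = 0 := by
    refine lieDer_eq_zero_of_mem_span (s := Gam R B ξ j) (ha j hj) ?_
    rcases eq_or_mem_Gam0 hγ with rfl | hγ0
    · rw [lie_E_xi_eq_zero hξ hB (hj.trans_le hi) hβj]; exact zero_mem _
    · exact Submodule.span_mono (Set.image_mono fun _ h => h.1)
        (lie_E_Gam0_mem hξ hB (hj.trans_le hi) hβj hγ0)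
  rw [lieDer_lie, ha j hj γ hγ, map_zero, zero_sub, neg_eq_zero] at hz
  exact hz

theorem lieDer_rootPair_snd_of_lt (hξ : IsKostantCascade R B ξ m) (hB : IsBase H B) (hi : i < m)
    (hα : α ∈ Gam0 R B ξ i) (hj : j < i) (hγ : γ ∈ Gam R B ξ j) :
    lieDer K (R.E γ) (rootPair R B ξ i α).2 = 0 := by
  rw [rootPair_snd hξ hB hi hα, Derivation.map_smul,
    lieDer_mul_inv_cascadeElt hξ hB hi (E_mem_nilradical hγ.1.1),
    lieDer_tildeLin_eq_zero hξ hB hi.le hj hγ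
      (E_mem_borelStage (hξ.sub_mem_Gam0 hB hi hα).1.1), zero_mul, smul_zero]

theorem lieDer_topPair_snd_of_lt (hξ : IsKostantCascade R B ξ m) (hB : IsBase H B) (hi : i < m)
    (hj : j < i) (hγ : γ ∈ Gam R B ξ j) : lieDer K (R.E γ) (topPair R B ξ i).2 = 0 := by
  rw [topPair_snd hξ hB hi, map_neg, Derivation.map_smul,
    lieDer_mul_inv_cascadeElt hξ hB hi (E_mem_nilradical hγ.1.1),
    lieDer_tildeLin_eq_zero hξ hB hi.le hj hγ (coroot_mem_borelStage hξ hB hi), zero_mul,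
    smul_zero, neg_zero]

/-- Modulo its centre the Heisenberg algebra is commutative, so its derivations commute on the
constants of the one attached to `ξ i`. Hence `S_{ξ i}` acts first and the remaining factors may be
taken in any order. -/
theorem lieDer_comm_of_mem_Gam0 (hξ : IsKostantCascade R B ξ m) (hB : IsBase H B) (hi : i < m)
    (hα : α ∈ Gam R B ξ i) (hβ : β ∈ Gam R B ξ i) {a : Fld K g}
    (ha : lieDer K (R.E (ξ i)) a = 0) (hβa : lieDer K (R.E β) a = 0) :
    lieDer K (R.E β) (lieDer K (R.E α) a) = 0 := by
  have hz : lieDer K ⁅R.E β, R.E α⁆ a = 0 := by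
    refine lieDer_eq_zero_of_mem_span (s := {ξ i}) (by rintro _ rfl; exact ha) ?_
    rcases eq_or_mem_Gam0 hβ with rfl | hβ0
    · rw [hξ.lie_E_xi hB hi hα.1]; exact zero_mem _
    rcases eq_or_mem_Gam0 hα with rfl | hα0
    · rw [← lie_skew, hξ.lie_E_xi hB hi hβ.1, neg_zero]; exact zero_mem _
    by_cases h : β + α = ξ i
    · obtain rfl : α = ξ i - β := by rw [← h, add_sub_cancel_left]
      rw [hξ.lie_Gam0_sub hB hi hβ0]
      exact Submodule.smul_mem _ _ (Submodule.subset_span ⟨_, rfl, rfl⟩)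
    · rw [hξ.lie_Gam0_eq_zero hB hi hβ0 hα0 h]; exact zero_mem _
  rw [lieDer_lie, hβa, map_zero, sub_zero] at hz
  exact hz

/-- The set `s` holds the roots already treated; keeping it arbitrary is what lets the induction on
the list run. -/
theorem isSliceTower_rootPairs (hξ : IsKostantCascade R B ξ m) (hB : IsBase H B) (hi : i < m)
    {W : Subalgebra K (Fld K g)} {s : Set (Module.Dual K H)} (hs : s ⊆ Gam0 R B ξ i)
    (hW : ∀ a, a ∈ W ↔ (a ∈ locAlg R B ξ m ∧
      ∀ j < i, ∀ γ ∈ Gam R B ξ j, lieDer K (R.E γ) a = 0) ∧ lieDer K (R.E (ξ i)) a = 0 ∧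
      ∀ γ ∈ s, lieDer K (R.E γ) a = 0) {l : List (Module.Dual K H)} (hl : l.Nodup)
    (hl' : ∀ α ∈ l, α ∈ Gam0 R B ξ i ∧ α ∉ s) :
    IsSliceTower W (l.map (rootPair R B ξ i)) := by
  induction l generalizing W s with
  | nil => trivial
  | cons α l ih =>
    obtain ⟨hα, hαs⟩ := hl' α List.mem_cons_self
    have hαn := E_mem_nilradical hα.1.1.1 (R := R)
    refine ⟨fun a ha => ?_, fun a ha => ?_, ?_, lieDer_rootPair_snd_self hξ hB hi hα, ?_⟩
    · rw [hW] at ha ⊢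
      obtain ⟨⟨ha1, ha2⟩, ha3, ha4⟩ := ha
      exact ⟨⟨lieDer_mem_locAlg hξ hB hαn ha1,
        lieDer_of_mem_Gam_of_stagePos hξ hB hi.le hα.1.1 ha2⟩,
        lieDer_comm_of_mem_Gam0 hξ hB hi hα.1 (hξ.xi_mem_Gam hi) ha3 ha3,
        fun γ hγ => lieDer_comm_of_mem_Gam0 hξ hB hi hα.1 (hs hγ).1 ha3 (ha4 γ hγ)⟩
    · exact locAlg_le_nilElements hξ hB hαn ((hW a).1 ha).1.1
    · rw [hW]
      refine ⟨⟨rootPair_snd_mem_locAlg hξ hB hi hα, fun j hj γ hγ =>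
        lieDer_rootPair_snd_of_lt hξ hB hi hα hj hγ⟩,
        lieDer_rootPair_snd_of_ne hξ hB hi hα (hξ.xi_mem_Gam hi) fun h => hα.2 h.symm,
        fun γ hγ => lieDer_rootPair_snd_of_ne hξ hB hi hα (hs hγ).1 ?_⟩
      rintro rfl
      exact hαs hγ
    · refine ih (s := insert α s) (Set.insert_subset hα hs) (fun a => ?_) (List.nodup_cons.1 hl).2
        fun β hβ => ⟨(hl' β (List.mem_cons_of_mem _ hβ)).1, ?_⟩
      · rw [Algebra.mem_inf, hW, mem_constants, Set.forall_mem_insert]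
        simp only [rootPair]
        tauto
      · rw [Set.mem_insert_iff, not_or]
        refine ⟨?_, (hl' β (List.mem_cons_of_mem _ hβ)).2⟩
        rintro rfl
        exact (List.nodup_cons.1 hl).1 hβ

theorem isSliceTower_cascadeList (hξ : IsKostantCascade R B ξ m) (hB : IsBase H B)
    (hord : ∀ i < m, (ord i).Nodup ∧ ∀ α, α ∈ ord i ↔ α ∈ Gam0 R B ξ i) (hi : i ≤ m) :
    IsSliceTower (locAlg R B ξ m) (cascadeList R B ξ ord i) := by
  induction i with
  | zero => trivial
  | succ i ih =>
    have hi' : i < m := hi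
    refine (ih hi'.le).append ?_
    have hV : ∀ a, a ∈ towerConstants (locAlg R B ξ m) (cascadeList R B ξ ord i) ↔
        a ∈ locAlg R B ξ m ∧ ∀ j < i, ∀ γ ∈ Gam R B ξ j, lieDer K (R.E γ) a = 0 := by
      intro a
      rw [mem_towerConstants, forall_mem_cascadeList_iff hξ hord hi'.le]
    have hxn := E_mem_nilradical (hξ.mem i hi').1 (R := R)
    refine ⟨fun a ha => ?_, fun a ha => ?_, ?_, lieDer_topPair_snd hξ hB hi', ?_⟩
    · rw [hV] at ha ⊢
      exact ⟨lieDer_mem_locAlg hξ hB hxn ha.1,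
        lieDer_of_mem_Gam_of_stagePos hξ hB hi'.le (hξ.mem i hi') ha.2⟩
    · exact locAlg_le_nilElements hξ hB hxn ((hV a).1 ha).1
    · rw [hV]
      exact ⟨topPair_snd_mem_locAlg hξ hB hi', fun j hj γ hγ =>
        lieDer_topPair_snd_of_lt hξ hB hi' hj hγ⟩
    · refine isSliceTower_rootPairs hξ hB hi' (s := ∅) (Set.empty_subset _) (fun a => ?_)
        (List.nodup_reverse.2 (hord i hi').1) fun α hα =>
          ⟨((hord i hi').2 α).1 (List.mem_reverse.1 hα), Set.notMem_empty α⟩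
      rw [Algebra.mem_inf, hV, mem_constants]
      simp [topPair]

end CascadeTower

/-! ### The projector as a homomorphism -/

section TowerHom

variable {K F : Type*} [Field K] [CharZero K] [Field F] [Algebra K F]
  {W : Subalgebra K F} {l : List (Derivation K F F × F)}

/-- The projection attached to a tower of slices, as a homomorphism. -/
def IsSliceTower.hom (h : IsSliceTower W l) : W →ₐ[K] F where
  toFun a := towerProj l (a : F)
  map_one' := towerProj_eq_self fun _ _ => one_mem _
  map_mul' a b := h.towerProj_mul a.2 b.2
  map_zero' := towerProj_eq_self fun _ _ => zero_mem _
  map_add' a b := h.towerProj_add a.2 b.2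
  commutes' r := towerProj_eq_self fun _ _ => Subalgebra.algebraMap_mem _ r

theorem IsSliceTower.towerProj_smul (h : IsSliceTower W l) (c : K) {a : F} (ha : a ∈ W) :
    towerProj l (c • a) = c • towerProj l a :=
  map_smul h.hom c ⟨a, ha⟩

end TowerHom

/-! ### Generators of the algebra and of the field of invariants -/

section Generation

variable {K g : Type*} [Field K] [CharZero K] [LieRing g] [LieAlgebra K g]
  [FiniteDimensional K g] [HasCentralRadical K g]
  {H : LieSubalgebra K g} [H.IsCartanSubalgebra] [IsTriangularizable K H g]
  {R : RootVectors H} {B : Set (Module.Dual K H)} {ξ : ℕ → Module.Dual K H}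
  {m i j : ℕ} {α β γ : Module.Dual K H} {x y : g}
  {ord : ℕ → List (Module.Dual K H)}

theorem mem_towerConstants_cascadeList (hξ : IsKostantCascade R B ξ m) (hB : IsBase H B)
    (hord : ∀ i < m, (ord i).Nodup ∧ ∀ α, α ∈ ord i ↔ α ∈ Gam0 R B ξ i) {a : Fld K g} :
    a ∈ towerConstants (locAlg R B ξ m) (cascadeList R B ξ ord m) ↔ a ∈ locInvariants R B ξ m := by
  rw [mem_towerConstants, forall_mem_cascadeList_iff hξ hord le_rfl,
    forall_mem_posRoots_iff hξ hB, ← mem_invariantField_iff fun x hx => isNilpotent_ad hB hx]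
  rfl

theorem mem_constants_of_mem_invariantField (hξ : IsKostantCascade R B ξ m) (hB : IsBase H B)
    (hord : ∀ i < m, (ord i).Nodup ∧ ∀ α, α ∈ ord i ↔ α ∈ Gam0 R B ξ i) {a : Fld K g}
    (ha : a ∈ invariantField R B) : ∀ p ∈ cascadeList R B ξ ord m, a ∈ constants p.1 := by
  rw [forall_mem_cascadeList_iff hξ hord le_rfl, forall_mem_posRoots_iff hξ hB,
    ← mem_invariantField_iff fun x hx => isNilpotent_ad hB hx]
  exact ha

theorem proj_eq_self (hξ : IsKostantCascade R B ξ m) (hB : IsBase H B)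
    (hord : ∀ i < m, (ord i).Nodup ∧ ∀ α, α ∈ ord i ↔ α ∈ Gam0 R B ξ i) {a : Fld K g}
    (ha : a ∈ invariantField R B) : proj R B ξ ord m a = a := by
  rw [proj_eq_towerProj]
  exact towerProj_eq_self (mem_constants_of_mem_invariantField hξ hB hord ha)

theorem proj_mem_locInvariants (hξ : IsKostantCascade R B ξ m) (hB : IsBase H B)
    (hord : ∀ i < m, (ord i).Nodup ∧ ∀ α, α ∈ ord i ↔ α ∈ Gam0 R B ξ i) {a : Fld K g}
    (ha : a ∈ locAlg R B ξ m) : proj R B ξ ord m a ∈ locInvariants R B ξ m := by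
  rw [proj_eq_towerProj, ← mem_towerConstants_cascadeList hξ hB hord]
  exact (isSliceTower_cascadeList hξ hB hord le_rfl).towerProj_mem ha

theorem cascadeElt_mem_invariantField (hξ : IsKostantCascade R B ξ m) (hB : IsBase H B)
    (hi : i < m) : cascadeElt R B ξ i ∈ invariantField R B := by
  rw [mem_invariantField_iff fun x hx => isNilpotent_ad hB hx]
  exact fun x hx => lieDer_cascadeElt hξ hB hi hx

/-- The projector as a homomorphism on the localized algebra. -/
theorem exists_projHom (hξ : IsKostantCascade R B ξ m) (hB : IsBase H B)
    (hord : ∀ i < m, (ord i).Nodup ∧ ∀ α, α ∈ ord i ↔ α ∈ Gam0 R B ξ i) :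
    ∃ φ : locAlg R B ξ m →ₐ[K] locInvariants R B ξ m,
      ∀ a, (φ a : Fld K g) = proj R B ξ ord m (a : Fld K g) := by
  have hT := isSliceTower_cascadeList hξ hB hord le_rfl
  have h : ∀ a, hT.hom a = proj R B ξ ord m (a : Fld K g) :=
    fun a => (proj_eq_towerProj m (a : Fld K g)).symm
  exact ⟨hT.hom.codRestrict _ fun a => by
    rw [h]; exact proj_mem_locInvariants hξ hB hord a.2, h⟩

theorem proj_slice (hξ : IsKostantCascade R B ξ m) (hB : IsBase H B)
    (hord : ∀ i < m, (ord i).Nodup ∧ ∀ α, α ∈ ord i ↔ α ∈ Gam0 R B ξ i)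
    {p : Derivation K (Fld K g) (Fld K g) × Fld K g} (hp : p ∈ cascadeList R B ξ ord m) :
    proj R B ξ ord m p.2 = 0 := by
  rw [proj_eq_towerProj]
  exact (isSliceTower_cascadeList hξ hB hord le_rfl).towerProj_slice hp

theorem proj_add (hξ : IsKostantCascade R B ξ m) (hB : IsBase H B)
    (hord : ∀ i < m, (ord i).Nodup ∧ ∀ α, α ∈ ord i ↔ α ∈ Gam0 R B ξ i) {a b : Fld K g}
    (ha : a ∈ locAlg R B ξ m) (hb : b ∈ locAlg R B ξ m) :
    proj R B ξ ord m (a + b) = proj R B ξ ord m a + proj R B ξ ord m b := by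
  simp only [proj_eq_towerProj]
  exact (isSliceTower_cascadeList hξ hB hord le_rfl).towerProj_add ha hb

theorem proj_mul (hξ : IsKostantCascade R B ξ m) (hB : IsBase H B)
    (hord : ∀ i < m, (ord i).Nodup ∧ ∀ α, α ∈ ord i ↔ α ∈ Gam0 R B ξ i) {a b : Fld K g}
    (ha : a ∈ locAlg R B ξ m) (hb : b ∈ locAlg R B ξ m) :
    proj R B ξ ord m (a * b) = proj R B ξ ord m a * proj R B ξ ord m b := by
  simp only [proj_eq_towerProj]
  exact (isSliceTower_cascadeList hξ hB hord le_rfl).towerProj_mul ha hb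

theorem proj_smul (hξ : IsKostantCascade R B ξ m) (hB : IsBase H B)
    (hord : ∀ i < m, (ord i).Nodup ∧ ∀ α, α ∈ ord i ↔ α ∈ Gam0 R B ξ i) (c : K) {a : Fld K g}
    (ha : a ∈ locAlg R B ξ m) :
    proj R B ξ ord m (c • a) = c • proj R B ξ ord m a := by
  simp only [proj_eq_towerProj]
  exact (isSliceTower_cascadeList hξ hB hord le_rfl).towerProj_smul c ha

/-- The copy of `E α` is, up to a scalar, the slice of the partner root `ξ i - α` times the cascade
element, and P kills slices. -/
theorem proj_tildeLin_Gam0 (hξ : IsKostantCascade R B ξ m) (hB : IsBase H B)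
    (hord : ∀ i < m, (ord i).Nodup ∧ ∀ α, α ∈ ord i ↔ α ∈ Gam0 R B ξ i) (hi : i < m)
    (hα : α ∈ Gam0 R B ξ i) : proj R B ξ ord m (tildeLin R B ξ i (R.E α)) = 0 := by
  have hβ := hξ.sub_mem_Gam0 hB hi hα
  have hs := rootPair_snd hξ hB hi hβ
  rw [sub_sub_cancel] at hs
  have hN := hξ.structConst_ne_zero hB hi hβ
  rw [sub_sub_cancel] at hN
  have h : tildeLin R B ξ i (R.E α) =
      structConst R (ξ i - α) α • ((rootPair R B ξ i (ξ i - α)).2 * cascadeElt R B ξ i) := by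
    rw [hs, smul_mul_assoc, smul_inv_smul₀ hN,
      inv_mul_cancel_right₀ (cascadeElt_ne_zero hξ hB hi)]
  have hQ := rootPair_snd_mem_locAlg hξ hB hi hβ
  have hZ := cascadeElt_mem_locAlg hξ hB hi
  rw [h, proj_smul hξ hB hord _ (mul_mem hQ hZ), proj_mul hξ hB hord hQ hZ,
    proj_slice hξ hB hord (mem_cascadeList.2 ⟨i, hi, Or.inr ⟨_, ((hord i hi).2 _).2 hβ, rfl⟩⟩),
    zero_mul, smul_zero]

theorem proj_tildeLin_coroot (hξ : IsKostantCascade R B ξ m) (hB : IsBase H B)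
    (hord : ∀ i < m, (ord i).Nodup ∧ ∀ α, α ∈ ord i ↔ α ∈ Gam0 R B ξ i) (hi : i < m) :
    proj R B ξ ord m (tildeLin R B ξ i (R.coroot (ξ i))) = 0 := by
  have h : tildeLin R B ξ i (R.coroot (ξ i)) =
      (-2 : K) • ((topPair R B ξ i).2 * cascadeElt R B ξ i) := by
    rw [topPair_snd hξ hB hi, neg_mul, smul_mul_assoc,
      inv_mul_cancel_right₀ (cascadeElt_ne_zero hξ hB hi), ← neg_smul, smul_smul]
    norm_num
  have hQ := topPair_snd_mem_locAlg hξ hB hi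
  have hZ := cascadeElt_mem_locAlg hξ hB hi
  rw [h, proj_smul hξ hB hord _ (mul_mem hQ hZ), proj_mul hξ hB hord hQ hZ,
    proj_slice hξ hB hord (mem_cascadeList.2 ⟨i, hi, Or.inl rfl⟩), zero_mul, smul_zero]

theorem proj_corrSpan (hξ : IsKostantCascade R B ξ m) (hB : IsBase H B)
    (hord : ∀ i < m, (ord i).Nodup ∧ ∀ α, α ∈ ord i ↔ α ∈ Gam0 R B ξ i) (hi : i < m)
    {a : Fld K g} (ha : a ∈ corrSpan R B ξ i (tildeLin R B ξ i)) : proj R B ξ ord m a = 0 := by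
  have hle := corrLin_tildeLin_mem_locAlg_of hξ hB hi
    fun x hx => tildeLin_mem_locAlg hξ hB hi.le hx
  induction ha using Submodule.span_induction with
  | zero => exact proj_eq_self hξ hB hord (zero_mem _)
  | add a b ha hb iha ihb => rw [proj_add hξ hB hord (hle ha) (hle hb), iha, ihb, add_zero]
  | smul c a ha iha => rw [proj_smul hξ hB hord c (hle ha), iha, smul_zero]
  | mem a ha =>
    obtain ⟨α, hα, β, hβ, rfl⟩ := ha
    have h1 := tildeLin_mem_locAlg hξ hB hi.le (E_mem_borelStage hα.1.1)
    have h2 := tildeLin_mem_locAlg hξ hB hi.le (E_mem_borelStage hβ.1.1)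
    rw [← cascadeElt_eq hξ hB hi, mul_assoc,
      proj_mul hξ hB hord h1 (mul_mem h2 (inv_cascadeElt_mem_locAlg hi)),
      proj_tildeLin_Gam0 hξ hB hord hi hα, zero_mul]

/-- Corrections are combinations of products with a factor killed by P, so P does not see the
tildes. -/
theorem proj_emb_eq_proj_tildeLin (hξ : IsKostantCascade R B ξ m) (hB : IsBase H B)
    (hord : ∀ i < m, (ord i).Nodup ∧ ∀ α, α ∈ ord i ↔ α ∈ Gam0 R B ξ i) (hi : i ≤ m)
    (hx : x ∈ borelStage R B ξ i) :
    proj R B ξ ord m (emb x) = proj R B ξ ord m (tildeLin R B ξ i x) := by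
  induction i with
  | zero => rfl
  | succ i ih =>
    have hi' : i < m := hi
    have hc := corrLin_mem (t := tildeLin R B ξ i) hξ hB hi' hx
    have h : tildeLin R B ξ i x =
        tildeLin R B ξ (i + 1) x + corrLin R B ξ i (tildeLin R B ξ i) x := by
      rw [tildeLin_succ, sub_add_cancel]
    rw [ih hi'.le (borelStage_succ_le hx), h, proj_add hξ hB hord (tildeLin_mem_locAlg hξ hB hi hx)
      (corrLin_tildeLin_mem_locAlg_of hξ hB hi'
        (fun x hx => tildeLin_mem_locAlg hξ hB hi'.le hx) hc), proj_corrSpan hξ hB hord hi' hc,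
      add_zero]

variable {ι : Type*} (h : ι → H)

theorem generators_mem_locInvariants (hξ : IsKostantCascade R B ξ m) (hB : IsBase H B)
    (hord : ∀ i < m, (ord i).Nodup ∧ ∀ α, α ∈ ord i ↔ α ∈ Gam0 R B ξ i)
    (k : posRoots H B ⊕ ι ⊕ Fin m) :
    generators R B ξ m ord h k ∈ locInvariants R B ξ m := by
  rcases k with α | k | i
  · exact proj_mem_locInvariants hξ hB hord (emb_mem_locAlg _)
  · exact proj_mem_locInvariants hξ hB hord (emb_mem_locAlg _)
  · exact ⟨cascadeElt_mem_locAlg hξ hB i.2, cascadeElt_mem_invariantField hξ hB i.2⟩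

variable {h} {A : Subalgebra K (Fld K g)}

/-- By linearity a spanning set of `g` suffices. Negative root vectors and the orthogonal complement
of the cascade yield generators by definition, `E (ξ i)` yields the cascade element, and the other
positive root vectors and the coroots of the cascade go to zero. -/
theorem proj_emb_mem (hξ : IsKostantCascade R B ξ m) (hB : IsBase H B)
    (hord : ∀ i < m, (ord i).Nodup ∧ ∀ α, α ∈ ord i ↔ α ∈ Gam0 R B ξ i)
    (hh : cascadeOrth ξ m ≤ Submodule.span K (Set.range h))
    (hA : ∀ k, generators R B ξ m ord h k ∈ A) (x : g) : proj R B ξ ord m (emb x) ∈ A := by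
  let N : Submodule K g :=
    { carrier := {x | proj R B ξ ord m (emb x) ∈ A}
      add_mem' := fun {x y} hx hy => by
        change proj R B ξ ord m (emb (x + y)) ∈ A
        rw [map_add, proj_add hξ hB hord (emb_mem_locAlg x) (emb_mem_locAlg y)]
        exact add_mem hx hy
      zero_mem' := by
        change proj R B ξ ord m (emb 0) ∈ A
        rw [map_zero, proj_eq_self hξ hB hord (zero_mem _)]
        exact zero_mem _
      smul_mem' := fun c x hx => by
        change proj R B ξ ord m (emb (c • x)) ∈ A
        rw [map_smul, proj_smul hξ hB hord c (emb_mem_locAlg x)]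
        exact Subalgebra.smul_mem _ hx c }
  change x ∈ N
  have htop : (⊤ : Submodule K g) ≤ N := by
    rw [← R.cartan_sup_span_E]
    refine sup_le (fun y hy => ?_) (Submodule.span_le.2 ?_)
    · have hcor : ∀ i < m, (R.coroot (ξ i) : g) ∈ N := by
        intro i hi
        change proj R B ξ ord m (emb _) ∈ A
        rw [proj_emb_eq_proj_tildeLin hξ hB hord hi.le (coroot_mem_borelStage hξ hB hi),
          proj_tildeLin_coroot hξ hB hord hi]
        exact zero_mem _
      have horth : (cascadeOrth ξ m).map H.toSubmodule.subtype ≤ N := by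
        refine (Submodule.map_mono hh).trans ?_
        rw [Submodule.map_span, Submodule.span_le]
        rintro _ ⟨_, ⟨k, rfl⟩, rfl⟩
        exact hA (Sum.inr (Sum.inl k))
      -- The coroots of the cascade are dual to the `ξ i` up to the factor 2, so this is the
      -- projection of `y` to the orthogonal complement along them.
      have hmem : (⟨y, hy⟩ : H) - ∑ i : Fin m, (ξ i ⟨y, hy⟩ / 2) • R.coroot (ξ i) ∈
          cascadeOrth ξ m := by
        rw [mem_cascadeOrth]
        intro j hj
        rw [map_sub, map_sum, Finset.sum_eq_single (⟨j, hj⟩ : Fin m)]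
        · rw [map_smul, R.apply_coroot_self (hξ.mem_roots hj), smul_eq_mul,
            div_mul_cancel₀ _ two_ne_zero, sub_self]
        · intro i _ hij
          rw [map_smul, hξ.xi_apply_coroot hB hj i.2 fun h' => hij (Fin.ext h'.symm), smul_zero]
        · exact fun h' => absurd (Finset.mem_univ _) h'
      have h1 := horth (Submodule.mem_map_of_mem hmem)
      have h2 : ((∑ i : Fin m, (ξ i ⟨y, hy⟩ / 2) • R.coroot (ξ i) : H) : g) ∈ N := by
        change H.toSubmodule.subtype (∑ i : Fin m, (ξ i ⟨y, hy⟩ / 2) • R.coroot (ξ i)) ∈ N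
        rw [map_sum]
        refine sum_mem fun i _ => ?_
        rw [map_smul]
        exact Submodule.smul_mem _ _ (hcor i i.2)
      have h3 := add_mem h1 h2
      rw [map_sub] at h3
      change y - _ + _ ∈ N at h3
      rw [← sub_sub_self y y]
      simpa using h3
    · rintro _ ⟨α, hα, rfl⟩
      change proj R B ξ ord m (emb (R.E α)) ∈ A
      rcases hB.pos_or_neg α hα with hpos | hneg
      · obtain ⟨i, hi, hαi⟩ := hξ.exists_mem_Gam hB ⟨hα, hpos⟩
        rw [proj_emb_eq_proj_tildeLin hξ hB hord hi.le (E_mem_borelStage hαi.1)]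
        rcases eq_or_mem_Gam0 hαi with rfl | hα0
        · rw [← cascadeElt_eq hξ hB hi,
            proj_eq_self hξ hB hord (cascadeElt_mem_invariantField hξ hB hi)]
          exact hA (Sum.inr (Sum.inr ⟨i, hi⟩))
        · rw [proj_tildeLin_Gam0 hξ hB hord hi hα0]
          exact zero_mem _
      · have := hA (Sum.inl ⟨-α, R.neg_mem_roots hα, hneg⟩)
        rw [generators, Sum.elim_inl, neg_neg] at this
        exact this
  exact htop trivial

/-- An invariant equals its own projection, so it is enough to project the generators of S(g)_*. The
target `A` is arbitrary in order to serve for the generated subalgebra and for the generated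
subfield. -/
theorem locInvariants_le (hξ : IsKostantCascade R B ξ m) (hB : IsBase H B)
    (hord : ∀ i < m, (ord i).Nodup ∧ ∀ α, α ∈ ord i ↔ α ∈ Gam0 R B ξ i)
    (hh : cascadeOrth ξ m ≤ Submodule.span K (Set.range h))
    (hA : ∀ k, generators R B ξ m ord h k ∈ A) (hA' : ∀ i < m, (cascadeElt R B ξ i)⁻¹ ∈ A) :
    locInvariants R B ξ m ≤ A := by
  obtain ⟨φ, hφ⟩ := exists_projHom hξ hB hord
  have hle : locAlg R B ξ m ≤
      (A.comap ((locInvariants R B ξ m).val.comp φ)).map (locAlg R B ξ m).val := by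
    refine locAlg_le (fun x => ⟨⟨emb x, emb_mem_locAlg x⟩, ?_, rfl⟩)
      fun i hi => ⟨⟨_, inv_cascadeElt_mem_locAlg hi⟩, ?_, rfl⟩
    · change (φ _ : Fld K g) ∈ A
      rw [hφ]
      exact proj_emb_mem hξ hB hord hh hA x
    · change (φ _ : Fld K g) ∈ A
      rw [hφ, proj_eq_self hξ hB hord (inv_mem (cascadeElt_mem_invariantField hξ hB hi))]
      exact hA' i hi
  intro a ha
  obtain ⟨b, hb, rfl⟩ := hle ha.1
  change (φ b : Fld K g) ∈ A at hb
  rw [hφ] at hb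
  have := proj_eq_self hξ hB hord ha.2
  change proj R B ξ ord m (b : Fld K g) = b at this
  rw [this] at hb
  exact hb

theorem adjoin_generators_eq (hξ : IsKostantCascade R B ξ m) (hB : IsBase H B)
    (hord : ∀ i < m, (ord i).Nodup ∧ ∀ α, α ∈ ord i ↔ α ∈ Gam0 R B ξ i)
    (hh : cascadeOrth ξ m ≤ Submodule.span K (Set.range h)) :
    Algebra.adjoin K (Set.range (generators R B ξ m ord h) ∪
      {q | ∃ i < m, q = (cascadeElt R B ξ i)⁻¹}) = locInvariants R B ξ m := by
  refine le_antisymm (Algebra.adjoin_le ?_) (locInvariants_le hξ hB hord hh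
    (fun k => Algebra.subset_adjoin (Or.inl ⟨k, rfl⟩))
    fun i hi => Algebra.subset_adjoin (Or.inr ⟨i, hi, rfl⟩))
  rintro _ (⟨k, rfl⟩ | ⟨i, hi, rfl⟩)
  · exact generators_mem_locInvariants h hξ hB hord k
  · exact ⟨inv_cascadeElt_mem_locAlg hi, (invariantField R B).inv_mem (cascadeElt_mem_invariantField hξ hB hi)⟩

theorem locInvariants_le_fieldAdjoin (hξ : IsKostantCascade R B ξ m) (hB : IsBase H B)
    (hord : ∀ i < m, (ord i).Nodup ∧ ∀ α, α ∈ ord i ↔ α ∈ Gam0 R B ξ i)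
    (hh : cascadeOrth ξ m ≤ Submodule.span K (Set.range h)) :
    locInvariants R B ξ m ≤
      (IntermediateField.adjoin K (Set.range (generators R B ξ m ord h))).toSubalgebra := by
  have hg : ∀ k, generators R B ξ m ord h k ∈
      IntermediateField.adjoin K (Set.range (generators R B ξ m ord h)) :=
    fun k => IntermediateField.subset_adjoin _ _ ⟨k, rfl⟩
  refine locInvariants_le hξ hB hord hh hg fun i hi => ?_
  exact IntermediateField.inv_mem _ (hg (Sum.inr (Sum.inr ⟨i, hi⟩)))

theorem fieldAdjoin_generators_eq (hξ : IsKostantCascade R B ξ m) (hB : IsBase H B)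
    (hord : ∀ i < m, (ord i).Nodup ∧ ∀ α, α ∈ ord i ↔ α ∈ Gam0 R B ξ i)
    (hh : cascadeOrth ξ m ≤ Submodule.span K (Set.range h)) :
    IntermediateField.adjoin K (Set.range (generators R B ξ m ord h)) = invariantField R B := by
  refine le_antisymm (IntermediateField.adjoin_le_iff.2 ?_) fun f hf => ?_
  · rintro _ ⟨k, rfl⟩
    exact (generators_mem_locInvariants h hξ hB hord k).2
  · have hle := locInvariants_le_fieldAdjoin hξ hB hord hh
    obtain ⟨a, b, hb, hab⟩ := IsFractionRing.div_surjective (A := SymmetricAlgebra K g) f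
    have hb0 : algebraMap _ (Fld K g) b ≠ 0 :=
      IsFractionRing.to_map_ne_zero_of_mem_nonZeroDivisors hb
    -- An arbitrary denominator of `f` is traded for an invariant one by descending the tower.
    obtain ⟨c, hc, hc0, hfc⟩ := (isSliceTower_cascadeList hξ hB hord le_rfl).exists_mul_eq
      (mem_constants_of_mem_invariantField hξ hB hord hf)
      ⟨algebraMap _ (Fld K g) b, algebraMap_mem_of_emb_mem emb_mem_locAlg b, hb0, by
        rw [← hab, div_mul_cancel₀ _ hb0]
        exact algebraMap_mem_of_emb_mem emb_mem_locAlg a⟩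
    rw [mem_towerConstants_cascadeList hξ hB hord] at hc hfc
    have := IntermediateField.div_mem _ (hle hfc) (hle hc)
    rwa [mul_div_cancel_right₀ _ hc0] at this

end Generation

/-! ### Algebraic independence -/

section Independence

theorem finrank_le_trdeg (K g : Type*) [Field K] [LieRing g] [LieAlgebra K g]
    [FiniteDimensional K g] :
    (finrank K g : Cardinal) ≤ Algebra.trdeg K (Fld K g) := by
  have key : ∀ f : MvPolynomial (Fin (finrank K g)) K →ₐ[K] Fld K g, Function.Injective f →
      (finrank K g : Cardinal) ≤ Algebra.trdeg K (Fld K g) := by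
    intro f hf
    have h := ((MvPolynomial.algebraicIndependent_X (Fin (finrank K g)) K).map'
      hf).lift_cardinalMk_le_trdeg
    rwa [Cardinal.mk_fin, Cardinal.lift_natCast, Cardinal.nat_le_lift_iff] at h
  exact key ((IsScalarTower.toAlgHom K (SymmetricAlgebra K g) (Fld K g)).comp
    (SymmetricAlgebra.equivMvPolynomial (finBasis K g)).symm.toAlgHom)
    ((IsFractionRing.injective (SymmetricAlgebra K g) (Fld K g)).comp
      (SymmetricAlgebra.equivMvPolynomial (finBasis K g)).symm.injective)

/-- A family of at most `trdeg` elements which generates a field is algebraically independent. -/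
theorem algebraicIndependent_of_adjoin_eq_top {K F κ : Type*} [Field K] [Field F] [Algebra K F]
    [Finite κ] {z : κ → F} (hz : IntermediateField.adjoin K (Set.range z) = ⊤)
    (hc : (Nat.card κ : Cardinal) ≤ Algebra.trdeg K F) : AlgebraicIndependent K z := by
  have halg : Algebra.IsAlgebraic (Algebra.adjoin K (Set.range z)) F := by
    refine ⟨fun f => ?_⟩
    have hf : f ∈ IntermediateField.adjoin K (Set.range z) := by rw [hz]; trivial
    obtain ⟨r, hr, s, hs, rfl⟩ := IntermediateField.mem_adjoin_iff_div.1 hf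
    rw [div_eq_mul_inv]
    exact (isAlgebraic_algebraMap (⟨r, hr⟩ : Algebra.adjoin K (Set.range z))).mul
      (isAlgebraic_algebraMap (⟨s, hs⟩ : Algebra.adjoin K (Set.range z))).inv
  refine (Algebra.IsAlgebraic.isTranscendenceBasis_of_lift_le_trdeg_of_finite K z ?_).1
  rw [← Nat.cast_card, Cardinal.lift_natCast, Cardinal.nat_le_lift_iff]
  exact hc

variable {K g : Type*} [Field K] [CharZero K] [LieRing g] [LieAlgebra K g]
  [FiniteDimensional K g] [HasCentralRadical K g]
  {H : LieSubalgebra K g} [H.IsCartanSubalgebra] [IsTriangularizable K H g]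
  {R : RootVectors H} {B : Set (Module.Dual K H)} {ξ : ℕ → Module.Dual K H}
  {m : ℕ} {ord : ℕ → List (Module.Dual K H)} {ι : Type*} {h : ι → H}

theorem finite_posRoots : Finite (posRoots H B) :=
  (RootVectors.finite_roots.subset fun _ h => h.1).to_subtype

theorem two_mul_card_posRoots_le (R : RootVectors H) (hB : IsBase H B) :
    2 * Nat.card (posRoots H B) ≤ finrank K (Submodule.span K (R.E '' roots H)) := by
  have := (RootVectors.finite_roots (H := H)).to_subtype
  have := Fintype.ofFinite (roots H)
  have h1 := finrank_span_eq_card R.linearIndependent_E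
  have h2 : Set.range (fun α : roots H => R.E α) = R.E '' roots H :=
    (Set.image_eq_range R.E (roots H)).symm
  rw [h2] at h1
  rw [h1, ← Nat.card_eq_fintype_card]
  have := finite_posRoots (B := B)
  rw [two_mul, ← Nat.card_sum]
  let f : posRoots H B ⊕ posRoots H B → roots H :=
    Sum.elim (fun α => ⟨α, α.2.1⟩) (fun α => ⟨-α, R.neg_mem_roots α.2.1⟩)
  refine Nat.card_le_card_of_injective f ?_
  rintro (α | α) (β | β) hf
  · exact congrArg Sum.inl (Subtype.ext (congrArg (fun γ : roots H => (γ : Module.Dual K H)) hf))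
  · have : (α : Module.Dual K H) = -β := congrArg (fun γ : roots H => (γ : Module.Dual K H)) hf
    exact absurd (this ▸ α.2) (hB.neg_notMem_posRoots β.2)
  · have : -(α : Module.Dual K H) = β := congrArg (fun γ : roots H => (γ : Module.Dual K H)) hf
    exact absurd (this ▸ β.2) (hB.neg_notMem_posRoots α.2)
  · have : -(α : Module.Dual K H) = -β := congrArg (fun γ : roots H => (γ : Module.Dual K H)) hf
    exact congrArg Sum.inr (Subtype.ext (neg_injective this))

theorem finrank_cascadeOrth_add (hξ : IsKostantCascade R B ξ m) (hB : IsBase H B) :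
    finrank K (cascadeOrth ξ m) + m = finrank K H := by
  let f : H →ₗ[K] Fin m → K := LinearMap.pi fun i => ξ i
  have hker : LinearMap.ker f = cascadeOrth ξ m := LinearMap.ker_pi _
  have hrange : LinearMap.range f = ⊤ := by
    refine LinearMap.range_eq_top.2 fun c => ⟨∑ i : Fin m, (c i / 2) • R.coroot (ξ i), ?_⟩
    ext j
    change ξ j _ = _
    rw [map_sum, Finset.sum_eq_single j]
    · rw [map_smul, R.apply_coroot_self (hξ.mem_roots j.2), smul_eq_mul,
        div_mul_cancel₀ _ two_ne_zero]
    · intro i _ hij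
      rw [map_smul, hξ.xi_apply_coroot hB j.2 i.2 fun h' => hij (Fin.ext h'.symm), smul_zero]
    · exact fun h' => absurd (Finset.mem_univ _) h'
  have := f.finrank_range_add_finrank_ker
  rw [hker, hrange, finrank_top, finrank_fin_fun] at this
  omega

theorem finrank_cartan_add (R : RootVectors H) :
    finrank K H + finrank K (Submodule.span K (R.E '' roots H)) = finrank K g := by
  have := Submodule.finrank_sup_add_finrank_inf_eq H.toSubmodule
    (Submodule.span K (R.E '' roots H))
  rw [R.cartan_sup_span_E, R.disjoint_cartan_span_E.eq_bot, finrank_top, finrank_bot,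
    add_zero] at this
  exact this.symm

/-- As the `Gam j` are disjoint, the slices can be indexed by positive roots, which gives the number
needed for the count. -/
theorem exists_slice_family (hξ : IsKostantCascade R B ξ m)
    (hord : ∀ i < m, (ord i).Nodup ∧ ∀ α, α ∈ ord i ↔ α ∈ Gam0 R B ξ i) :
    ∃ Q : posRoots H B → Fld K g, ∀ p ∈ cascadeList R B ξ ord m, p.2 ∈ Set.range Q := by
  have hQ : ∀ α : posRoots H B, ∃ q : Fld K g,
      (∀ j < m, (α : Module.Dual K H) = ξ j → q = (topPair R B ξ j).2) ∧
      ∀ j < m, (α : Module.Dual K H) ∈ Gam0 R B ξ j → q = (rootPair R B ξ j α).2 := by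
    intro α
    by_cases h1 : ∃ j < m, (α : Module.Dual K H) = ξ j
    · obtain ⟨j, hj, hα⟩ := h1
      have hαj : (α : Module.Dual K H) ∈ Gam R B ξ j := hα ▸ hξ.xi_mem_Gam hj
      refine ⟨(topPair R B ξ j).2, fun k hk hαk => ?_, fun k hk hαk => ?_⟩
      · rw [IsKostantCascade.Gam_disjoint hαj (hαk ▸ hξ.xi_mem_Gam hk)]
      · obtain rfl := IsKostantCascade.Gam_disjoint hαj hαk.1
        exact absurd hα hαk.2
    · by_cases h2 : ∃ j < m, (α : Module.Dual K H) ∈ Gam0 R B ξ j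
      · obtain ⟨j, hj, hα⟩ := h2
        refine ⟨(rootPair R B ξ j α).2, fun k hk hαk => absurd ⟨k, hk, hαk⟩ h1,
          fun k hk hαk => ?_⟩
        rw [IsKostantCascade.Gam_disjoint hα.1 hαk.1]
      · exact ⟨0, fun k hk hαk => absurd ⟨k, hk, hαk⟩ h1, fun k hk hαk => absurd ⟨k, hk, hαk⟩ h2⟩
  choose Q hQ1 hQ2 using hQ
  refine ⟨Q, fun p hp => ?_⟩
  obtain ⟨j, hj, rfl | ⟨α, hα, rfl⟩⟩ := mem_cascadeList.1 hp
  · exact ⟨⟨ξ j, (hξ.mem j hj).1⟩, hQ1 _ j hj rfl⟩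
  · have hα' := ((hord j hj).2 α).1 hα
    exact ⟨⟨α, hα'.1.1.1⟩, hQ2 _ j hj hα'⟩

theorem cascadeOrth_le_span (b : Module.Basis ι K (cascadeOrth ξ m)) :
    cascadeOrth ξ m ≤ Submodule.span K (Set.range fun k => (b k : H)) := by
  have := congrArg (Submodule.map (cascadeOrth ξ m).subtype) b.span_eq
  rw [Submodule.map_span, Submodule.map_subtype_top, ← Set.range_comp] at this
  exact this.ge

theorem algebraicIndependent_generators (hξ : IsKostantCascade R B ξ m) (hB : IsBase H B)
    (hord : ∀ i < m, (ord i).Nodup ∧ ∀ α, α ∈ ord i ↔ α ∈ Gam0 R B ξ i)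
    (b : Module.Basis ι K (cascadeOrth ξ m)) :
    AlgebraicIndependent K (generators R B ξ m ord fun k => (b k : H)) := by
  have hh := cascadeOrth_le_span b
  obtain ⟨Q, hQ⟩ := exists_slice_family (B := B) hξ hord
  have := finite_posRoots (B := B)
  have : Finite ι := Module.Finite.finite_basis b
  let z : (posRoots H B ⊕ ι ⊕ Fin m) ⊕ posRoots H B → Fld K g :=
    Sum.elim (generators R B ξ m ord fun k => (b k : H)) Q
  have hz : IntermediateField.adjoin K (Set.range z) = ⊤ := by
    have hgen : Set.range (generators R B ξ m ord fun k => (b k : H)) ⊆ Set.range z := by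
      rintro _ ⟨k, rfl⟩
      exact ⟨Sum.inl k, rfl⟩
    -- The tower recovers S(g)_* from the invariants and the slices, so adding the slices to the
    -- system generates all of F.
    have hW : locAlg R B ξ m ≤ (IntermediateField.adjoin K (Set.range z)).toSubalgebra := by
      refine (isSliceTower_cascadeList hξ hB hord le_rfl).le_adjoin.trans (Algebra.adjoin_le ?_)
      rintro a (ha | ⟨p, hp, rfl⟩)
      · exact IntermediateField.adjoin.mono _ _ _ hgen (locInvariants_le_fieldAdjoin hξ hB hord hh
          ((mem_towerConstants_cascadeList hξ hB hord).1 ha))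
      · obtain ⟨α, hα⟩ := hQ p hp
        exact IntermediateField.subset_adjoin _ _ ⟨Sum.inr α, hα⟩
    rw [eq_top_iff]
    intro f _
    obtain ⟨a, b, -, rfl⟩ := IsFractionRing.div_surjective (A := SymmetricAlgebra K g) f
    exact IntermediateField.div_mem _ (hW (algebraMap_mem_of_emb_mem emb_mem_locAlg a))
      (hW (algebraMap_mem_of_emb_mem emb_mem_locAlg b))
  -- Positive roots counted twice plus (dim H - m) + m; opposite roots and `H` fit independently
  -- into `g`.
  have hcard : Nat.card ((posRoots H B ⊕ ι ⊕ Fin m) ⊕ posRoots H B) ≤ finrank K g := by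
    have h1 := two_mul_card_posRoots_le R hB
    have h2 := finrank_cascadeOrth_add hξ hB
    have h3 := finrank_cartan_add R
    rw [finrank_eq_nat_card_basis b] at h2
    simp only [Nat.card_sum, Nat.card_fin]
    omega
  exact (algebraicIndependent_of_adjoin_eq_top hz
    ((Nat.cast_le.2 hcard).trans (finrank_le_trdeg K g))).comp Sum.inl Sum.inl_injective

end Independence

end

end AdjointProjector

open AdjointProjector in
theorem theorem5 {K g : Type*} [Field K] [CharZero K] [LieRing g] [LieAlgebra K g]
    [FiniteDimensional K g] [LieAlgebra.HasCentralRadical K g]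
    (H : LieSubalgebra K g) [H.IsCartanSubalgebra] [LieModule.IsTriangularizable K H g]
    (R : RootVectors H) (B : Set (Module.Dual K H)) (hB : IsBase H B)
    (m : ℕ) (ξ : ℕ → Module.Dual K H) (hξ : IsKostantCascade R B ξ m)
    (ord : ℕ → List (Module.Dual K H))
    (hord : ∀ i < m, (ord i).Nodup ∧ ∀ α, α ∈ ord i ↔ α ∈ Gam0 R B ξ i)
    {ι : Type*} (h : Module.Basis ι K (cascadeOrth ξ m)) :
    -- the derivations `D_x`, `x ∈ u`, are locally nilpotent on `S(g)_*`
    (∀ x ∈ nilradical R B, ∀ a ∈ locAlg R B ξ m, ∃ k : ℕ, (lieDer K x)^[k] a = 0) ∧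
    -- `P` is a homomorphism `S(g) → S(g)_*^U` which is the identity on `S(g)^U`
    (∃ P : SymmetricAlgebra K g →ₐ[K] locInvariants R B ξ m,
      (∀ a, (P a : Fld K g) = proj R B ξ ord m (algebraMap _ (Fld K g) a)) ∧
      ∀ a, algebraMap _ (Fld K g) a ∈ invariantField R B →
        (P a : Fld K g) = algebraMap _ (Fld K g) a) ∧
    -- the system is algebraically independent and generates `S(g)_*^U`, the elements of `Ξ`
    -- being invertible there
    AlgebraicIndependent K (generators R B ξ m ord fun k => (h k : H)) ∧
    Algebra.adjoin K (Set.range (generators R B ξ m ord fun k => (h k : H)) ∪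
      {q | ∃ i < m, q = (cascadeElt R B ξ i)⁻¹}) = locInvariants R B ξ m ∧
    -- it generates the field of `U`-invariants
    IntermediateField.adjoin K (Set.range (generators R B ξ m ord fun k => (h k : H))) =
      invariantField R B := by
  have hh := cascadeOrth_le_span h
  refine ⟨fun x hx a ha => locAlg_le_nilElements hξ hB hx ha, ?_,
    algebraicIndependent_generators hξ hB hord h, adjoin_generators_eq hξ hB hord hh,
    fieldAdjoin_generators_eq hξ hB hord hh⟩
  obtain ⟨φ, hφ⟩ := exists_projHom hξ hB hord
  refine ⟨φ.comp ((IsScalarTower.toAlgHom K (SymmetricAlgebra K g) (Fld K g)).codRestrict _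
    fun a => algebraMap_mem_of_emb_mem emb_mem_locAlg a), fun a => hφ _, fun a ha => ?_⟩
  exact (hφ _).trans (proj_eq_self hξ hB hord ha)
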